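/- All logarithms are to base $2$. Fix integers $\ell$ and $\rho\ge 1$. Put $n=\ell^2$ (the number of vertices of the $\ell\times\ell$ input grid), $\eta=2^{\lceil\sqrt{\log n}\rceil}$ and $d_h=\eta^{\rho-h+3}$ for $1\le h\le\rho$, and assume $d_1=\eta^{\rho+2}<\ell$. Let $\ell'$ be the largest multiple of $\eta^{\rho+2}$ smaller than $\ell$, let $\tilde G$ be the $\ell'\times\ell'$ grid, and let $R^*$ be a row of $\ell'$ vertices disjoint from $\tilde G$. **Squares.** A collection of intervals of $\{1,\dots,\ell'\}$ is $d$-canonical if every interval has exactly $d$ elements and $|i-j|>d$ whenever $i,j$ lie in two distinct intervals of the collection. A family of subgrids of $\tilde G$ is a $d$-canonical family of squares if it consists of all $Q(I,I')$ (rows $I$, columns $I'$) with $I\in\mathcal I$, $I'\in\mathcal I'$, for two $d$-canonical collections $\mathcal I,\mathcal I'$. A hierarchical system of squares is a sequence $\tilde{\mathcal H}=(\mathcal Q_1,\dots,\mathcal Q_\rho)$ where $\mathcal Q_h$ is a $d_h$-canonical family of squares and, for $h>1$, every $Q\in\mathcal Q_h$ is contained in some square of $\mathcal Q_{h-1}$,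 its parent-square. Its vertices are those in $\bigcup_{Q\in\mathcal Q_\rho}V(Q)$. **Colors.** Let $\ell_1\ge\dots\ge\ell_\rho$ be integral powers of $\eta$ with $\ell_1\mid\ell'$. For each $h$, partition $R^*$ into consecutive intervals of $\ell_h$ vertices each; every such interval $I$ has its own level-$h$ color $c_h(I)$, and $\chi_h$ is the set of level-$h$ colors. The color $c_h(I)$ is an ancestor of $c_{h'}(I')$ ($h\le h'$) if $I'\subseteq I$, and $c_{h+1}(I')$ is then called a child-color of $c_h(I)$ in the case $h'=h+1$. Let $\mathcal C=(\chi_1,\dots,\chi_\rho)$. A coloring $f$ of $\tilde{\mathcal H}$ by $\mathcal C$ assigns to every level-$h$ square a color in $\chi_h$, for every $h$, so that the color of each square of level $h>1$ is a child-color of the color of its parent-square. **Hierarchical Square Coloring (HSC).** The input consists of $\tilde{\mathcal H}$, $\mathcal C$ and a finite multiset $U$ of vertices of $\tilde{\mathcal H}$, each with an assigned level-$\rho$ color; its level-$h$ color is the level-$h$ ancestor of that color. A solution is a coloring $f$ of $\tilde{\mathcal H}$ by $\mathcal C$ and a sub-multiset $U'\subseteq U$ such that every $t\in U'$ has the same level-$\rho$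 color as the level-$\rho$ square containing it, and for every level $1\le h\le\rho$ and every level-$h$ color $c_h$, at most $d_h$ elements of $U'$ have level-$h$ color $c_h$. The goal is to maximize $|U'|$. **Theorem 6.1.** There is a constant $C>0$ such that for every $K$ there is a randomized algorithm which, on every HSC instance, always runs in time polynomial in $n+|U|$ and always returns a solution $(f,U')$, and which satisfies $$|U''|\le C\,\log^4 n\cdot|U'|\quad\text{for every solution }(f'',U'')$$ with probability at least $1-n^{-K}$. The same algorithm, with the same $C$, has this property also when $n$ is replaced by $|U|$ in the approximation factor and in the probability, provided $|U|\ge2$. **Consequence (Theorem 3.7).** Let $\tilde{\mathcal M}$ be a set of demand pairs $(s,t)$, $s\in R^*$, $t$ a vertex of $\tilde{\mathcal H}$. A set $\tilde{\mathcal M}'\subseteq\tilde{\mathcal M}$ is perfect for a coloring $f$ if all its sources and all its destinations are distinct; for each $(s,t)\in\tilde{\mathcal M}'$, the source $s$ lies in the interval of the color of the level-$\rho$ square containing $t$; and for each $h$ and each level-$h$ color, at most $d_h$ pairs of $\tilde{\mathcal M}'$ have their source in the interval of that color. There is a constant $C>0$ such that for every $K$ there is a randomized algorithm which, given $\tilde{\mathcal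 H}$, $\mathcal C$ and $\tilde{\mathcal M}$, always runs in time polynomial in $n+|\tilde{\mathcal M}|$ and always returns a coloring $f$ and a set $\tilde{\mathcal M}'$ that is perfect for $f$, and which with probability at least $1-n^{-K}$ satisfies $|\tilde{\mathcal M}''|\le 2^{C\sqrt{\log n}}\,|\tilde{\mathcal M}'|$ for every $\tilde{\mathcal M}''\subseteq\tilde{\mathcal M}$ that is perfect for some coloring. -/

import Mathlib

open MeasureTheory

/-! ### A randomized random-access machine with unit-cost steps -/

namespace RandRAM

/-- A machine state: scalar registers, integer arrays (both named by natural numbers, of which a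
program mentions finitely many), and the stream of random bits that have not been read yet. -/
structure State where
  reg : ℕ → ℕ
  arr : ℕ → ℕ → ℕ
  coins : ℕ → Bool

/-- Arithmetic expressions. The only arithmetic operations are addition and truncated subtraction,
so a computation of `t` steps lengthens the numbers by at most `O(t)` bits and unit cost is
polynomially equivalent to Turing machine time. -/
inductive Expr where
  | const (k : ℕ)
  | reg (x : ℕ)
  | get (a : ℕ) (i : Expr)
  | add (e₁ e₂ : Expr)
  | sub (e₁ e₂ : Expr)

def Expr.eval (s : State) : Expr → ℕ
  | .const k => k
  | .reg x => s.reg x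
  | .get a i => s.arr a (i.eval s)
  | .add e₁ e₂ => e₁.eval s + e₂.eval s
  | .sub e₁ e₂ => e₁.eval s - e₂.eval s

/-- Every node of an expression costs one step. -/
def Expr.cost : Expr → ℕ
  | .const _ => 1
  | .reg _ => 1
  | .get _ i => i.cost + 1
  | .add e₁ e₂ => e₁.cost + e₂.cost + 1
  | .sub e₁ e₂ => e₁.cost + e₂.cost + 1

/-- Programs. `flip x` puts a fresh random bit into register `x`; a condition `e` is true when its
value is nonzero. -/
inductive Prog where
  | skip
  | assign (x : ℕ) (e : Expr)
  | store (a : ℕ) (i e : Expr)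
  | flip (x : ℕ)
  | seq (p q : Prog)
  | ite (e : Expr) (p q : Prog)
  | loop (e : Expr) (p : Prog)

def State.setReg (s : State) (x v : ℕ) : State :=
  { s with reg := Function.update s.reg x v }

def State.setArr (s : State) (a i v : ℕ) : State :=
  { s with arr := Function.update s.arr a (Function.update (s.arr a) i v) }

def State.flip (s : State) (x : ℕ) : State :=
  { s.setReg x (s.coins 0).toNat with coins := fun j => s.coins (j + 1) }

/-- `Exec p s s' t`: the program `p`, started in state `s`, halts in state `s'` after `t` steps. -/
inductive Exec : Prog → State → State → ℕ → Prop where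
  | skip (s : State) : Exec .skip s s 1
  | assign (x : ℕ) (e : Expr) (s : State) :
      Exec (.assign x e) s (s.setReg x (e.eval s)) (e.cost + 1)
  | store (a : ℕ) (i e : Expr) (s : State) :
      Exec (.store a i e) s (s.setArr a (i.eval s) (e.eval s)) (i.cost + e.cost + 1)
  | flip (x : ℕ) (s : State) : Exec (.flip x) s (s.flip x) 1
  | seq {p q : Prog} {s s₁ s₂ : State} {t₁ t₂ : ℕ} :
      Exec p s s₁ t₁ → Exec q s₁ s₂ t₂ → Exec (.seq p q) s s₂ (t₁ + t₂)
  | iteTrue {e : Expr} {p q : Prog} {s s₁ : State} {t : ℕ} :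
      e.eval s ≠ 0 → Exec p s s₁ t → Exec (.ite e p q) s s₁ (e.cost + 1 + t)
  | iteFalse {e : Expr} {p q : Prog} {s s₁ : State} {t : ℕ} :
      e.eval s = 0 → Exec q s s₁ t → Exec (.ite e p q) s s₁ (e.cost + 1 + t)
  | loopTrue {e : Expr} {p : Prog} {s s₁ s₂ : State} {t₁ t₂ : ℕ} :
      e.eval s ≠ 0 → Exec p s s₁ t₁ → Exec (.loop e p) s₁ s₂ t₂ →
      Exec (.loop e p) s s₂ (e.cost + 1 + t₁ + t₂)
  | loopFalse {e : Expr} {p : Prog} {s : State} :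
      e.eval s = 0 → Exec (.loop e p) s s (e.cost + 1)

/-- The machine is deterministic once the stream of random bits is fixed. -/
theorem Exec.deterministic {p : Prog} {s s₁ s₂ : State} {t₁ t₂ : ℕ}
    (h₁ : Exec p s s₁ t₁) (h₂ : Exec p s s₂ t₂) : s₁ = s₂ ∧ t₁ = t₂ := by
  induction h₁ generalizing s₂ t₂ with
  | skip s => cases h₂; exact ⟨rfl, rfl⟩
  | assign x e s => cases h₂; exact ⟨rfl, rfl⟩
  | store a i e s => cases h₂; exact ⟨rfl, rfl⟩
  | flip x s => cases h₂; exact ⟨rfl, rfl⟩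
  | seq _ _ ihp ihq =>
    cases h₂ with
    | seq hp hq =>
      obtain ⟨rfl, rfl⟩ := ihp hp
      obtain ⟨rfl, rfl⟩ := ihq hq
      exact ⟨rfl, rfl⟩
  | iteTrue he _ ih =>
    cases h₂ with
    | iteTrue _ hp => obtain ⟨rfl, rfl⟩ := ih hp; exact ⟨rfl, rfl⟩
    | iteFalse he' _ => exact absurd he' he
  | iteFalse he _ ih =>
    cases h₂ with
    | iteTrue he' _ => exact absurd he he'
    | iteFalse _ hp => obtain ⟨rfl, rfl⟩ := ih hp; exact ⟨rfl, rfl⟩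
  | loopTrue he _ _ ihp ihq =>
    cases h₂ with
    | loopTrue _ hp hq =>
      obtain ⟨rfl, rfl⟩ := ihp hp
      obtain ⟨rfl, rfl⟩ := ihq hq
      exact ⟨rfl, rfl⟩
    | loopFalse he' => exact absurd he' he
  | loopFalse he =>
    cases h₂ with
    | loopTrue he' _ _ => exact absurd he he'
    | loopFalse _ => exact ⟨rfl, rfl⟩

/-- The initial state: the input is in array `0` and its length in register `0`; everything else
is zero. -/
def initState (input : List ℕ) (ω : ℕ → Bool) : State where
  reg := fun x => if x = 0 then input.length else 0
  arr := fun a i => if a = 0 then input.getD i 0 else 0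
  coins := ω

/-- The output: the first entries of array `1`, their number being given by register `0`. -/
def State.output (s : State) : List ℕ :=
  (List.range (s.reg 0)).map (s.arr 1)

/-- On the given input and random bits `ω`, the program halts after `t` steps with output `out`. -/
def Outputs (p : Prog) (input : List ℕ) (ω : ℕ → Bool) (out : List ℕ) (t : ℕ) : Prop :=
  ∃ s : State, Exec p (initState input ω) s t ∧ s.output = out

/-- The law of a stream of independent fair coin flips. -/
noncomputable def coinMeasure : Measure (ℕ → Bool) :=
  Measure.infinitePi fun _ : ℕ => (PMF.uniformOfFintype Bool).toMeasure

end RandRAM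

/-! ### Hierarchical systems of squares and of colors -/

/-- The vertex set of the `d × d` square with top-left corner `q`. Vertices of the grid are given
by their row and column, both counted from `0`. -/
def squareVertices (d : ℕ) (q : ℕ × ℕ) : Finset (ℕ × ℕ) :=
  Finset.Ico q.1 (q.1 + d) ×ˢ Finset.Ico q.2 (q.2 + d)

/-- `A` is the set of left endpoints of a `d`-canonical collection of intervals of
`{0, …, m - 1}`: the intervals have length `d` and are pairwise `d`-separated. -/
def IsCanonicalIntervals (d m : ℕ) (A : Finset ℕ) : Prop :=
  (∀ a ∈ A, a + d ≤ m) ∧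
  ∀ a ∈ A, ∀ b ∈ A, a ≠ b → ∀ i ∈ Finset.Ico a (a + d), ∀ j ∈ Finset.Ico b (b + d),
    (d : ℤ) < |(i : ℤ) - (j : ℤ)|

/-- A list of top-left corners (without repetitions) describes a `d`-canonical family of squares of
the `m × m` grid: all products of an interval from one `d`-canonical collection with an interval
from another. -/
def IsCanonicalSquares (d m : ℕ) (Q : List (ℕ × ℕ)) : Prop :=
  Q.Nodup ∧ ∃ A B : Finset ℕ, IsCanonicalIntervals d m A ∧ IsCanonicalIntervals d m B ∧
    ∀ q : ℕ × ℕ, q ∈ Q ↔ q.1 ∈ A ∧ q.2 ∈ B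

/-- The data of a hierarchical system of squares together with a hierarchical system of colors.
Only the values of `len` and `squares` at the levels `1, …, depth` matter. -/
structure SquareColorSystem where
  /-- the side `ℓ` of the input grid -/
  side : ℕ
  /-- the number `ρ` of levels -/
  depth : ℕ
  /-- the length `ℓ_h` of the level-`h` intervals of the row of sources -/
  len : ℕ → ℕ
  /-- the top-left corners of the level-`h` squares -/
  squares : ℕ → List (ℕ × ℕ)

namespace SquareColorSystem

variable (H : SquareColorSystem)

/-- The number of vertices of the input grid. -/
def gridCard : ℕ := H.side ^ 2

noncomputable def eta : ℕ := 2 ^ ⌈Real.sqrt (Real.logb 2 (H.gridCard : ℝ))⌉₊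

/-- `d_h = η ^ (ρ - h + 3)`. -/
noncomputable def d (h : ℕ) : ℕ := H.eta ^ (H.depth + 3 - h)

/-- The side `ℓ'` of the truncated grid: the largest multiple of `η ^ (ρ + 2)` below `ℓ`. -/
noncomputable def side' : ℕ := (H.side - 1) / H.eta ^ (H.depth + 2) * H.eta ^ (H.depth + 2)

/-- The levels `1, …, ρ`. -/
def levels : List ℕ := List.range' 1 H.depth

/-- The vertices of the level-`h` square with corner `q`. -/
noncomputable def verts (h : ℕ) (q : ℕ × ℕ) : Finset (ℕ × ℕ) := squareVertices (H.d h) q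

/-- The level-`h` colors are numbered from left to right by the level-`h` intervals, into which
the row of sources (with `ℓ'` vertices) is partitioned. -/
def IsColor (h c : ℕ) : Prop := c < H.side' / H.len h

/-- The level-`h` interval that belongs to the level-`h` color `c`. -/
def interval (h c : ℕ) : Finset ℕ := Finset.Ico (c * H.len h) ((c + 1) * H.len h)

/-- The level-`h` color `c` is an ancestor-color of the level-`h'` color `c'`. -/
def IsAncestor (h c h' c' : ℕ) : Prop := H.interval h' c' ⊆ H.interval h c

/-- The requirements on the parameters, on the squares and on the interval lengths. -/
structure Valid : Prop where
  one_le_depth : 1 ≤ H.depth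
  eta_pow_lt : H.eta ^ (H.depth + 2) < H.side
  canonical : ∀ h, 1 ≤ h → h ≤ H.depth → IsCanonicalSquares (H.d h) H.side' (H.squares h)
  nested : ∀ h, 1 ≤ h → h < H.depth → ∀ q ∈ H.squares (h + 1),
    ∃ q' ∈ H.squares h, H.verts (h + 1) q ⊆ H.verts h q'
  len_pow : ∀ h, 1 ≤ h → h ≤ H.depth → ∃ e : ℕ, H.len h = H.eta ^ e
  len_anti : ∀ h, 1 ≤ h → h < H.depth → H.len (h + 1) ≤ H.len h
  len_dvd : H.len 1 ∣ H.side'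

/-- `f h q` is the color of the level-`h` square with corner `q`. Every level-`h` square gets a
level-`h` color, and the color of a child-square is a child-color of that of its parent-square. -/
def IsColoring (f : ℕ → ℕ × ℕ → ℕ) : Prop :=
  (∀ h, 1 ≤ h → h ≤ H.depth → ∀ q ∈ H.squares h, H.IsColor h (f h q)) ∧
  ∀ h, 1 ≤ h → h < H.depth → ∀ q ∈ H.squares (h + 1), ∀ q' ∈ H.squares h,
    H.verts (h + 1) q ⊆ H.verts h q' → H.IsAncestor h (f h q') (h + 1) (f (h + 1) q)

/-- The vertex `v` lies in some level-`ρ` square. -/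
def Belongs (v : ℕ × ℕ) : Prop := ∃ q ∈ H.squares H.depth, v ∈ H.verts H.depth q

/-- The system as a list of integers. -/
noncomputable def encode : List ℕ :=
  [H.side, H.side', H.depth] ++ H.levels.map H.d ++ H.levels.map H.len ++
    H.levels.flatMap fun h => (H.squares h).length :: (H.squares h).flatMap fun q => [q.1, q.2]

/-- A coloring together with a subset of `{0, …, m - 1}` as a list of integers: the colors of the
squares in the order of the input, then the characteristic vector of the subset. -/
def encodeSolution (f : ℕ → ℕ × ℕ → ℕ) {m : ℕ} (S : Finset (Fin m)) : List ℕ :=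
  (H.levels.flatMap fun h => (H.squares h).map (f h)) ++
    (List.finRange m).map fun k => if k ∈ S then 1 else 0

end SquareColorSystem

/-! ### Hierarchical Square Coloring -/

/-- An instance of Hierarchical Square Coloring: in addition to the squares and the colors, a
multiset of vertices, each with a level-`ρ` color. -/
structure HSCInstance extends SquareColorSystem where
  U : List ((ℕ × ℕ) × ℕ)

namespace HSCInstance

variable (I : HSCInstance)

structure Valid : Prop where
  system : I.toSquareColorSystem.Valid
  belongs : ∀ u ∈ I.U, I.Belongs u.1
  color : ∀ u ∈ I.U, I.IsColor I.depth u.2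

/-- The coloring `f` and the sub-multiset `S` of `U` (given by the positions of its elements) form
a solution. -/
structure Feasible (f : ℕ → ℕ × ℕ → ℕ) (S : Finset (Fin I.U.length)) : Prop where
  coloring : I.IsColoring f
  agree : ∀ k ∈ S, ∀ q ∈ I.squares I.depth, I.U[k].1 ∈ I.verts I.depth q →
    f I.depth q = I.U[k].2
  capacity : ∀ h, 1 ≤ h → h ≤ I.depth → ∀ c, I.IsColor h c →
    Set.ncard {k | k ∈ S ∧ I.IsAncestor h c I.depth I.U[k].2} ≤ I.d h

/-- `(f, S)` is a solution whose value is within the factor `r` of that of every solution. -/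
def IsApprox (r : ℝ) (f : ℕ → ℕ × ℕ → ℕ) (S : Finset (Fin I.U.length)) : Prop :=
  I.Feasible f S ∧ ∀ f' S', I.Feasible f' S' → (S'.card : ℝ) ≤ r * S.card

noncomputable def encode : List ℕ :=
  I.toSquareColorSystem.encode ++ I.U.length :: I.U.flatMap fun u => [u.1.1, u.1.2, u.2]

/-- The size of the instance: the grid and the multiset are given explicitly. -/
def size : ℕ := I.gridCard + I.U.length

end HSCInstance

/-! ### Perfect sets of demand pairs -/

/-- A system of squares and colors with a set of demand pairs; a pair consists of the column of
its source, which lies on the top row, and of its destination. -/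
structure DemandInstance extends SquareColorSystem where
  pairs : List (ℕ × (ℕ × ℕ))

namespace DemandInstance

variable (I : DemandInstance)

structure Valid : Prop where
  system : I.toSquareColorSystem.Valid
  nodup : I.pairs.Nodup
  source : ∀ p ∈ I.pairs, p.1 < I.side'
  destination : ∀ p ∈ I.pairs, I.Belongs p.2

/-- The set `S` of demand pairs (given by their positions in the list) is perfect for the
coloring `f`. A source has level-`h` color `c` when it lies in the interval of `c`; a destination
has the color of its square. -/
structure Perfect (f : ℕ → ℕ × ℕ → ℕ) (S : Finset (Fin I.pairs.length)) : Prop where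
  coloring : I.IsColoring f
  distinct : ∀ k ∈ S, ∀ k' ∈ S, k ≠ k' →
    I.pairs[k].1 ≠ I.pairs[k'].1 ∧ I.pairs[k].2 ≠ I.pairs[k'].2
  agree : ∀ k ∈ S, ∀ q ∈ I.squares I.depth, I.pairs[k].2 ∈ I.verts I.depth q →
    I.pairs[k].1 ∈ I.interval I.depth (f I.depth q)
  capacity : ∀ h, 1 ≤ h → h ≤ I.depth → ∀ c, I.IsColor h c →
    Set.ncard {k | k ∈ S ∧ I.pairs[k].1 ∈ I.interval h c} ≤ I.d h

/-- `S` is perfect for `f`, and its size is within the factor `r` of that of every set that is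
perfect for some coloring. -/
def IsApprox (r : ℝ) (f : ℕ → ℕ × ℕ → ℕ) (S : Finset (Fin I.pairs.length)) : Prop :=
  I.Perfect f S ∧ ∀ f' S', I.Perfect f' S' → (S'.card : ℝ) ≤ r * S.card

noncomputable def encode : List ℕ :=
  I.toSquareColorSystem.encode ++
    I.pairs.length :: I.pairs.flatMap fun p => [p.1, p.2.1, p.2.2]

def size : ℕ := I.gridCard + I.pairs.length

end DemandInstance

/-! A deterministic greedy selection is already within the factor `ρ + 2` of every solution, and `ρ
+ 2 ≤ log n`; the random bits are never read, so the probability bounds are trivial.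

A solution amounts to a set of elements, because a coloring can be read off from it: a square takes
the color of a selected element inside it and otherwise inherits from its parent-square. The set has
to satisfy two conditions. Elements in a common square agree on the color of that level (`Compat`),
and every color respects its capacity (`Indep`). As colors are nested, the capacities define a
laminar matroid: for independent `A` and `B` there is `O ⊆ B \ A` such that `A ∪ O` is independent
and `#B ≤ #A + #O` (`Hierarchical.exchange`).

The selection treats the squares recursively. Inside an open level-`h` square it keeps alternatives
for all level-`h` colors side by side, and an element competes for capacity only with the selected
elements that are consistent with it (`vis`). An element is added when the capacities allow it. When
a level-`(h + 1)` square is finished, pruning keeps, below each level-`h` color, only the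
child-color with the most elements.

The invariant `Extends` says that, for each level-`h` color, the gain is at least `1 / α` of the
size of any compatible set of that color by which the previous selection could have been continued.
Pruning keeps `α`, since a compatible set inside one level-`(h + 1)` square has a single level-`(h +
1)` color there. Scanning the subclasses of a class raises `α` by one: at a cost of at most the
gain, the exchange property trims the competitor to one that continues even the final selection; its
part in each subclass then continued the selection at the time that subclass was treated, and these
parts are bounded separately. Single elements have `α = 1`, and there are `ρ + 1` nested scans,
hence `Hierarchical.card_le_greedy`. If no capacity can bind, nothing is trimmed and the factor is
`1`.

With `η = 2 ^ s` one has `n ≤ 2 ^ (s * s)`, and `η ^ (ρ + 2) < ℓ` then forces `2 * (ρ + 2) < s`. So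
`ρ + 2 ≤ log n`. For the bound in terms of `|U|`, either `|U| ≤ η ^ 3 ≤ d_h` and no capacity binds,
or `log |U| ≥ 3 * s ≥ ρ + 2`. For demand pairs the capacity of the level-`ρ` colors is lowered to
`1`, which makes sources and destinations distinct and costs a factor `d_ρ = η ^ 3`.

The algorithm is written in a small language whose loops are all truncated at a bound computed from
the input. Polynomial running time then follows from the syntax alone, and correctness only requires
the bound to be large enough. The recursion becomes the iteration of one step on an explicit stack.
-/

namespace RandRAM

/-! ### A structured language compiled to the machine -/

/-- `Runs p s T Q`: started in `s`, the program `p` halts within `T` steps in a state with `Q`. -/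
def Runs (p : Prog) (s : State) (T : ℕ) (Q : State → Prop) : Prop :=
  ∃ s' t, Exec p s s' t ∧ t ≤ T ∧ Q s'

theorem Runs.mono {p : Prog} {s : State} {T T' : ℕ} {Q Q' : State → Prop} (h : Runs p s T Q)
    (hT : T ≤ T') (hQ : ∀ s', Q s' → Q' s') : Runs p s T' Q' := by
  obtain ⟨s', t, he, ht, hq⟩ := h
  exact ⟨s', t, he, ht.trans hT, hQ _ hq⟩

theorem Runs.seq {p q : Prog} {s : State} {T₁ T₂ : ℕ} {Q R : State → Prop}
    (hp : Runs p s T₁ Q) (hq : ∀ s', Q s' → Runs q s' T₂ R) :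
    Runs (.seq p q) s (T₁ + T₂) R := by
  obtain ⟨s', t, he, ht, h⟩ := hp
  obtain ⟨s'', t', he', ht', h'⟩ := hq s' h
  exact ⟨s'', _, .seq he he', by omega, h'⟩

theorem Runs.assign {x : ℕ} {e : Expr} {s : State} {Q : State → Prop}
    (h : Q (s.setReg x (e.eval s))) : Runs (.assign x e) s (e.cost + 1) Q :=
  ⟨_, _, .assign x e s, le_rfl, h⟩

theorem Runs.store {a : ℕ} {i e : Expr} {s : State} {Q : State → Prop}
    (h : Q (s.setArr a (i.eval s) (e.eval s))) : Runs (.store a i e) s (i.cost + e.cost + 1) Q :=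
  ⟨_, _, .store a i e s, le_rfl, h⟩

theorem Runs.ite {e : Expr} {p q : Prog} {s : State} {T₁ T₂ : ℕ} {Q : State → Prop}
    (hp : e.eval s ≠ 0 → Runs p s T₁ Q) (hq : e.eval s = 0 → Runs q s T₂ Q) :
    Runs (.ite e p q) s (e.cost + 1 + (T₁ + T₂)) Q := by
  by_cases h : e.eval s = 0
  · obtain ⟨s', t, he, ht, h'⟩ := hq h
    exact ⟨s', _, .iteFalse h he, by omega, h'⟩
  · obtain ⟨s', t, he, ht, h'⟩ := hp h
    exact ⟨s', _, .iteTrue h he, by omega, h'⟩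

/-- A loop that counts register `x` up to the content of register `l`. -/
theorem Runs.counting_loop {x l N T : ℕ} {p : Prog} {Inv : ℕ → State → Prop}
    (hreg : ∀ i s, Inv i s → s.reg l = N ∧ s.reg x = i)
    (hstep : ∀ i s, i < N → Inv i s → Runs p s T (Inv (i + 1))) :
    ∀ j i s, i + j = N → Inv i s →
      Runs (.loop (.sub (.reg l) (.reg x)) p) s (j * (T + 4) + 4) (Inv N) := by
  intro j
  induction j with
  | zero =>
    intro i s hi hs
    obtain ⟨h₁, h₂⟩ := hreg i s hs
    refine ⟨s, _, .loopFalse ?_, ?_, ?_⟩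
    · simp [Expr.eval, h₁, h₂]; omega
    -- The test `l - x` has three nodes and the branch costs one step; this is the overhead of `4`
    -- per round.
    · simp [Expr.cost]
    · have : i = N := by omega
      exact this ▸ hs
  | succ j ih =>
    intro i s hi hs
    obtain ⟨h₁, h₂⟩ := hreg i s hs
    obtain ⟨s', t, he, ht, h'⟩ := hstep i s (by omega) hs
    obtain ⟨s'', t', he', ht', h''⟩ := ih (i + 1) s' (by omega) h'
    refine ⟨s'', _, .loopTrue ?_ he he', ?_, h''⟩
    · simp [Expr.eval, h₁, h₂]; omega
    · simp only [Expr.cost]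
      have : (j + 1) * (T + 4) = j * (T + 4) + T + 4 := by ring
      omega

/-! ### Expressions with truncated sums -/

/-- Expressions with bounded sums and calls of expressions with four arguments. -/
inductive Ex where
  | const (k : ℕ)
  | var (i : ℕ)
  | get (a : ℕ) (i : Ex)
  | add (x y : Ex)
  | sub (x y : Ex)
  | ite (c x y : Ex)
  | sum (n b : Ex)
  | call (f x y z w : Ex)

/-- The value for the bound `β` on the number of summands, the arrays `A` and the variables `v`. -/
def Ex.eval (β : ℕ) (A : ℕ → ℕ → ℕ) : Ex → List ℕ → ℕ
  | .const k, _ => k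
  | .var i, v => v.getD i 0
  | .get a i, v => A a (i.eval β A v)
  | .add x y, v => x.eval β A v + y.eval β A v
  | .sub x y, v => x.eval β A v - y.eval β A v
  | .ite c x y, v => if c.eval β A v ≠ 0 then x.eval β A v else y.eval β A v
  | .sum n b, v => ∑ i ∈ Finset.range (min (n.eval β A v) β), b.eval β A (i :: v)
  | .call f x y z w, v =>
    f.eval β A [x.eval β A v, y.eval β A v, z.eval β A v, w.eval β A v]

/-- Register `l` is replaced by its minimum with register `0`. -/
def capReg (l : ℕ) : Prog := .ite (.sub (.reg l) (.reg 0)) (.assign l (.reg 0)) .skip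

theorem runs_capReg {l : ℕ} {s : State} {Q : State → Prop}
    (h : ∀ s', s'.arr = s.arr → (∀ x, x ≠ l → s'.reg x = s.reg x) →
      s'.reg l = min (s.reg l) (s.reg 0) → Q s') : Runs (capReg l) s 7 Q := by
  by_cases hl : s.reg l - s.reg 0 = 0
  · refine ⟨s, _, .iteFalse (by simpa [Expr.eval] using hl) (.skip s), by simp [Expr.cost], ?_⟩
    exact h s rfl (fun _ _ => rfl) (by omega)
  · refine ⟨_, _, .iteTrue (by simpa [Expr.eval] using hl) (.assign _ _ s),
      by simp [Expr.cost], ?_⟩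
    refine h _ rfl (fun x hx => by simp [State.setReg, hx]) ?_
    simp [State.setReg, Expr.eval]; omega

/-- The value is put into register `d`, and registers below `d` are left unchanged. -/
def Ex.compile : Ex → List ℕ → ℕ → Prog
  | .const k, _, d => .assign d (.const k)
  | .var i, r, d => .assign d (if i < r.length then .reg (r.getD i 0) else .const 0)
  | .get a i, r, d => .seq (i.compile r d) (.assign d (.get a (.reg d)))
  | .add x y, r, d => .seq (x.compile r d) (.seq (y.compile r (d + 1))
      (.assign d (.add (.reg d) (.reg (d + 1)))))
  | .sub x y, r, d => .seq (x.compile r d) (.seq (y.compile r (d + 1))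
      (.assign d (.sub (.reg d) (.reg (d + 1)))))
  | .ite c x y, r, d => .seq (c.compile r d) (.ite (.reg d) (x.compile r d) (y.compile r d))
  | .sum n b, r, d => .seq (n.compile r (d + 1)) (.seq (capReg (d + 1)) (.seq
      (.assign d (.const 0)) (.seq (.assign (d + 2) (.const 0))
      (.loop (.sub (.reg (d + 1)) (.reg (d + 2)))
        (.seq (b.compile ((d + 2) :: r) (d + 3))
          (.seq (.assign d (.add (.reg d) (.reg (d + 3))))
            (.assign (d + 2) (.add (.reg (d + 2)) (.const 1)))))))))
  | .call f x y z w, r, d => .seq (x.compile r (d + 1)) (.seq (y.compile r (d + 2))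
      (.seq (z.compile r (d + 3)) (.seq (w.compile r (d + 4))
      (.seq (f.compile [d + 1, d + 2, d + 3, d + 4] (d + 5)) (.assign d (.reg (d + 5)))))))

/-- The variable `X` stands for the bound in register `0`. As sums are truncated there, the syntax
alone determines a polynomial bound. -/
noncomputable def Ex.cost : Ex → Polynomial ℕ
  | .const _ => 2
  | .var _ => 2
  | .get _ i => i.cost + 3
  | .add x y => x.cost + (y.cost + 4)
  | .sub x y => x.cost + (y.cost + 4)
  | .ite c x y => c.cost + (2 + (x.cost + y.cost))
  | .sum n b => n.cost + (7 + (2 + (2 + (Polynomial.X * (b.cost + 12) + 4))))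
  | .call f x y z w => x.cost + (y.cost + (z.cost + (w.cost + (f.cost + 2))))

/-- Induction on the expression. The compiled code writes only to registers from `d` on, whereas the
bound in register `0` and the registers `r` of the variables lie below `d`; hence they survive every
subcomputation and the induction hypotheses can be chained. -/
theorem Ex.runs_compile (e : Ex) : ∀ (v r : List ℕ) (d : ℕ) (s : State), 0 < d →
    r.map s.reg = v → (∀ x ∈ r, x < d) →
    Runs (e.compile r d) s (e.cost.eval (s.reg 0)) fun s' => s'.arr = s.arr ∧
      (∀ x < d, s'.reg x = s.reg x) ∧ s'.reg d = e.eval (s.reg 0) s.arr v := by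
  have keep : ∀ {r v : List ℕ} {s s' : State} {d : ℕ}, r.map s.reg = v → (∀ x ∈ r, x < d) →
      (∀ x < d, s'.reg x = s.reg x) → r.map s'.reg = v := by
    intro r v s s' d h₁ h₂ h₃
    rw [← h₁]
    exact List.map_congr_left fun x hx => h₃ x (h₂ x hx)
  induction e with
  | const k =>
    intro v r d s hd hr hlt
    refine (Runs.assign (e := .const k) (Q := _) ?_).mono (by simp [Expr.cost, cost]) fun _ h => h
    refine ⟨rfl, fun x hx => ?_, ?_⟩
    · simp [State.setReg, hx.ne]
    · simp [State.setReg, Expr.eval, eval]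
  | var i =>
    intro v r d s hd hr hlt
    refine (Runs.assign (Q := _) ?_).mono
      (by simp only [cost]; split_ifs <;> simp [Expr.cost]) fun _ h => h
    refine ⟨rfl, fun x hx => ?_, ?_⟩
    · simp [State.setReg, hx.ne]
    · subst hr
      by_cases hi : i < r.length
      · simp [State.setReg, Expr.eval, eval, hi, List.getD_eq_getElem?_getD]
      · simp [State.setReg, Expr.eval, eval, hi, List.getD_eq_getElem?_getD]
  | get a i ih =>
    intro v r d s hd hr hlt
    simp only [cost, Polynomial.eval_add, Polynomial.eval_ofNat]
    refine (ih v r d s hd hr hlt).seq ?_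
    rintro s₁ ⟨h₁, h₂, h₃⟩
    refine Runs.assign (e := .get a (.reg d)) ⟨h₁, fun x hx => ?_, ?_⟩
    · simp [State.setReg, hx.ne, h₂ x hx]
    · simp [State.setReg, Expr.eval, eval, h₁, h₃]
  | add x y ihx ihy =>
    intro v r d s hd hr hlt
    simp only [cost, Polynomial.eval_add, Polynomial.eval_ofNat]
    refine (ihx v r d s hd hr hlt).seq ?_
    rintro s₁ ⟨h₁, h₂, h₃⟩
    have hy := ihy v r (d + 1) s₁ (by omega) (keep hr hlt h₂) fun x hx => (hlt x hx).trans_le (by simp)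
    rw [h₂ 0 hd, h₁] at hy
    refine hy.seq ?_
    rintro s₂ ⟨g₁, g₂, g₃⟩
    refine Runs.assign (e := .add (.reg d) (.reg (d + 1))) ⟨g₁, fun x hx => ?_, ?_⟩
    · simp [State.setReg, hx.ne, h₂ x hx, g₂ x (by omega)]
    · simp [State.setReg, Expr.eval, eval, g₃, g₂, h₃]
  | sub x y ihx ihy =>
    intro v r d s hd hr hlt
    simp only [cost, Polynomial.eval_add, Polynomial.eval_ofNat]
    refine (ihx v r d s hd hr hlt).seq ?_
    rintro s₁ ⟨h₁, h₂, h₃⟩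
    have hy := ihy v r (d + 1) s₁ (by omega) (keep hr hlt h₂) fun x hx => (hlt x hx).trans_le (by simp)
    rw [h₂ 0 hd, h₁] at hy
    refine hy.seq ?_
    rintro s₂ ⟨g₁, g₂, g₃⟩
    refine Runs.assign (e := .sub (.reg d) (.reg (d + 1))) ⟨g₁, fun x hx => ?_, ?_⟩
    · simp [State.setReg, hx.ne, h₂ x hx, g₂ x (by omega)]
    · simp [State.setReg, Expr.eval, eval, g₃, g₂, h₃]
  | ite c x y ihc ihx ihy =>
    intro v r d s hd hr hlt
    simp only [cost, Polynomial.eval_add, Polynomial.eval_ofNat]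
    refine (ihc v r d s hd hr hlt).seq ?_
    rintro s₁ ⟨h₁, h₂, h₃⟩
    have hx := ihx v r d s₁ hd (keep hr hlt h₂) hlt
    have hy := ihy v r d s₁ hd (keep hr hlt h₂) hlt
    rw [h₂ 0 hd, h₁] at hx hy
    refine (Runs.ite (e := .reg d) (fun hc => hx.mono le_rfl ?_) (fun hc => hy.mono le_rfl ?_))
    · rintro s₂ ⟨g₁, g₂, g₃⟩
      refine ⟨g₁, fun x hx => (g₂ x hx).trans (h₂ x hx), ?_⟩
      rw [Expr.eval, h₃] at hc
      simp [eval, g₃, hc]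
    · rintro s₂ ⟨g₁, g₂, g₃⟩
      refine ⟨g₁, fun x hx => (g₂ x hx).trans (h₂ x hx), ?_⟩
      rw [Expr.eval, h₃] at hc
      simp [eval, g₃, hc]
  | sum n b ihn ihb =>
    intro v r d s hd hr hlt
    simp only [cost, Polynomial.eval_add, Polynomial.eval_ofNat, Polynomial.eval_mul,
      Polynomial.eval_X]
    refine (ihn v r (d + 1) s (by omega) hr fun x hx => (hlt x hx).trans_le (by simp)).seq ?_
    rintro s₁ ⟨h₁, h₂, h₃⟩
    refine Runs.seq (runs_capReg (Q := fun s' => s'.arr = s.arr ∧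
      (∀ x < d + 1, s'.reg x = s.reg x) ∧
      s'.reg (d + 1) = min (n.eval (s.reg 0) s.arr v) (s.reg 0)) ?_) ?_
    · intro s' k₁ k₂ k₃
      refine ⟨k₁.trans h₁, fun x hx => (k₂ x (by omega)).trans (h₂ x hx), ?_⟩
      rw [k₃, h₃, h₂ 0 (by omega)]
    rintro s₂ ⟨k₁, k₂, k₃⟩
    refine Runs.seq (Runs.assign (e := .const 0) (Q := fun s' => s'.arr = s.arr ∧
      (∀ x < d, s'.reg x = s.reg x) ∧
      s'.reg (d + 1) = min (n.eval (s.reg 0) s.arr v) (s.reg 0) ∧ s'.reg d = 0) ?_) ?_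
    · refine ⟨k₁, fun x hx => ?_, ?_, ?_⟩
      · simp [State.setReg, hx.ne, k₂ x (by omega)]
      · simp [State.setReg, k₃]
      · simp [State.setReg, Expr.eval]
    rintro s₃ ⟨l₁, l₂, l₃, l₄⟩
    set N := min (n.eval (s.reg 0) s.arr v) (s.reg 0) with hN
    -- Register `d` accumulates the sum, `d + 1` holds the truncated number of summands and `d + 2`
    -- is the counter, which is the new variable `0` of the body.
    let Inv : ℕ → State → Prop := fun i s' => s'.arr = s.arr ∧ (∀ x < d, s'.reg x = s.reg x) ∧
      s'.reg (d + 1) = N ∧ s'.reg (d + 2) = i ∧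
      s'.reg d = ∑ j ∈ Finset.range i, b.eval (s.reg 0) s.arr (j :: v)
    refine Runs.seq (Runs.assign (e := .const 0) (Q := Inv 0) ?_) ?_
    · refine ⟨l₁, fun x hx => ?_, ?_, ?_, ?_⟩
      · have : x ≠ d + 2 := by omega
        simp [State.setReg, this, l₂ x hx]
      · simp [State.setReg, l₃]
      · simp [State.setReg, Expr.eval]
      · simp [State.setReg, l₄]
    intro s₄ hs₄
    have hloop := Runs.counting_loop (x := d + 2) (l := d + 1) (N := N)
      (T := b.cost.eval (s.reg 0) + 8)
      (p := .seq (b.compile ((d + 2) :: r) (d + 3))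
          (.seq (.assign d (.add (.reg d) (.reg (d + 3))))
            (.assign (d + 2) (.add (.reg (d + 2)) (.const 1)))))
      (Inv := Inv) (fun i s' h => ⟨h.2.2.1, h.2.2.2.1⟩) (by
        rintro i s' hi ⟨a₁, a₂, a₃, a₄, a₅⟩
        have hb := ihb (i :: v) ((d + 2) :: r) (d + 3) s' (by omega)
          (by rw [List.map_cons, a₄, keep hr hlt a₂])
          (by
            intro x hx
            rcases List.mem_cons.1 hx with rfl | hx
            · omega
            · exact (hlt x hx).trans_le (by simp))
        rw [a₂ 0 hd, a₁] at hb
        refine hb.seq ?_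
        rintro s₅ ⟨b₁, b₂, b₃⟩
        refine Runs.seq (T₁ := 4) (T₂ := 4) (Runs.assign (e := .add (.reg d) (.reg (d + 3)))
          (Q := fun s' => s'.arr = s.arr ∧ (∀ x < d, s'.reg x = s.reg x) ∧
            s'.reg (d + 1) = N ∧ s'.reg (d + 2) = i ∧
            s'.reg d = ∑ j ∈ Finset.range (i + 1), b.eval (s.reg 0) s.arr (j :: v)) ?_) ?_
        · refine ⟨b₁, fun x hx => ?_, ?_, ?_, ?_⟩
          · simp [State.setReg, hx.ne, b₂ x (by omega), a₂ x hx]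
          · simp [State.setReg, b₂, a₃]
          · simp [State.setReg, b₂, a₄]
          · simp [State.setReg, Expr.eval, b₂, a₅, b₃, Finset.sum_range_succ]
        rintro s₆ ⟨c₁, c₂, c₃, c₄, c₅⟩
        refine Runs.assign (e := .add (.reg (d + 2)) (.const 1)) ⟨c₁, fun x hx => ?_, ?_, ?_, ?_⟩
        · have : x ≠ d + 2 := by omega
          simp [State.setReg, this, c₂ x hx]
        · simp [State.setReg, c₃]
        · simp [State.setReg, Expr.eval, c₄]
        · simp [State.setReg, c₅])
      N 0 s₄ (by simp) hs₄
    refine hloop.mono ?_ ?_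
    · have : N ≤ s.reg 0 := min_le_right _ _
      exact Nat.add_le_add_right (Nat.mul_le_mul this (by omega)) _
    · rintro s' ⟨a₁, a₂, a₃, a₄, a₅⟩
      exact ⟨a₁, a₂, a₅⟩
  | call f x y z w ihf ihx ihy ihz ihw =>
    intro v r d s hd hr hlt
    have up : ∀ k, ∀ x ∈ r, x < d + k := fun k x hx => (hlt x hx).trans_le (by simp)
    simp only [cost, Polynomial.eval_add, Polynomial.eval_ofNat]
    refine (ihx v r (d + 1) s (by omega) hr (up 1)).seq ?_
    rintro s₁ ⟨a₁, b₁, c₁⟩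
    have h₂ := ihy v r (d + 2) s₁ (by omega) (keep hr (up 1) b₁) (up 2)
    rw [b₁ 0 (by omega), a₁] at h₂
    refine h₂.seq ?_
    rintro s₂ ⟨a₂, b₂, c₂⟩
    have e₂ : ∀ x < d + 1, s₂.reg x = s.reg x := fun x hx => by
      rw [b₂ x (by omega), b₁ x hx]
    have h₃ := ihz v r (d + 3) s₂ (by omega) (keep hr (up 1) e₂) (up 3)
    rw [e₂ 0 (by omega), a₂] at h₃
    refine h₃.seq ?_
    rintro s₃ ⟨a₃, b₃, c₃⟩
    have e₃ : ∀ x < d + 1, s₃.reg x = s.reg x := fun x hx => by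
      rw [b₃ x (by omega), e₂ x hx]
    have h₄ := ihw v r (d + 4) s₃ (by omega) (keep hr (up 1) e₃) (up 4)
    rw [e₃ 0 (by omega), a₃] at h₄
    refine h₄.seq ?_
    rintro s₄ ⟨a₄, b₄, c₄⟩
    have e₄ : ∀ x < d + 1, s₄.reg x = s.reg x := fun x hx => by
      rw [b₄ x (by omega), e₃ x hx]
    have h₅ := ihf [x.eval (s.reg 0) s.arr v, y.eval (s.reg 0) s.arr v, z.eval (s.reg 0) s.arr v,
      w.eval (s.reg 0) s.arr v] [d + 1, d + 2, d + 3, d + 4] (d + 5) s₄ (by omega)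
      (by simp [c₄, b₄, c₃, b₃, c₂, b₂, c₁]) (by simp)
    rw [e₄ 0 (by omega), a₄] at h₅
    refine h₅.seq ?_
    rintro s₅ ⟨a₅, b₅, c₅⟩
    refine Runs.assign (e := .reg (d + 5)) ⟨a₅, fun x hx => ?_, ?_⟩
    · simp [State.setReg, hx.ne, b₅ x (by omega), e₄ x (by omega)]
    · simp [State.setReg, Expr.eval, eval, c₅]

/-- The result of `n` rounds of `f`. -/
def rounds {α : Type*} (f : ℕ → α → α) : ℕ → α → α
  | 0, a => a
  | n + 1, a => f n (rounds f n a)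

/-! ### Statements with truncated loops -/

/-- Statements; they change arrays only. A loop binds its counter as variable `0` of the body. -/
inductive Stmt where
  | store (a : ℕ) (i e : Ex)
  | seq (p q : Stmt)
  | ite (e : Ex) (p q : Stmt)
  | loop (n : Ex) (p : Stmt)

def Stmt.run (β : ℕ) : Stmt → List ℕ → (ℕ → ℕ → ℕ) → ℕ → ℕ → ℕ
  | .store a i e, v, A =>
    Function.update A a (Function.update (A a) (i.eval β A v) (e.eval β A v))
  | .seq p q, v, A => q.run β v (p.run β v A)
  | .ite e p q, v, A => if e.eval β A v ≠ 0 then p.run β v A else q.run β v A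
  | .loop n p, v, A => rounds (fun i A => p.run β (i :: v) A) (min (n.eval β A v) β) A

def Stmt.compile : Stmt → List ℕ → ℕ → Prog
  | .store a i e, r, d => .seq (i.compile r d) (.seq (e.compile r (d + 1))
      (.store a (.reg d) (.reg (d + 1))))
  | .seq p q, r, d => .seq (p.compile r d) (q.compile r d)
  | .ite e p q, r, d => .seq (e.compile r d) (.ite (.reg d) (p.compile r d) (q.compile r d))
  | .loop n p, r, d => .seq (n.compile r (d + 1)) (.seq (capReg (d + 1))
      (.seq (.assign (d + 2) (.const 0))
      (.loop (.sub (.reg (d + 1)) (.reg (d + 2)))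
        (.seq (p.compile ((d + 2) :: r) (d + 3))
            (.assign (d + 2) (.add (.reg (d + 2)) (.const 1)))))))

noncomputable def Stmt.cost : Stmt → Polynomial ℕ
  | .store _ i e => i.cost + (e.cost + 3)
  | .seq p q => p.cost + q.cost
  | .ite e p q => e.cost + (2 + (p.cost + q.cost))
  | .loop n p => n.cost + (7 + (2 + (Polynomial.X * (p.cost + 8) + 4)))

theorem Stmt.runs_compile (p : Stmt) : ∀ (v r : List ℕ) (d : ℕ) (s : State), 0 < d →
    r.map s.reg = v → (∀ x ∈ r, x < d) →
    Runs (p.compile r d) s (p.cost.eval (s.reg 0)) fun s' => s'.arr = p.run (s.reg 0) v s.arr ∧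
      (∀ x < d, s'.reg x = s.reg x) := by
  have keep : ∀ {r v : List ℕ} {s s' : State} {d : ℕ}, r.map s.reg = v → (∀ x ∈ r, x < d) →
      (∀ x < d, s'.reg x = s.reg x) → r.map s'.reg = v := by
    intro r v s s' d h₁ h₂ h₃
    rw [← h₁]
    exact List.map_congr_left fun x hx => h₃ x (h₂ x hx)
  induction p with
  | store a i e =>
    intro v r d s hd hr hlt
    simp only [cost, Polynomial.eval_add, Polynomial.eval_ofNat]
    refine (i.runs_compile v r d s hd hr hlt).seq ?_
    rintro s₁ ⟨h₁, h₂, h₃⟩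
    have hy := e.runs_compile v r (d + 1) s₁ (by omega) (keep hr hlt h₂)
      fun x hx => (hlt x hx).trans_le (by simp)
    rw [h₂ 0 hd, h₁] at hy
    refine hy.seq ?_
    rintro s₂ ⟨g₁, g₂, g₃⟩
    refine Runs.store (i := .reg d) (e := .reg (d + 1)) ⟨?_, fun x hx => ?_⟩
    · simp [State.setArr, Expr.eval, run, g₁, g₃, g₂, h₃]
    · simp [State.setArr, g₂ x (by omega), h₂ x hx]
  | seq p q ihp ihq =>
    intro v r d s hd hr hlt
    simp only [cost, Polynomial.eval_add]
    refine (ihp v r d s hd hr hlt).seq ?_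
    rintro s₁ ⟨h₁, h₂⟩
    have hy := ihq v r d s₁ hd (keep hr hlt h₂) hlt
    rw [h₂ 0 hd, h₁] at hy
    exact hy.mono le_rfl fun s₂ ⟨g₁, g₂⟩ => ⟨g₁, fun x hx => (g₂ x hx).trans (h₂ x hx)⟩
  | ite c x y ihx ihy =>
    intro v r d s hd hr hlt
    simp only [cost, Polynomial.eval_add, Polynomial.eval_ofNat]
    refine (c.runs_compile v r d s hd hr hlt).seq ?_
    rintro s₁ ⟨h₁, h₂, h₃⟩
    have hx := ihx v r d s₁ hd (keep hr hlt h₂) hlt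
    have hy := ihy v r d s₁ hd (keep hr hlt h₂) hlt
    rw [h₂ 0 hd, h₁] at hx hy
    refine (Runs.ite (e := .reg d) (fun hc => hx.mono le_rfl ?_) (fun hc => hy.mono le_rfl ?_))
    · rintro s₂ ⟨g₁, g₂⟩
      rw [Expr.eval, h₃] at hc
      exact ⟨by simp [run, g₁, hc], fun x hx => (g₂ x hx).trans (h₂ x hx)⟩
    · rintro s₂ ⟨g₁, g₂⟩
      rw [Expr.eval, h₃] at hc
      exact ⟨by simp [run, g₁, hc], fun x hx => (g₂ x hx).trans (h₂ x hx)⟩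
  | loop n b ihb =>
    intro v r d s hd hr hlt
    simp only [cost, Polynomial.eval_add, Polynomial.eval_ofNat, Polynomial.eval_mul,
      Polynomial.eval_X]
    refine (n.runs_compile v r (d + 1) s (by omega) hr
      fun x hx => (hlt x hx).trans_le (by simp)).seq ?_
    rintro s₁ ⟨h₁, h₂, h₃⟩
    refine Runs.seq (runs_capReg (Q := fun s' => s'.arr = s.arr ∧
      (∀ x < d + 1, s'.reg x = s.reg x) ∧
      s'.reg (d + 1) = min (n.eval (s.reg 0) s.arr v) (s.reg 0)) ?_) ?_
    · intro s' k₁ k₂ k₃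
      refine ⟨k₁.trans h₁, fun x hx => (k₂ x (by omega)).trans (h₂ x hx), ?_⟩
      rw [k₃, h₃, h₂ 0 (by omega)]
    rintro s₃ ⟨l₁, l₂, l₃⟩
    set N := min (n.eval (s.reg 0) s.arr v) (s.reg 0) with hN
    let Inv : ℕ → State → Prop := fun i s' =>
      s'.arr = rounds (fun i A => b.run (s.reg 0) (i :: v) A) i s.arr ∧
      (∀ x < d, s'.reg x = s.reg x) ∧ s'.reg (d + 1) = N ∧ s'.reg (d + 2) = i
    refine Runs.seq (Runs.assign (e := .const 0) (Q := Inv 0) ?_) ?_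
    · refine ⟨l₁, fun x hx => ?_, ?_, ?_⟩
      · have : x ≠ d + 2 := by omega
        simp [State.setReg, this, l₂ x (by omega)]
      · simp [State.setReg, l₃]
      · simp [State.setReg, Expr.eval]
    intro s₄ hs₄
    have hloop := Runs.counting_loop (x := d + 2) (l := d + 1) (N := N)
      (T := b.cost.eval (s.reg 0) + 4)
      (p := .seq (b.compile ((d + 2) :: r) (d + 3))
            (.assign (d + 2) (.add (.reg (d + 2)) (.const 1))))
      (Inv := Inv) (fun i s' h => ⟨h.2.2.1, h.2.2.2⟩) (by
        rintro i s' hi ⟨a₁, a₂, a₃, a₄⟩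
        have hb := ihb (i :: v) ((d + 2) :: r) (d + 3) s' (by omega)
          (by rw [List.map_cons, a₄, keep hr hlt a₂])
          (by
            intro x hx
            rcases List.mem_cons.1 hx with rfl | hx
            · omega
            · exact (hlt x hx).trans_le (by simp))
        rw [a₂ 0 hd, a₁] at hb
        refine hb.seq ?_
        rintro s₅ ⟨b₁, b₂⟩
        refine Runs.assign (e := .add (.reg (d + 2)) (.const 1)) ⟨b₁, fun x hx => ?_, ?_, ?_⟩
        · have : x ≠ d + 2 := by omega
          simp [State.setReg, this, b₂ x (by omega), a₂ x hx]
        · simp [State.setReg, b₂, a₃]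
        · simp [State.setReg, Expr.eval, b₂, a₄])
      N 0 s₄ (by simp) hs₄
    refine hloop.mono ?_ ?_
    · have : N ≤ s.reg 0 := min_le_right _ _
      exact Nat.add_le_add_right (Nat.mul_le_mul this (by omega)) _
    · rintro s' ⟨a₁, a₂, a₃, a₄⟩
      exact ⟨a₁, a₂⟩

/-- Run `p` with the input length plus the first entry of the input plus `3` as the bound on loops,
and then output as many entries of array `1` as `e` says. -/
def Stmt.main (p : Stmt) (e : Ex) : Prog :=
  .seq (.assign 0 (.add (.reg 0) (.add (.get 0 (.const 0)) (.const 3))))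
    (.seq (p.compile [] 1) (.seq (e.compile [] 1) (.assign 0 (.reg 1))))

/-- The first input entry will be the side of the grid. Adding it to the input length makes the
bound exceed every position in the row of sources, as unary multiplication and division need,
besides the numbers of squares and of elements. -/
theorem Stmt.outputs_main (p : Stmt) (e : Ex) (input : List ℕ) (ω : ℕ → Bool) (β : ℕ)
    (hβ : β = input.length + input.getD 0 0 + 3) (A : ℕ → ℕ → ℕ)
    (hA : A = p.run β [] (initState input ω).arr) :
    ∃ t ≤ (p.cost + e.cost + 9).eval β,
      Outputs (p.main e) input ω ((List.range (e.eval β A [])).map (A 1)) t := by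
  have h : Runs (p.main e) (initState input ω) ((p.cost + e.cost + 9).eval β) fun s =>
      s.output = (List.range (e.eval β A [])).map (A 1) := by
    -- The constant `9` is `6 + 1` for setting the bound and `2` for the final assignment.
    have hT : (p.cost + e.cost + 9).eval β
        = 6 + 1 + (p.cost.eval β + (e.cost.eval β + 2)) := by
      simp; ring
    rw [hT]
    refine Runs.seq (Runs.assign (e := .add (.reg 0) (.add (.get 0 (.const 0)) (.const 3)))
      (Q := fun s => s.reg 0 = β ∧ s.arr = (initState input ω).arr) ?_) ?_
    · refine ⟨?_, rfl⟩
      simp [State.setReg, Expr.eval, initState, hβ]; ring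
    rintro s₁ ⟨h₁, h₂⟩
    have hp := p.runs_compile [] [] 1 s₁ one_pos rfl (by simp)
    rw [h₁, h₂, ← hA] at hp
    refine hp.seq ?_
    rintro s₂ ⟨g₁, g₂⟩
    have he := e.runs_compile [] [] 1 s₂ one_pos rfl (by simp)
    rw [g₂ 0 one_pos, h₁, g₁] at he
    refine he.seq ?_
    rintro s₃ ⟨k₁, k₂, k₃⟩
    refine Runs.assign (e := .reg 1) ?_
    simp [State.output, State.setReg, Expr.eval, k₁, k₃]
  obtain ⟨s', t, he, ht, hq⟩ := h
  exact ⟨t, ht, s', he, hq⟩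

theorem _root_.Polynomial.eval_nat_mono (p : Polynomial ℕ) : Monotone fun x : ℕ => p.eval x := by
  intro a b hab
  simp only [Polynomial.eval_eq_sum, Polynomial.sum_def]
  gcongr

end RandRAM

/-! ### Greedy selection under hierarchical consistency and laminar capacities -/

/-- Elements `0, …, n - 1`, each with a class `lab h k` and a color `col h k` at every level
`h ≤ depth`, and capacities for the colors at the levels `1, …, depth`. -/
structure LaminarProblem where
  n : ℕ
  depth : ℕ
  lab : ℕ → ℕ → ℕ
  col : ℕ → ℕ → ℕ
  cap : ℕ → ℕ

namespace LaminarProblem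

open Finset RandRAM

open scoped Classical

variable (P : LaminarProblem)

/-- The classes and the colors are refined from level to level, and are trivial at level `0`. -/
structure Hierarchical : Prop where
  lab_zero : ∀ k, P.lab 0 k = 0
  col_zero : ∀ k, P.col 0 k = 0
  lab_succ : ∀ h < P.depth, ∀ x < P.n, ∀ y < P.n,
    P.lab (h + 1) x = P.lab (h + 1) y → P.lab h x = P.lab h y
  col_succ : ∀ h < P.depth, ∀ x < P.n, ∀ y < P.n,
    P.col (h + 1) x = P.col (h + 1) y → P.col h x = P.col h y

/-- Elements of the same class have the same color, at all levels. -/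
def Compat (x y : ℕ) : Prop :=
  ∀ h < P.depth, P.lab (h + 1) x = P.lab (h + 1) y → P.col (h + 1) x = P.col (h + 1) y

/-- The capacities are respected. -/
def Indep (S : Finset ℕ) : Prop :=
  ∀ h < P.depth, ∀ c, #{x ∈ S | P.col (h + 1) x = c} ≤ P.cap (h + 1)

/-- The elements of the class of `k` at level `h`. -/
def cls (h k : ℕ) : Finset ℕ := {x ∈ range P.n | P.lab h x = P.lab h k}

/-- The elements of `S` that are consistent with `e` at the levels up to `h`. -/
noncomputable def vis (h e : ℕ) (S : Finset ℕ) : Finset ℕ :=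
  {x ∈ S | ∀ j ≤ h, P.lab j x = P.lab j e → P.col j x = P.col j e}

/-- Select `k` if the capacities allow it next to the selected elements compatible with `k`. -/
noncomputable def add (k : ℕ) (S : Finset ℕ) : Finset ℕ :=
  if ∀ h < P.depth,
    #{x ∈ S | P.Compat k x ∧ P.col (h + 1) x = P.col (h + 1) k} < P.cap (h + 1)
  then insert k S else S

/-- The number of selected elements with the class and the color of `k` at level `h`. -/
def cnt (S : Finset ℕ) (h k : ℕ) : ℕ := #{x ∈ S | P.lab h x = P.lab h k ∧ P.col h x = P.col h k}

/-- In the class of `k` at level `h` another color below the same color of the preceding level is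
preferable to that of `k`. -/
def Beaten (S : Finset ℕ) (h k : ℕ) : Prop :=
  ∃ x ∈ S, P.lab h x = P.lab h k ∧ P.col (h - 1) x = P.col (h - 1) k ∧
    (P.cnt S h k < P.cnt S h x ∨ P.cnt S h k = P.cnt S h x ∧ P.col h x < P.col h k)

/-- In the class of `i` at level `h` keep, for each color of the preceding level, only the elements
of the best color below it. -/
noncomputable def prune (h i : ℕ) (S : Finset ℕ) : Finset ℕ :=
  {x ∈ S | ¬ (P.lab h x = P.lab h i ∧ P.Beaten S h x)}

/-- Handle the classes at the next level, with labels `L`, in the class of `k` at level `h`. -/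
noncomputable def scan (h k : ℕ) (L : ℕ → ℕ) (step : ℕ → Finset ℕ → Finset ℕ) (m : ℕ)
    (S : Finset ℕ) : Finset ℕ :=
  rounds (fun i S => if P.lab h i = P.lab h k ∧ ∀ j < i, L j ≠ L i then step i S else S) m S

/-- Greedy selection in the class of `k` at level `h`, where `r` is the number of levels below. -/
noncomputable def select : ℕ → ℕ → ℕ → Finset ℕ → Finset ℕ
  | 0, h, k, S => P.scan h k id P.add P.n S
  | r + 1, h, k, S =>
    P.scan h k (P.lab (h + 1)) (fun i S => P.prune (h + 1) i (select r (h + 1) i S)) P.n S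

/-- What a round of the greedy selection in a set `R` of elements achieves, for each color of
level `h`, compared with all ways to continue the selection `S` by consistent elements of `R`. -/
structure Extends (h α : ℕ) (R S S' : Finset ℕ) : Prop where
  outside : ∀ x, x ∉ R → (x ∈ S' ↔ x ∈ S)
  indep : ∀ e ∈ R, P.Indep (P.vis h e S')
  compat : ∀ x ∈ S', x ∈ R → ∀ y ∈ S', y ∈ R → P.col h x = P.col h y → P.Compat x y
  bound : ∀ e ∈ R, ∀ O ⊆ R, (∀ x ∈ O, ∀ y ∈ O, P.Compat x y) → (∀ x ∈ O, P.col h x = P.col h e) →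
    P.Indep (P.vis h e S ∪ O) → #O ≤ α * #{x ∈ S' | x ∈ R ∧ P.col h x = P.col h e}

variable {P}

/-! ### Refinement of classes and colors, and visibility -/

theorem mem_cls {h k x : ℕ} : x ∈ P.cls h k ↔ x < P.n ∧ P.lab h x = P.lab h k := by
  simp [cls]

theorem Hierarchical.lab_le (hP : P.Hierarchical) {x y : ℕ} (hx : x < P.n) (hy : y < P.n) {h j : ℕ}
    (hj : j ≤ h) (hh : h ≤ P.depth) (he : P.lab h x = P.lab h y) : P.lab j x = P.lab j y := by
  induction h, hj using Nat.le_induction with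
  | base => exact he
  | succ h _ ih => exact ih (by omega) (hP.lab_succ h (by omega) x hx y hy he)

theorem Hierarchical.col_le (hP : P.Hierarchical) {x y : ℕ} (hx : x < P.n) (hy : y < P.n) {h j : ℕ}
    (hj : j ≤ h) (hh : h ≤ P.depth) (he : P.col h x = P.col h y) : P.col j x = P.col j y := by
  induction h, hj using Nat.le_induction with
  | base => exact he
  | succ h _ ih => exact ih (by omega) (hP.col_succ h (by omega) x hx y hy he)

theorem Indep.subset {S T : Finset ℕ} (hT : P.Indep T) (h : S ⊆ T) : P.Indep S :=
  fun j hj c => (card_le_card (filter_subset_filter _ h)).trans (hT j hj c)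

theorem vis_mono {h e : ℕ} {S T : Finset ℕ} (hST : S ⊆ T) : P.vis h e S ⊆ P.vis h e T :=
  filter_subset_filter _ hST

theorem vis_subset {h e : ℕ} {S : Finset ℕ} : P.vis h e S ⊆ S := filter_subset _ _

/-- The class and the color at level `h` determine those at all coarser levels, and nothing else
about `e` enters. -/
theorem Hierarchical.vis_congr (hP : P.Hierarchical) {h e e' : ℕ} (hh : h ≤ P.depth) (he : e < P.n)
    (he' : e' < P.n) (hl : P.lab h e = P.lab h e') (hc : P.col h e = P.col h e') (S : Finset ℕ) :
    P.vis h e S = P.vis h e' S := by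
  refine filter_congr fun x _ => forall₂_congr fun j hj => ?_
  rw [hP.lab_le he he' hj hh hl, hP.col_le he he' hj hh hc]

/-- Inside the class of `e` the condition at level `h` implies the conditions at the coarser levels.
-/
theorem Hierarchical.mem_vis (hP : P.Hierarchical) {h e x : ℕ} (hh : h ≤ P.depth) (he : e < P.n)
    (hx : x < P.n) (hl : P.lab h x = P.lab h e) {S : Finset ℕ} :
    x ∈ P.vis h e S ↔ x ∈ S ∧ P.col h x = P.col h e := by
  simp only [vis, mem_filter]
  refine and_congr_right fun _ => ⟨fun H => H h le_rfl hl, fun H j hj _ => hP.col_le hx he hj hh H⟩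

/-! ### The exchange property of laminar capacities -/

/-- A selection that cannot be extended from `B` is at least as large as `B`. -/
theorem Hierarchical.card_le_of_maximal (hP : P.Hierarchical) {A B : Finset ℕ} (hA : A ⊆ range P.n)
    (hB : B ⊆ range P.n) (iB : P.Indep B) (iA : P.Indep A)
    (hmax : ∀ b ∈ B, b ∉ A → ¬ P.Indep (insert b A)) : #B ≤ #A := by
  -- A color is tight when `A` exhausts its capacity. By maximality every element of `B \ A` lies in
  -- a tight color.
  let tight : ℕ → ℕ → Prop := fun x h => h < P.depth ∧
    P.cap (h + 1) ≤ #{y ∈ A | P.col (h + 1) y = P.col (h + 1) x}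
  have htight : ∀ b ∈ B, b ∉ A → ∃ h, tight b h := by
    intro b hb hbA
    have := hmax b hb hbA
    simp only [Indep, not_forall, not_le] at this
    obtain ⟨h, hh, c, hc⟩ := this
    refine ⟨h, hh, ?_⟩
    rw [filter_insert] at hc
    split_ifs at hc with hbc
    · rw [hbc]
      rw [card_insert_of_notMem (by simp [hbA])] at hc
      omega
    · exact absurd (iA h hh c) (by omega)
  -- The least level gives the coarsest tight color of an element. These colors, being maximal in a
  -- laminar family, are disjoint; together with the elements in no tight color they partition
  -- everything, and `A` and `B` are compared part by part.
  let g : ℕ → Option (ℕ × ℕ) := fun x =>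
    if H : ∃ h, tight x h then some (Nat.find H, P.col (Nat.find H + 1) x) else none
  -- Elements that share the coarsest tight color of one of them share all coarser colors as well,
  -- so no still coarser color is tight for the other.
  have hg : ∀ x < P.n, ∀ y < P.n, ∀ H : (∃ h, tight x h),
      P.col (Nat.find H + 1) y = P.col (Nat.find H + 1) x → g y = g x := by
    intro x hx y hy H hc
    have hd := (Nat.find_spec H).1
    have hcol : ∀ j ≤ Nat.find H, P.col (j + 1) y = P.col (j + 1) x := fun j hj =>
      hP.col_le hy hx (by omega) (by omega) hc
    have ht : tight y (Nat.find H) := by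
      refine ⟨hd, ?_⟩
      rw [hc]
      exact (Nat.find_spec H).2
    have H' : ∃ h, tight y h := ⟨_, ht⟩
    have hle : Nat.find H' ≤ Nat.find H := Nat.find_min' H' ht
    have hge : Nat.find H ≤ Nat.find H' := by
      refine Nat.find_min' H ⟨(Nat.find_spec H').1, ?_⟩
      rw [← hcol _ hle]
      exact (Nat.find_spec H').2
    have heq : Nat.find H' = Nat.find H := le_antisymm hle hge
    simp only [g, H, H', dif_pos, heq, hc]
  rw [card_eq_sum_card_fiberwise (f := g) (t := (A ∪ B).image g) (s := B)
      fun x hx => mem_coe.2 (mem_image_of_mem _ (mem_union_right _ hx)),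
    card_eq_sum_card_fiberwise (f := g) (t := (A ∪ B).image g) (s := A)
      fun x hx => mem_coe.2 (mem_image_of_mem _ (mem_union_left _ hx))]
  refine sum_le_sum fun κ _ => ?_
  rcases ({b ∈ B | g b = κ}).eq_empty_or_nonempty with he | ⟨b, hb⟩
  · simp [he]
  rw [mem_filter] at hb
  obtain ⟨hb, rfl⟩ := hb
  have hbn := mem_range.1 (hB hb)
  -- In a tight color `B` is at most the capacity and `A` at least.
  by_cases H : ∃ h, tight b h
  · calc #{x ∈ B | g x = g b} ≤ #{x ∈ B | P.col (Nat.find H + 1) x = P.col (Nat.find H + 1) b} := by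
          refine card_le_card fun x hx => ?_
          rw [mem_filter] at hx ⊢
          refine ⟨hx.1, ?_⟩
          have := hx.2
          simp only [g, H, dif_pos] at this
          split_ifs at this with H'
          simp only [Option.some.injEq, Prod.mk.injEq] at this
          rw [← this.1]
          rw [this.2, ← this.1]
      _ ≤ P.cap (Nat.find H + 1) := iB _ (Nat.find_spec H).1 _
      _ ≤ #{x ∈ A | P.col (Nat.find H + 1) x = P.col (Nat.find H + 1) b} := (Nat.find_spec H).2
      _ ≤ #{x ∈ A | g x = g b} := by
          refine card_le_card fun x hx => ?_
          rw [mem_filter] at hx ⊢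
          exact ⟨hx.1, hg b hbn x (mem_range.1 (hA hx.1)) H hx.2⟩
  -- In the remaining part all elements of `B` already belong to `A`.
  · refine card_le_card fun x hx => ?_
    rw [mem_filter] at hx ⊢
    refine ⟨?_, hx.2⟩
    by_contra hxA
    have h₁ : g b = none := by simp only [g, H, dif_neg, not_false_iff]
    have := hx.2
    rw [h₁] at this
    simp only [g, htight x hx.1 hxA, dif_pos] at this
    exact absurd this (by simp)

/-- Choose `O` as large as possible among the sets that keep `A ∪ O` independent. Then `A ∪ O`
cannot be extended from `B`, so it is at least as large as `B`. -/
theorem Hierarchical.exchange (hP : P.Hierarchical) {A B : Finset ℕ} (hA : A ⊆ range P.n)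
    (hB : B ⊆ range P.n) (iB : P.Indep B) (iA : P.Indep A) :
    ∃ O ⊆ B \ A, P.Indep (A ∪ O) ∧ #B ≤ #A + #O := by
  obtain ⟨O, hO, hmax⟩ := exists_max_image {O ∈ (B \ A).powerset | P.Indep (A ∪ O)} card
    ⟨∅, by simp [iA]⟩
  rw [mem_filter, mem_powerset] at hO
  refine ⟨O, hO.1, hO.2, ?_⟩
  have hOn : A ∪ O ⊆ range P.n :=
    union_subset hA (hO.1.trans (sdiff_subset.trans hB))
  refine (hP.card_le_of_maximal hOn hB iB hO.2 fun b hb hbn hi => ?_).trans (card_union_le _ _)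
  rw [mem_union, not_or] at hbn
  have := hmax (insert b O) (by
    rw [mem_filter, mem_powerset, insert_subset_iff, mem_sdiff, union_insert]
    exact ⟨⟨⟨hb, hbn.1⟩, hO.1⟩, hi⟩)
  rw [card_insert_of_notMem hbn.2] at this
  omega

/-! ### A single element, and pruning one class -/

theorem Extends.subset_range {h α : ℕ} {R S S' : Finset ℕ} (H : P.Extends h α R S S')
    (hR : R ⊆ range P.n) (hS : S ⊆ range P.n) : S' ⊆ range P.n := fun x hx => by
  by_cases hxR : x ∈ R
  · exact hR hxR
  · exact hS ((H.outside x hxR).1 hx)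

/-- At the last level, being visible from `k` means being compatible with `k`, so the test made by
`add` is exactly the independence of the visible set with `k` inserted. The only nonempty competitor
is `{k}`, and it is taken whenever it is possible. -/
theorem Hierarchical.extends_add (hP : P.Hierarchical) {k : ℕ} (hk : k < P.n) {S : Finset ℕ}
    (hkS : k ∉ S) (hi : P.Indep (P.vis P.depth k S)) :
    P.Extends P.depth 1 {k} S (P.add k S) := by
  have hvis : P.vis P.depth k S = {x ∈ S | P.Compat k x} := by
    refine filter_congr fun x _ => ⟨fun H h hh he => (H (h + 1) hh he.symm).symm, fun H j hj he => ?_⟩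
    rcases j with _ | j
    · rw [hP.col_zero, hP.col_zero]
    · exact (H j hj he.symm).symm
  have hk' : k ∉ P.vis P.depth k S := fun H => hkS (vis_subset H)
  have hadd : P.Indep (insert k (P.vis P.depth k S)) ↔ ∀ h < P.depth,
      #{x ∈ S | P.Compat k x ∧ P.col (h + 1) x = P.col (h + 1) k} < P.cap (h + 1) := by
    have hcard : ∀ h, #{x ∈ S | P.Compat k x ∧ P.col (h + 1) x = P.col (h + 1) k}
        = #{x ∈ P.vis P.depth k S | P.col (h + 1) x = P.col (h + 1) k} := fun h => by
      rw [hvis, filter_filter]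
    constructor
    · intro H h hh
      have := H h hh (P.col (h + 1) k)
      rw [filter_insert, if_pos rfl, card_insert_of_notMem (by simp [hk'])] at this
      rw [hcard]; omega
    · intro H h hh c
      rw [filter_insert]
      split_ifs with hc
      · subst hc
        rw [card_insert_of_notMem (by simp [hk'])]
        have := H h hh
        rw [hcard] at this; omega
      · exact hi h hh c
  have hself : P.vis P.depth k (insert k S) = insert k (P.vis P.depth k S) := by
    rw [vis, filter_insert, if_pos fun _ _ _ => rfl]; rfl
  refine ⟨fun x hx => ?_, fun e he => ?_, fun x _ hx y _ hy _ => ?_, fun e he O hO _ _ hO' => ?_⟩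
  · rw [mem_singleton] at hx
    rw [add]; split_ifs <;> simp [hx]
  · rw [mem_singleton.1 he, add]
    split_ifs with H
    · rw [hself]; exact hadd.2 H
    · exact hi
  · rw [mem_singleton.1 hx, mem_singleton.1 hy]
    exact fun _ _ _ => rfl
  · rw [mem_singleton] at he
    subst he
    rcases subset_singleton_iff.1 hO with rfl | rfl
    · simp
    · rw [union_comm, ← insert_eq] at hO'
      rw [add, if_pos (hadd.1 hO'), card_singleton, one_mul, Nat.succ_le_iff, card_pos]
      exact ⟨e, by simp⟩

/-- A compatible competitor inside one class of level `h + 1` has a single color of that level, so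
keeping the largest child-color below each level-`h` color loses nothing against it. Afterwards the
level-`h` color of a selected element of the class determines its level-`(h + 1)` color, which turns
consistency at level `h + 1` into consistency at level `h`. -/
theorem Hierarchical.extends_prune (hP : P.Hierarchical) {h i α : ℕ} (hh : h < P.depth)
    {S S' : Finset ℕ} (hS : S ⊆ range P.n)
    (hi : ∀ e ∈ P.cls (h + 1) i, P.Indep (P.vis h e S))
    (H : P.Extends (h + 1) α (P.cls (h + 1) i) S S') :
    P.Extends h α (P.cls (h + 1) i) S (P.prune (h + 1) i S') := by
  have hR : P.cls (h + 1) i ⊆ range P.n := filter_subset _ _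
  have hS' := H.subset_range hR hS
  have hlt : ∀ {x}, x ∈ S' → x < P.n := fun hx => mem_range.1 (hS' hx)
  have hlab : ∀ {x y}, x ∈ P.cls (h + 1) i → y ∈ P.cls (h + 1) i →
      P.lab (h + 1) x = P.lab (h + 1) y := fun hx hy => (mem_cls.1 hx).2.trans (mem_cls.1 hy).2.symm
  have hkeep : ∀ {x}, x ∈ P.cls (h + 1) i →
      (x ∈ P.prune (h + 1) i S' ↔ x ∈ S' ∧ ¬ P.Beaten S' (h + 1) x) := fun hx => by
    simp [prune, (mem_cls.1 hx).2]
  have hsub : P.prune (h + 1) i S' ⊆ S' := filter_subset _ _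
  -- The preference, by number of elements and then by smaller color, is a total order on the
  -- child-colors of one color; two survivors cannot differ.
  have hsame : ∀ x ∈ P.prune (h + 1) i S', x ∈ P.cls (h + 1) i → ∀ y ∈ P.prune (h + 1) i S',
      y ∈ P.cls (h + 1) i → P.col h x = P.col h y → P.col (h + 1) x = P.col (h + 1) y := by
    intro x hx hxR y hy hyR hc
    rw [hkeep hxR] at hx
    rw [hkeep hyR] at hy
    by_contra hne
    have hx2 : ¬ (P.cnt S' (h + 1) x < P.cnt S' (h + 1) y ∨
        P.cnt S' (h + 1) x = P.cnt S' (h + 1) y ∧ P.col (h + 1) y < P.col (h + 1) x) :=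
      fun h' => hx.2 ⟨y, hy.1, hlab hyR hxR, by simpa using hc.symm, h'⟩
    have hy2 : ¬ (P.cnt S' (h + 1) y < P.cnt S' (h + 1) x ∨
        P.cnt S' (h + 1) y = P.cnt S' (h + 1) x ∧ P.col (h + 1) x < P.col (h + 1) y) :=
      fun h' => hy.2 ⟨x, hx.1, hlab hxR hyR, by simpa using hc, h'⟩
    omega
  -- Being beaten depends only on the color of an element within the class, so a surviving color
  -- keeps all its elements.
  have hclosed : ∀ x ∈ P.prune (h + 1) i S', x ∈ P.cls (h + 1) i → ∀ y ∈ S',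
      y ∈ P.cls (h + 1) i → P.col (h + 1) y = P.col (h + 1) x → y ∈ P.prune (h + 1) i S' := by
    intro x hx hxR y hy hyR hc
    rw [hkeep hxR] at hx
    rw [hkeep hyR]
    refine ⟨hy, fun hb => hx.2 ?_⟩
    have hc' : P.col h y = P.col h x := hP.col_le (hlt hy) (hlt hx.1) (Nat.le_succ h) hh hc
    have hcnt : P.cnt S' (h + 1) y = P.cnt S' (h + 1) x := by
      simp only [cnt, hlab hyR hxR, hc]
    obtain ⟨z, hz, h₁, h₂, h₃⟩ := hb
    refine ⟨z, hz, h₁.trans (hlab hyR hxR), ?_, ?_⟩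
    · simpa [hc'] using h₂
    · rwa [hcnt, hc] at h₃
  have hbest : ∀ y ∈ S', y ∈ P.cls (h + 1) i → ∃ x ∈ P.prune (h + 1) i S', x ∈ P.cls (h + 1) i ∧
      P.col h x = P.col h y ∧ P.cnt S' (h + 1) y ≤ P.cnt S' (h + 1) x := by
    intro y hy hyR
    obtain ⟨x, hx, hmax⟩ := exists_max_image
      {x ∈ S' | x ∈ P.cls (h + 1) i ∧ P.col h x = P.col h y}
      -- The order dual makes the smaller color win ties, as in `Beaten`.
      (fun x => toLex (P.cnt S' (h + 1) x, OrderDual.toDual (P.col (h + 1) x)))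
      ⟨y, by simp [hy, hyR]⟩
    rw [mem_filter] at hx
    refine ⟨x, (hkeep hx.2.1).2 ⟨hx.1, ?_⟩, hx.2.1, hx.2.2, ?_⟩
    · rintro ⟨z, hz, h₁, h₂, h₃⟩
      have hzR : z ∈ P.cls (h + 1) i := mem_cls.2 ⟨hlt hz, h₁.trans (mem_cls.1 hx.2.1).2⟩
      have := hmax z (by
        rw [mem_filter]
        exact ⟨hz, hzR, by simpa [hx.2.2] using h₂⟩)
      rw [Prod.Lex.toLex_le_toLex] at this
      simp only [OrderDual.toDual_le_toDual] at this
      omega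
    · have := hmax y (by simp [hy, hyR])
      rw [Prod.Lex.toLex_le_toLex] at this
      simp only [OrderDual.toDual_le_toDual] at this
      omega
  refine ⟨fun x hx => ?_, fun e he => ?_, fun x hx hxR y hy hyR hc => ?_,
    fun e he O hO hOc hOe hOi => ?_⟩
  · rw [← H.outside x hx]
    refine ⟨fun h' => hsub h', fun h' => ?_⟩
    refine mem_filter.2 ⟨h', fun hb => hx (mem_cls.2 ⟨hlt h', hb.1⟩)⟩
  · have hen := (mem_cls.1 he).1
    -- If some survivor `x` has the level-`h` color of `e`, whatever `e` sees at level `h` is seen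
    -- by `x` at level `h + 1`. Otherwise `e` sees nothing inside the class, and outside it nothing
    -- has changed.
    by_cases hex : ∃ x ∈ P.prune (h + 1) i S', x ∈ P.cls (h + 1) i ∧ P.col h x = P.col h e
    · obtain ⟨x, hx, hxR, hxe⟩ := hex
      refine (H.indep x hxR).subset fun y hy => ?_
      rw [vis, mem_filter] at hy ⊢
      have hy' := hsub hy.1
      refine ⟨hy', fun j hj hl => ?_⟩
      have hxn := (mem_cls.1 hxR).1
      have hle : ∀ j ≤ h + 1, P.lab j x = P.lab j e := fun j hj =>
        hP.lab_le hxn hen hj hh (hlab hxR he)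
      have hce : ∀ j ≤ h, P.col j x = P.col j e := fun j hj =>
        hP.col_le hxn hen hj hh.le hxe
      rcases Nat.lt_or_eq_of_le hj with hj | rfl
      · rw [hce j (by omega)]
        exact hy.2 j (by omega) (hl.trans (hle j (by omega)))
      · have hyR : y ∈ P.cls (h + 1) i := mem_cls.2 ⟨hlt hy', hl.trans (mem_cls.1 hxR).2⟩
        refine hsame y hy.1 hyR x hx hxR ?_
        rw [hxe]
        refine hy.2 h le_rfl ?_
        exact hP.lab_le (hlt hy') hen (Nat.le_succ h) hh (hlab hyR he)
    · refine (hi e he).subset fun y hy => ?_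
      rw [vis, mem_filter] at hy ⊢
      refine ⟨?_, hy.2⟩
      by_cases hyR : y ∈ P.cls (h + 1) i
      · exact absurd ⟨y, hy.1, hyR, hy.2 h le_rfl
          (hP.lab_le (mem_cls.1 hyR).1 hen (Nat.le_succ h) hh (hlab hyR he))⟩ hex
      · exact (H.outside y hyR).1 (hsub hy.1)
  · exact H.compat x (hsub hx) hxR y (hsub hy) hyR (hsame x hx hxR y hy hyR hc)
  · rcases O.eq_empty_or_nonempty with rfl | ⟨o, ho⟩
    · simp
    have hoR := hO ho
    have hon := (mem_cls.1 hoR).1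
    have hen := (mem_cls.1 he).1
    -- The competitor has the level-`h` color of `e`; its element `o` is subject to one more
    -- condition and sees less than `e`, so the competitor is also admissible for the bound at level
    -- `h + 1`.
    have hvis : P.vis (h + 1) o S ⊆ P.vis h e S := by
      intro y hy
      rw [vis, mem_filter] at hy ⊢
      refine ⟨hy.1, fun j hj hl => ?_⟩
      rw [hP.lab_le hen hon (hj.trans (Nat.le_succ h)) hh (hlab he hoR)] at hl
      rw [hy.2 j (by omega) hl]
      exact hP.col_le hon hen hj hh.le (hOe o ho)
    have hb := H.bound o hoR O hO hOc
      (fun x hx => hOc x hx o ho h hh (hlab (hO hx) hoR))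
      (hOi.subset (union_subset_union_left hvis))
    refine hb.trans (Nat.mul_le_mul_left _ ?_)
    rcases ({x ∈ S' | x ∈ P.cls (h + 1) i ∧ P.col (h + 1) x = P.col (h + 1) o}).eq_empty_or_nonempty
      with hemp | ⟨y, hy⟩
    · rw [hemp]; simp
    rw [mem_filter] at hy
    obtain ⟨x, hx, hxR, hxy, hcnt⟩ := hbest y hy.1 hy.2.1
    have hyo : P.col h y = P.col h o :=
      hP.col_le (hlt hy.1) hon (Nat.le_succ h) hh hy.2.2
    calc #{x ∈ S' | x ∈ P.cls (h + 1) i ∧ P.col (h + 1) x = P.col (h + 1) o}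
        ≤ P.cnt S' (h + 1) y := by
          refine card_le_card fun z hz => ?_
          rw [mem_filter] at hz ⊢
          exact ⟨hz.1, hlab hz.2.1 hy.2.1, hz.2.2.trans hy.2.2.symm⟩
      _ ≤ P.cnt S' (h + 1) x := hcnt
      _ ≤ _ := by
          refine card_le_card fun z hz => ?_
          rw [mem_filter] at hz ⊢
          have hzR : z ∈ P.cls (h + 1) i :=
            mem_cls.2 ⟨hlt hz.1, hz.2.1.trans (mem_cls.1 hxR).2⟩
          refine ⟨hclosed x hx hxR z hz.1 hzR hz.2.2, hzR, ?_⟩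
          rw [hP.col_le (hlt hz.1) (hlt (hsub hx)) (Nat.le_succ h) hh hz.2.2, hxy, hyo, hOe o ho]

/-! ### Scanning the subclasses of a class -/

/-- The state of the greedy selection in the class of `k` after the first `i` elements. -/
structure ScanInvariant (P : LaminarProblem) (h k α : ℕ) (L : ℕ → ℕ) (S : Finset ℕ) (i : ℕ)
    (S' : Finset ℕ) : Prop where
  subset : S' ⊆ range P.n
  outside : ∀ x, x ∉ P.cls h k → (x ∈ S' ↔ x ∈ S)
  done : ∀ x ∈ S', x ∈ P.cls h k → ∃ j < i, L j = L x
  indep : ∀ e ∈ P.cls h k, P.Indep (P.vis h e S')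
  compat : ∀ x ∈ S', x ∈ P.cls h k → ∀ y ∈ S', y ∈ P.cls h k → P.col h x = P.col h y →
    P.Compat x y
  bound : ∀ e ∈ P.cls h k, ∀ O ⊆ P.cls h k, (∀ x ∈ O, ∃ j < i, L j = L x) →
    (∀ x ∈ O, ∀ y ∈ O, P.Compat x y) → (∀ x ∈ O, P.col h x = P.col h e) →
    P.Indep (P.vis h e S' ∪ O) → #O ≤ α * #{x ∈ S' | x ∈ P.cls h k ∧ P.col h x = P.col h e}

/-- The bound of the invariant admits only competitors that continue the current selection `S'`, not
merely the initial one. Such a competitor also continues all earlier selections, so its parts in the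
different subclasses are bounded separately and add up with the same `α`. -/
theorem Hierarchical.scanInvariant (hP : P.Hierarchical) {h k α : ℕ} (hh : h ≤ P.depth)
    {L : ℕ → ℕ} (hL : ∀ x < P.n, ∀ y < P.n, L x = L y → P.lab h x = P.lab h y)
    (hL' : ∀ j, h < j → j ≤ P.depth → ∀ x < P.n, ∀ y < P.n, P.lab j x = P.lab j y → L x = L y)
    {step : ℕ → Finset ℕ → Finset ℕ}
    (hstep : ∀ i ∈ P.cls h k, ∀ S ⊆ range P.n, (∀ x ∈ S, L x ≠ L i) →
      (∀ e ∈ range P.n, L e = L i → P.Indep (P.vis h e S)) →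
      P.Extends h α {x ∈ range P.n | L x = L i} S (step i S))
    {S : Finset ℕ} (hS : S ⊆ range P.n) (hdisj : ∀ x ∈ S, x ∉ P.cls h k)
    (hi : ∀ e ∈ P.cls h k, P.Indep (P.vis h e S)) (i : ℕ) (hin : i ≤ P.n) :
    P.ScanInvariant h k α L S i (P.scan h k L step i S) := by
  induction i with
  | zero =>
    refine ⟨hS, fun x _ => Iff.rfl, fun x hx hx' => absurd hx' (hdisj x hx), hi,
      fun x hx hx' => absurd hx' (hdisj x hx), fun e he O hO hO' _ _ _ => ?_⟩
    have : O = ∅ := eq_empty_of_forall_notMem fun x hx => by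
      obtain ⟨j, hj, _⟩ := hO' x hx
      omega
    simp [this]
  | succ i ih =>
    have I := ih (by omega)
    have hscan : P.scan h k L step (i + 1) S = if P.lab h i = P.lab h k ∧ ∀ j < i, L j ≠ L i
      then step i (P.scan h k L step i S) else P.scan h k L step i S := rfl
    rw [hscan]
    set T := P.scan h k L step i S with hT
    have hiQ : ∀ x ∈ P.cls h k, L i = L x → P.lab h i = P.lab h k := fun x hx hl =>
      (hL i (by omega) x (mem_cls.1 hx).1 hl).trans (mem_cls.1 hx).2
    split_ifs with hif
    · obtain ⟨hik, hfirst⟩ := hif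
      have hicls : i ∈ P.cls h k := mem_cls.2 ⟨by omega, hik⟩
      set R : Finset ℕ := {x ∈ range P.n | L x = L i} with hR
      have hmemR : ∀ x, x ∈ R ↔ x < P.n ∧ L x = L i := fun x => by simp [hR]
      have hRQ : R ⊆ P.cls h k := fun x hx => by
        rw [hmemR] at hx
        exact mem_cls.2 ⟨hx.1, (hL x hx.1 i (by omega) hx.2).trans hik⟩
      have hTR : ∀ x ∈ T, x ∉ R := fun x hx hxR => by
        obtain ⟨j, hj, hjx⟩ := I.done x hx (hRQ hxR)
        exact hfirst j hj (hjx.trans ((hmemR x).1 hxR).2)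
      have E := hstep i hicls T I.subset
        (fun x hx hl => hTR x hx ((hmemR x).2 ⟨mem_range.1 (I.subset hx), hl⟩))
        (fun e he hl => I.indep e (hRQ ((hmemR e).2 ⟨mem_range.1 he, hl⟩)))
      rw [← hR] at E
      set T' := step i T with hT'
      have hsub : T ⊆ T' := fun x hx => (E.outside x (hTR x hx)).2 hx
      have hT'n : T' ⊆ range P.n := E.subset_range (filter_subset _ _) I.subset
      refine ⟨hT'n, fun x hx => ?_, fun x hx hxQ => ?_, fun e he => ?_,
        fun x hx hxQ y hy hyQ hc => ?_, fun e he O hO hOd hOc hOe hOi => ?_⟩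
      · rw [E.outside x fun h' => hx (hRQ h'), I.outside x hx]
      · by_cases hxR : x ∈ R
        · exact ⟨i, by omega, ((hmemR x).1 hxR).2.symm⟩
        · obtain ⟨j, hj, hjx⟩ := I.done x ((E.outside x hxR).1 hx) hxQ
          exact ⟨j, by omega, hjx⟩
      -- The new subclass affects what `e` sees only through elements with its level-`h` color. If
      -- there is one, it sees the same as `e`, and the guarantee for the new subclass applies.
      · by_cases hex : ∃ e' ∈ R, P.col h e' = P.col h e
        · obtain ⟨e', he', hc⟩ := hex
          rw [hP.vis_congr hh (mem_cls.1 he).1 (mem_cls.1 (hRQ he')).1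
            ((mem_cls.1 he).2.trans (mem_cls.1 (hRQ he')).2.symm) hc.symm]
          exact E.indep e' he'
        · refine (I.indep e he).subset fun x hx => ?_
          have hxR : x ∉ R := fun hxR => hex ⟨x, hxR, ((hP.mem_vis hh (mem_cls.1 he).1
            (mem_cls.1 (hRQ hxR)).1 ((mem_cls.1 (hRQ hxR)).2.trans (mem_cls.1 he).2.symm)).1 hx).2⟩
          rw [vis, mem_filter] at hx ⊢
          exact ⟨(E.outside x hxR).1 hx.1, hx.2⟩
      · have hxn := (mem_cls.1 hxQ).1
        have hyn := (mem_cls.1 hyQ).1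
        -- Elements of different subclasses have no common class below level `h`; up to level `h`
        -- equality of their level-`h` colors suffices.
        have hmixed : L x ≠ L y → P.Compat x y := by
          intro hne j hj hl
          by_cases hjh : h < j + 1
          · exact absurd (hL' (j + 1) hjh hj x hxn y hyn hl) hne
          · exact hP.col_le hxn hyn (by omega) hh hc
        by_cases hl : L x = L y
        · by_cases hxi : L x = L i
          · exact E.compat x hx ((hmemR x).2 ⟨hxn, hxi⟩) y hy
              ((hmemR y).2 ⟨hyn, hl.symm.trans hxi⟩) hc
          · have hxR : x ∉ R := fun h' => hxi ((hmemR x).1 h').2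
            have hyR : y ∉ R := fun h' => hxi (hl.trans ((hmemR y).1 h').2)
            exact I.compat x ((E.outside x hxR).1 hx) hxQ y ((E.outside y hyR).1 hy) hyQ hc
        · exact hmixed hl
      · have hOn : ∀ x ∈ O, x < P.n := fun x hx => (mem_cls.1 (hO hx)).1
        -- The competitor is split into the part with labels seen before and the part in the new
        -- subclass. Both continue the selection `T` before this round, because `T ⊆ T'`.
        have h₁ : #{x ∈ O | ¬ L x = L i} ≤
            α * #{x ∈ T | x ∈ P.cls h k ∧ P.col h x = P.col h e} := by
          refine I.bound e he _ ((filter_subset _ _).trans hO) (fun x hx => ?_)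
            (fun x hx y hy => hOc x (mem_filter.1 hx).1 y (mem_filter.1 hy).1)
            (fun x hx => hOe x (mem_filter.1 hx).1)
            (hOi.subset (union_subset_union (vis_mono hsub) (filter_subset _ _)))
          rw [mem_filter] at hx
          obtain ⟨j, hj, hjx⟩ := hOd x hx.1
          refine ⟨j, ?_, hjx⟩
          rcases Nat.lt_succ_iff_lt_or_eq.1 hj with hj | rfl
          · exact hj
          · exact absurd hjx.symm hx.2
        have h₂ : #{x ∈ O | L x = L i} ≤ α * #{x ∈ T' | x ∈ R ∧ P.col h x = P.col h e} := by
          rcases ({x ∈ O | L x = L i}).eq_empty_or_nonempty with hemp | ⟨o, ho⟩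
          · simp [hemp]
          rw [mem_filter] at ho
          have hoR : o ∈ R := (hmemR o).2 ⟨hOn o ho.1, ho.2⟩
          have := E.bound o hoR {x ∈ O | L x = L i}
            (fun x hx => (hmemR x).2 ⟨hOn x (mem_filter.1 hx).1, (mem_filter.1 hx).2⟩)
            (fun x hx y hy => hOc x (mem_filter.1 hx).1 y (mem_filter.1 hy).1)
            (fun x hx => (hOe x (mem_filter.1 hx).1).trans (hOe o ho.1).symm) (by
              rw [hP.vis_congr hh (hOn o ho.1) (mem_cls.1 he).1
                ((mem_cls.1 (hO ho.1)).2.trans (mem_cls.1 he).2.symm) (hOe o ho.1)]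
              exact hOi.subset (union_subset_union (vis_mono hsub) (filter_subset _ _)))
          rwa [hOe o ho.1] at this
        have h₃ : #{x ∈ T | x ∈ P.cls h k ∧ P.col h x = P.col h e} +
            #{x ∈ T' | x ∈ R ∧ P.col h x = P.col h e} ≤
            #{x ∈ T' | x ∈ P.cls h k ∧ P.col h x = P.col h e} := by
          rw [← card_union_of_disjoint]
          · refine card_le_card (union_subset (fun x hx => ?_) fun x hx => ?_)
            · rw [mem_filter] at hx ⊢
              exact ⟨hsub hx.1, hx.2⟩
            · rw [mem_filter] at hx ⊢
              exact ⟨hx.1, hRQ hx.2.1, hx.2.2⟩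
          · refine disjoint_left.2 fun x hx hx' => ?_
            rw [mem_filter] at hx hx'
            exact hTR x hx.1 hx'.2.1
        have h₄ := card_filter_add_card_filter_not (s := O) fun x => L x = L i
        have h₅ := Nat.mul_le_mul_left α h₃
        rw [Nat.mul_add] at h₅
        omega
    -- A round that does nothing contributes no new label to the class: either `i` lies outside the
    -- class or its label occurred before.
    · have hdone : ∀ x ∈ P.cls h k, (∃ j < i + 1, L j = L x) → ∃ j < i, L j = L x := by
        rintro x hx ⟨j, hj, hjx⟩
        rcases Nat.lt_succ_iff_lt_or_eq.1 hj with hj | rfl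
        · exact ⟨j, hj, hjx⟩
        · have := hiQ x hx hjx
          simp only [this, true_and, not_forall, ne_eq, not_not] at hif
          obtain ⟨j', hj', hl⟩ := hif
          exact ⟨j', hj', hl.trans hjx⟩
      refine ⟨I.subset, I.outside, fun x hx hxQ => ?_, I.indep, I.compat,
        fun e he O hO hOd => I.bound e he O hO fun x hx => hdone x (hO hx) (hOd x hx)⟩
      obtain ⟨j, hj, hjx⟩ := I.done x hx hxQ
      exact ⟨j, by omega, hjx⟩

/-- This is the only place where the factor grows. The competitor `O` continues the initial
selection, but the scan invariant wants one that continues the final selection `T`. By the exchange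
property, dropping at most as many elements as were gained for the color of `e` leaves such a set
`O'`. This costs `1 ≤ ε`, or nothing if all sets are independent. -/
theorem Hierarchical.extends_scan (hP : P.Hierarchical) {h k α ε : ℕ} (hh : h ≤ P.depth)
    (hε : 1 ≤ ε ∨ ∀ S ⊆ range P.n, P.Indep S)
    {L : ℕ → ℕ} (hL : ∀ x < P.n, ∀ y < P.n, L x = L y → P.lab h x = P.lab h y)
    (hL' : ∀ j, h < j → j ≤ P.depth → ∀ x < P.n, ∀ y < P.n, P.lab j x = P.lab j y → L x = L y)
    {step : ℕ → Finset ℕ → Finset ℕ}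
    (hstep : ∀ i ∈ P.cls h k, ∀ S ⊆ range P.n, (∀ x ∈ S, L x ≠ L i) →
      (∀ e ∈ range P.n, L e = L i → P.Indep (P.vis h e S)) →
      P.Extends h α {x ∈ range P.n | L x = L i} S (step i S))
    {S : Finset ℕ} (hS : S ⊆ range P.n) (hdisj : ∀ x ∈ S, x ∉ P.cls h k)
    (hi : ∀ e ∈ P.cls h k, P.Indep (P.vis h e S)) :
    P.Extends h (α + ε) (P.cls h k) S (P.scan h k L step P.n S) := by
  have I := hP.scanInvariant hh hL hL' hstep hS hdisj hi P.n le_rfl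
  set T := P.scan h k L step P.n S
  have hdone : ∀ x ∈ P.cls h k, ∃ j < P.n, L j = L x := fun x hx => ⟨x, (mem_cls.1 hx).1, rfl⟩
  refine ⟨I.outside, I.indep, I.compat, fun e he O hO hOc hOe hOi => ?_⟩
  have hOn : O ⊆ range P.n := hO.trans (filter_subset _ _)
  have hen := (mem_cls.1 he).1
  obtain ⟨O', hO', hi', hcard⟩ : ∃ O' ⊆ O, P.Indep (P.vis h e T ∪ O') ∧
      #O ≤ ε * #{x ∈ T | x ∈ P.cls h k ∧ P.col h x = P.col h e} + #O' := by
    rcases hε with hε | hε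
    · have hST : S ⊆ T := fun x hx => (I.outside x (hdisj x hx)).2 hx
      obtain ⟨O', hO', hi', hcard⟩ := hP.exchange (A := P.vis h e T) (B := P.vis h e S ∪ O)
        (vis_subset.trans I.subset) (union_subset (vis_subset.trans hS) hOn) hOi (I.indep e he)
      refine ⟨O', fun x hx => ?_, hi', ?_⟩
      · have := hO' hx
        rw [mem_sdiff, mem_union] at this
        exact this.1.resolve_left fun h' => this.2 (vis_mono hST h')
      · rw [card_union_of_disjoint (disjoint_left.2 fun x hx hx' =>
          hdisj x (vis_subset hx) (hO hx'))] at hcard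
        -- What `e` sees in `T` lies outside the class, where `T` and `S` agree, or inside it with
        -- the level-`h` color of `e`.
        have : #(P.vis h e T) ≤ #(P.vis h e S) +
            #{x ∈ T | x ∈ P.cls h k ∧ P.col h x = P.col h e} := by
          refine (card_le_card fun x hx => ?_).trans (card_union_le _ _)
          rw [mem_union]
          by_cases hxQ : x ∈ P.cls h k
          · have := (hP.mem_vis hh hen (mem_cls.1 hxQ).1
              ((mem_cls.1 hxQ).2.trans (mem_cls.1 he).2.symm)).1 hx
            exact Or.inr (mem_filter.2 ⟨this.1, hxQ, this.2⟩)
          · rw [vis, mem_filter] at hx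
            exact Or.inl (mem_filter.2 ⟨(I.outside x hxQ).1 hx.1, hx.2⟩)
        have := Nat.mul_le_mul_right #{x ∈ T | x ∈ P.cls h k ∧ P.col h x = P.col h e} hε
        omega
    · exact ⟨O, Subset.rfl, hε _ (union_subset (vis_subset.trans I.subset) hOn), by omega⟩
  have := I.bound e he O' (hO'.trans hO) (fun x hx => hdone x (hO (hO' hx)))
    (fun x hx y hy => hOc x (hO' hx) y (hO' hy)) (fun x hx => hOe x (hO' hx)) hi'
  rw [Nat.add_mul]
  omega

/-- Each of the `r + 1` nested scans adds `ε` to the initial factor `1`, and pruning adds nothing. A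
subclass is entered with no selected elements in it, because only the first element of each class
triggers it. -/
theorem Hierarchical.extends_select (hP : P.Hierarchical) {ε : ℕ}
    (hε : 1 ≤ ε ∨ ∀ S ⊆ range P.n, P.Indep S) (r : ℕ) : ∀ h k, h + r = P.depth →
    ∀ S ⊆ range P.n, (∀ x ∈ S, x ∉ P.cls h k) → (∀ e ∈ P.cls h k, P.Indep (P.vis h e S)) →
    P.Extends h (1 + ε * (r + 1)) (P.cls h k) S (P.select r h k S) := by
  induction r with
  | zero =>
    intro h k hr S hS hdisj hi
    obtain rfl : h = P.depth := by omega
    have := hP.extends_scan (k := k) (α := 1) le_rfl hε (L := id) (step := P.add)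
      (fun x _ y _ hl => by rw [id, id] at hl; rw [hl]) (fun j hj hj' => by omega)
      (fun i hi S _ hd hin => by
        have hin' := (mem_cls.1 hi).1
        have : ({x ∈ range P.n | id x = id i} : Finset ℕ) = {i} := by
          ext x; simp only [id, mem_filter, mem_range, mem_singleton]
          exact ⟨fun h => h.2, fun h => ⟨h ▸ hin', h⟩⟩
        rw [this]
        exact hP.extends_add hin' (fun h => hd i h rfl) (hin i (mem_range.2 hin') rfl))
      hS hdisj hi
    simpa [select] using this
  | succ r ih =>
    intro h k hr S hS hdisj hi
    have := hP.extends_scan (k := k) (α := 1 + ε * (r + 1)) (h := h) (by omega) hε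
      (L := P.lab (h + 1)) (step := fun i S => P.prune (h + 1) i (P.select r (h + 1) i S))
      (fun x hx y hy hl => hP.lab_succ h (by omega) x hx y hy hl)
      (fun j hj hj' x hx y hy hl => hP.lab_le hx hy hj hj' hl)
      (fun i hi S hS hd hin => by
        have hdis : ∀ x ∈ S, x ∉ P.cls (h + 1) i := fun x hx hx' => hd x hx (mem_cls.1 hx').2
        have hind : ∀ e ∈ P.cls (h + 1) i, P.Indep (P.vis h e S) := fun e he =>
          hin e (mem_range.2 (mem_cls.1 he).1) (mem_cls.1 he).2
        refine hP.extends_prune (by omega) hS hind (ih (h + 1) i (by omega) S hS hdis ?_)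
        intro e he
        refine (hind e he).subset fun x hx => ?_
        rw [vis, mem_filter] at hx ⊢
        exact ⟨hx.1, fun j hj => hx.2 j (by omega)⟩)
      hS hdisj hi
    have he : 1 + ε * (r + 1) + ε = 1 + ε * (r + 1 + 1) := by ring
    rw [he] at this
    exact this

/-! ### The complete greedy selection -/

variable (P) in
/-- The greedy selection. -/
noncomputable def greedy : Finset ℕ := P.select P.depth 0 0 ∅

variable (P) in
/-- The feasible selections. -/
structure Feasible (S : Finset ℕ) : Prop where
  subset : S ⊆ range P.n
  compat : ∀ x ∈ S, ∀ y ∈ S, P.Compat x y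
  indep : P.Indep S

/-- At level `0` there is one class and one color: consistency up to this level is no restriction,
so the local guarantee becomes a global one. -/
theorem Hierarchical.extends_greedy (hP : P.Hierarchical) {ε : ℕ}
    (hε : 1 ≤ ε ∨ ∀ S ⊆ range P.n, P.Indep S) :
    P.Extends 0 (1 + ε * (P.depth + 1)) (range P.n) ∅ P.greedy := by
  have hcls : P.cls 0 0 = range P.n := by
    ext x; simp [mem_cls, hP.lab_zero]
  have := hP.extends_select hε P.depth 0 0 (by omega) ∅ (by simp) (by simp) (by
    intro e _ h _ c
    simp [vis])
  rwa [hcls] at this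

theorem Hierarchical.feasible_greedy (hP : P.Hierarchical) : P.Feasible P.greedy := by
  have E := hP.extends_greedy (Or.inl le_rfl)
  have hs := E.subset_range Subset.rfl (by simp)
  refine ⟨hs, fun x hx y hy => E.compat x hx (hs hx) y hy (hs hy)
    (by rw [hP.col_zero, hP.col_zero]), ?_⟩
  rcases P.greedy.eq_empty_or_nonempty with h | ⟨e, he⟩
  · rw [h]; intro h _ c; simp
  · have := E.indep e (hs he)
    have hv : P.vis 0 e P.greedy = P.greedy := by
      refine filter_true_of_mem fun x _ j hj _ => ?_
      rw [Nat.le_zero.1 hj, hP.col_zero, hP.col_zero]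
    rwa [hv] at this

theorem Hierarchical.card_le_greedy (hP : P.Hierarchical) {ε : ℕ}
    (hε : 1 ≤ ε ∨ ∀ S ⊆ range P.n, P.Indep S) {O : Finset ℕ} (hO : P.Feasible O) :
    #O ≤ (1 + ε * (P.depth + 1)) * #P.greedy := by
  rcases O.eq_empty_or_nonempty with h | ⟨e, he⟩
  · simp [h]
  have E := hP.extends_greedy hε
  refine (E.bound e (hO.subset he) O hO.subset hO.compat
    (fun x _ => by rw [hP.col_zero, hP.col_zero]) ?_).trans
    (Nat.mul_le_mul_left _ (card_le_card (filter_subset _ _)))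
  simpa [vis] using hO.indep

end LaminarProblem

namespace RandRAM

open Finset

/-! ### Derived expressions -/

namespace Ex

variable {β : ℕ} {A : ℕ → ℕ → ℕ} {v : List ℕ}

/-- The condition expressed by `c`. -/
def Holds (β : ℕ) (A : ℕ → ℕ → ℕ) (c : Ex) (v : List ℕ) : Prop := c.eval β A v ≠ 0

instance (c : Ex) : Decidable (c.Holds β A v) := inferInstanceAs (Decidable (_ ≠ _))

def not (x : Ex) : Ex := .ite x (.const 0) (.const 1)
def and (x y : Ex) : Ex := .ite x y (.const 0)
def or (x y : Ex) : Ex := .ite x (.const 1) y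
def le (x y : Ex) : Ex := .not (.sub x y)
def lt (x y : Ex) : Ex := .sub y x
def eq (x y : Ex) : Ex := .and (.le x y) (.le y x)
def count (n c : Ex) : Ex := .sum n (.ite c (.const 1) (.const 0))
def all (n c : Ex) : Ex := .not (.count n (.not c))
-- Calls always pass four arguments; the unused ones are zero, which explains the argument lists
-- `[h, k, 0, 0]` below.
def call₂ (f x y : Ex) : Ex := .call f x y (.const 0) (.const 0)

@[simp] theorem eval_const (k : ℕ) : (const k).eval β A v = k := rfl
@[simp] theorem eval_var_zero (i : ℕ) : (var 0).eval β A (i :: v) = i := rfl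
@[simp] theorem eval_var_one (i j : ℕ) : (var 1).eval β A (i :: j :: v) = j := rfl
@[simp] theorem eval_var_two (i j k : ℕ) : (var 2).eval β A (i :: j :: k :: v) = k := rfl
@[simp] theorem eval_var_three (i j k l : ℕ) : (var 3).eval β A (i :: j :: k :: l :: v) = l := rfl
@[simp] theorem eval_get (a : ℕ) (i : Ex) : (get a i).eval β A v = A a (i.eval β A v) := rfl
@[simp] theorem eval_add (x y : Ex) : (add x y).eval β A v = x.eval β A v + y.eval β A v := rfl
@[simp] theorem eval_sub (x y : Ex) : (sub x y).eval β A v = x.eval β A v - y.eval β A v := rfl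
@[simp] theorem eval_ite (c x y : Ex) : (ite c x y).eval β A v =
    if c.Holds β A v then x.eval β A v else y.eval β A v := rfl
@[simp] theorem eval_sum (n b : Ex) : (sum n b).eval β A v =
    ∑ i ∈ Finset.range (min (n.eval β A v) β), b.eval β A (i :: v) := rfl
@[simp] theorem eval_call (f x y z w : Ex) : (call f x y z w).eval β A v =
    f.eval β A [x.eval β A v, y.eval β A v, z.eval β A v, w.eval β A v] := rfl
@[simp] theorem holds_call (f x y z w : Ex) : (call f x y z w).Holds β A v ↔
    f.Holds β A [x.eval β A v, y.eval β A v, z.eval β A v, w.eval β A v] := Iff.rfl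
@[simp] theorem eval_call₂ (f x y : Ex) : (call₂ f x y).eval β A v =
    f.eval β A [x.eval β A v, y.eval β A v, 0, 0] := rfl
@[simp] theorem holds_call₂ (f x y : Ex) : (call₂ f x y).Holds β A v ↔
    f.Holds β A [x.eval β A v, y.eval β A v, 0, 0] := Iff.rfl
@[simp] theorem holds_get (a : ℕ) (i : Ex) : (get a i).Holds β A v ↔ A a (i.eval β A v) ≠ 0 :=
  Iff.rfl
@[simp] theorem holds_var_zero (i : ℕ) : (var 0).Holds β A (i :: v) ↔ i ≠ 0 := Iff.rfl
@[simp] theorem holds_sub (x y : Ex) : (sub x y).Holds β A v ↔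
    x.eval β A v - y.eval β A v ≠ 0 := Iff.rfl
@[simp] theorem holds_not (x : Ex) : (not x).Holds β A v ↔ ¬ x.Holds β A v := by
  simp only [Holds, not, eval]; split_ifs <;> simp_all
@[simp] theorem holds_and (x y : Ex) : (and x y).Holds β A v ↔ x.Holds β A v ∧ y.Holds β A v := by
  simp only [Holds, and, eval]; split_ifs <;> simp_all
@[simp] theorem holds_or (x y : Ex) : (or x y).Holds β A v ↔ x.Holds β A v ∨ y.Holds β A v := by
  simp only [Holds, or, eval]; split_ifs <;> simp_all
@[simp] theorem holds_le (x y : Ex) : (le x y).Holds β A v ↔ x.eval β A v ≤ y.eval β A v := by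
  rw [le, holds_not, holds_sub]; omega
@[simp] theorem holds_lt (x y : Ex) : (lt x y).Holds β A v ↔ x.eval β A v < y.eval β A v := by
  rw [lt, holds_sub]; omega
@[simp] theorem holds_eq (x y : Ex) : (eq x y).Holds β A v ↔ x.eval β A v = y.eval β A v := by
  simp only [eq, holds_and, holds_le]; omega
@[simp] theorem eval_count (n c : Ex) : (count n c).eval β A v =
    #{i ∈ Finset.range (min (n.eval β A v) β) | c.Holds β A (i :: v)} := by
  simp only [count, eval_sum, eval_ite, eval_const, card_filter]
@[simp] theorem holds_all (n c : Ex) : (all n c).Holds β A v ↔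
    ∀ i < min (n.eval β A v) β, c.Holds β A (i :: v) := by
  have : ∀ x : Ex, x.Holds β A v ↔ x.eval β A v ≠ 0 := fun _ => Iff.rfl
  rw [all, holds_not, this, eval_count, not_ne_iff, card_eq_zero, filter_eq_empty_iff]
  simp
theorem holds_count (n c : Ex) : (count n c).Holds β A v ↔
    ∃ i < min (n.eval β A v) β, c.Holds β A (i :: v) := by
  rw [Holds, eval_count, Finset.card_ne_zero]
  simp [Finset.Nonempty, and_assoc]

/-- Whether array `a` occurs in the expression. -/
def reads (a : ℕ) : Ex → Bool
  | .const _ => false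
  | .var _ => false
  | .get b i => a == b || i.reads a
  | .add x y => x.reads a || y.reads a
  | .sub x y => x.reads a || y.reads a
  | .ite c x y => c.reads a || x.reads a || y.reads a
  | .sum n b => n.reads a || b.reads a
  | .call f x y z w => f.reads a || x.reads a || y.reads a || z.reads a || w.reads a

theorem eval_congr {A B : ℕ → ℕ → ℕ} (e : Ex) : ∀ (v : List ℕ),
    (∀ a, e.reads a = true → A a = B a) → e.eval β A v = e.eval β B v := by
  induction e with
  | const k => intro v _; rfl
  | var i => intro v _; rfl
  | get a i ih =>
    intro v h
    simp only [reads, Bool.or_eq_true, beq_iff_eq] at h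
    rw [eval_get, eval_get, ih v fun b hb => h b (Or.inr hb), h a (Or.inl rfl)]
  | add x y ihx ihy =>
    intro v h
    simp only [reads, Bool.or_eq_true] at h
    rw [eval_add, eval_add, ihx v fun b hb => h b (Or.inl hb), ihy v fun b hb => h b (Or.inr hb)]
  | sub x y ihx ihy =>
    intro v h
    simp only [reads, Bool.or_eq_true] at h
    rw [eval_sub, eval_sub, ihx v fun b hb => h b (Or.inl hb), ihy v fun b hb => h b (Or.inr hb)]
  | ite c x y ihc ihx ihy =>
    intro v h
    simp only [reads, Bool.or_eq_true] at h
    simp only [eval]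
    rw [ihc v fun b hb => h b (Or.inl (Or.inl hb)), ihx v fun b hb => h b (Or.inl (Or.inr hb)),
      ihy v fun b hb => h b (Or.inr hb)]
  | sum n b ihn ihb =>
    intro v h
    simp only [reads, Bool.or_eq_true] at h
    rw [eval_sum, eval_sum, ihn v fun b hb => h b (Or.inl hb)]
    exact Finset.sum_congr rfl fun i _ => ihb _ fun b hb => h b (Or.inr hb)
  | call f x y z w ihf ihx ihy ihz ihw =>
    intro v h
    simp only [reads, Bool.or_eq_true] at h
    rw [eval_call, eval_call, ihx v fun b hb => h b (by simp [hb]),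
      ihy v fun b hb => h b (by simp [hb]), ihz v fun b hb => h b (by simp [hb]),
      ihw v fun b hb => h b (by simp [hb])]
    exact ihf _ fun b hb => h b (by simp [hb])

theorem eval_update {a : ℕ} {e : Ex} (h : e.reads a = false) (f : ℕ → ℕ) (v : List ℕ) :
    e.eval β (Function.update A a f) v = e.eval β A v :=
  e.eval_congr v fun b hb => Function.update_of_ne (fun hba => by simp [hba, h] at hb) _ _

end Ex

theorem rounds_congr {α : Type*} {f g : ℕ → α → α} {n : ℕ} (h : ∀ i < n, ∀ a, f i a = g i a)
    (a : α) : rounds f n a = rounds g n a := by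
  induction n with
  | zero => rfl
  | succ n ih => rw [rounds, rounds, ih fun i hi => h i (by omega), h n (by omega)]

/-- Storing values that do not depend on the array they are stored in. -/
theorem Stmt.run_loop_store {β : ℕ} {n e : Ex} {a : ℕ} {v : List ℕ} {A : ℕ → ℕ → ℕ}
    (h : e.reads a = false) :
    (Stmt.loop n (.store a (.var 0) e)).run β v A = Function.update A a fun k =>
      if k < min (n.eval β A v) β then e.eval β A (k :: v) else A a k := by
  simp only [run]
  generalize min (n.eval β A v) β = N
  induction N with
  | zero => simp [rounds]
  | succ N ih =>
    rw [rounds, ih]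
    simp only [Ex.eval_var_zero, Function.update_self, Ex.eval_update h, Function.update_idem]
    congr 1
    ext k
    rcases eq_or_ne k N with rfl | hk
    · simp
    · have : k < N + 1 ↔ k < N := by omega
      simp [hk, this]

/-! ### Expressions for the classes and the colors -/

/-- The number of levels. -/
def depthE : Ex := .get 0 (.const 2)
/-- The number of elements. -/
def cardE : Ex := .get 0 (.get 2 (.add depthE (.const 1)))

/-- Arguments `x, y`. -/
def mulE : Ex := .sum (.var 0) (.var 2)
/-- Arguments `x, y`. -/
def divE : Ex := .count (.var 0) (.le (.call₂ mulE (.add (.var 0) (.const 1)) (.var 2)) (.var 1))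

/-- Whether vertex `(a, b)` lies in square number `i` of level `h`; arguments `h, i, a, b`. -/
def inSquareE : Ex :=
  .and (.and (.le (.get 0 (.add (.add (.get 2 (.var 0)) (.const 1)) (.add (.var 1) (.var 1)))) (.var 2))
      (.lt (.var 2) (.add (.get 0 (.add (.add (.get 2 (.var 0)) (.const 1)) (.add (.var 1) (.var 1))))
        (.get 0 (.add (.var 0) (.const 2))))))
    (.and (.le (.get 0 (.add (.add (.get 2 (.var 0)) (.const 2)) (.add (.var 1) (.var 1)))) (.var 3))
      (.lt (.var 3) (.add (.get 0 (.add (.add (.get 2 (.var 0)) (.const 2)) (.add (.var 1) (.var 1))))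
        (.get 0 (.add (.var 0) (.const 2))))))

/-- The number of the level-`h` square of element `k`; arguments `h, k`. -/
def labE : Ex := .ite (.var 0)
  (.sum (.get 0 (.get 2 (.var 0)))
    (.ite (.call inSquareE (.var 1) (.var 0) (.get 3 (.var 2)) (.get 4 (.var 2))) (.var 0) (.const 0)))
  (.const 0)

/-- The level-`h` color of element `k`; arguments `h, k`. -/
def colE : Ex := .ite (.var 0)
  (.call₂ divE (.get 5 (.var 1)) (.get 0 (.add (.add (.var 0) (.const 2)) depthE))) (.const 0)

/-- The selection problem given by the arrays `0, 2, …, 6`. -/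
def problem (β : ℕ) (A : ℕ → ℕ → ℕ) : LaminarProblem where
  n := cardE.eval β A []
  depth := depthE.eval β A []
  lab h k := labE.eval β A [h, k, 0, 0]
  col h k := colE.eval β A [h, k, 0, 0]
  cap := A 6

/-- Marks, stack and scratch data live in the arrays from `7` on, so the selection problem stays the
same while the algorithm runs. -/
theorem problem_congr {β : ℕ} {A B : ℕ → ℕ → ℕ} (h : ∀ a < 7, A a = B a) :
    problem β A = problem β B := by
  have : ∀ e : Ex, (∀ a, e.reads a = true → a < 7) → ∀ v, e.eval β A v = e.eval β B v :=
    fun e he v => e.eval_congr v fun a ha => h a (he a ha)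
  have h₁ : ∀ a, labE.reads a = true → a < 7 := by
    intro a
    simp only [labE, inSquareE, Ex.reads, Ex.and, Ex.le, Ex.lt, Ex.not,
      Bool.or_eq_true, beq_iff_eq]
    simp; omega
  have h₂ : ∀ a, colE.reads a = true → a < 7 := by
    intro a
    simp only [colE, divE, mulE, depthE, Ex.reads, Ex.le, Ex.call₂, Ex.count, Ex.not,
      Bool.or_eq_true, beq_iff_eq]
    simp; omega
  simp only [problem, this labE h₁, this colE h₂, LaminarProblem.mk.injEq, h 6 (by omega), and_true]
  simp [cardE, depthE, h 0, h 2]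

/-- The selected elements, which are marked in array `7`. -/
def marked (β : ℕ) (A : ℕ → ℕ → ℕ) : Finset ℕ := {k ∈ range (problem β A).n | A 7 k ≠ 0}

/-- Arguments `x, y`. -/
def compatE : Ex := .all depthE
  (.or (.not (.eq (.call₂ labE (.add (.var 0) (.const 1)) (.var 1))
      (.call₂ labE (.add (.var 0) (.const 1)) (.var 2))))
    (.eq (.call₂ colE (.add (.var 0) (.const 1)) (.var 1))
      (.call₂ colE (.add (.var 0) (.const 1)) (.var 2))))

/-- Argument `k`. -/
def addableE : Ex := .all depthE (.lt
  (.count cardE (.and (.get 7 (.var 0)) (.and (.call₂ compatE (.var 2) (.var 0))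
    (.eq (.call₂ colE (.add (.var 1) (.const 1)) (.var 0))
      (.call₂ colE (.add (.var 1) (.const 1)) (.var 2))))))
  (.get 6 (.add (.var 0) (.const 1))))

/-- Arguments `h, k`. -/
def cntE : Ex := .count cardE (.and (.get 7 (.var 0))
  (.and (.eq (.call₂ labE (.var 1) (.var 0)) (.call₂ labE (.var 1) (.var 2)))
    (.eq (.call₂ colE (.var 1) (.var 0)) (.call₂ colE (.var 1) (.var 2)))))

/-- Arguments `h, k`. -/
def beatenE : Ex := .count cardE (.and (.get 7 (.var 0))
  (.and (.eq (.call₂ labE (.var 1) (.var 0)) (.call₂ labE (.var 1) (.var 2)))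
  (.and (.eq (.call₂ colE (.sub (.var 1) (.const 1)) (.var 0))
      (.call₂ colE (.sub (.var 1) (.const 1)) (.var 2)))
    (.or (.lt (.call₂ cntE (.var 1) (.var 2)) (.call₂ cntE (.var 1) (.var 0)))
      (.and (.eq (.call₂ cntE (.var 1) (.var 2)) (.call₂ cntE (.var 1) (.var 0)))
        (.lt (.call₂ colE (.var 1) (.var 0)) (.call₂ colE (.var 1) (.var 2))))))))

/-- No element before `k` has the same class as `k` at level `h`; arguments `h, k`. -/
def firstE : Ex := .all (.var 1)
  (.not (.eq (.call₂ labE (.var 1) (.var 0)) (.call₂ labE (.var 1) (.var 2))))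

section

variable {β : ℕ} {A : ℕ → ℕ → ℕ}

@[simp] theorem eval_cardE (v : List ℕ) : cardE.eval β A v = (problem β A).n := rfl
@[simp] theorem eval_depthE (v : List ℕ) : depthE.eval β A v = (problem β A).depth := rfl
@[simp] theorem eval_labE (h k : ℕ) : labE.eval β A [h, k, 0, 0] = (problem β A).lab h k := rfl
@[simp] theorem eval_colE (h k : ℕ) : colE.eval β A [h, k, 0, 0] = (problem β A).col h k := rfl

theorem mem_marked {k : ℕ} : k ∈ marked β A ↔ k < (problem β A).n ∧ A 7 k ≠ 0 := by simp [marked]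

/-- The statement for the loops to be carried out completely. -/
structure Fits (β : ℕ) (A : ℕ → ℕ → ℕ) : Prop where
  card_le : (problem β A).n ≤ β
  depth_le : (problem β A).depth ≤ β

theorem Fits.holds_compatE (hA : Fits β A) (x y : ℕ) :
    compatE.Holds β A [x, y, 0, 0] ↔ (problem β A).Compat x y := by
  simp [compatE, LaminarProblem.Compat, min_eq_left hA.depth_le, imp_iff_not_or]

open scoped Classical in
theorem Fits.holds_addableE (hA : Fits β A) (k : ℕ) (y z w : ℕ) : addableE.Holds β A [k, y, z, w] ↔
    ∀ h < (problem β A).depth, #{x ∈ marked β A | (problem β A).Compat k x ∧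
      (problem β A).col (h + 1) x = (problem β A).col (h + 1) k} < (problem β A).cap (h + 1) := by
  simp only [addableE, Ex.holds_all, eval_depthE, min_eq_left hA.depth_le, Ex.holds_lt,
    Ex.eval_count, eval_cardE, min_eq_left hA.card_le, Ex.holds_and, Ex.holds_get,
    Ex.eval_var_zero, Ex.eval_var_one, Ex.eval_var_two, Ex.holds_call₂, hA.holds_compatE,
    Ex.holds_eq, Ex.eval_call₂, Ex.eval_add, Ex.eval_const, eval_colE, Ex.eval_get, marked,
    filter_filter]
  rfl

theorem Fits.eval_cntE (hA : Fits β A) (h k : ℕ) :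
    cntE.eval β A [h, k, 0, 0] = (problem β A).cnt (marked β A) h k := by
  simp only [cntE, Ex.eval_count, eval_cardE, min_eq_left hA.card_le, Ex.holds_and, Ex.holds_get,
    Ex.eval_var_zero, Ex.eval_var_one, Ex.eval_var_two, Ex.holds_eq, Ex.eval_call₂, eval_labE,
    eval_colE, marked, LaminarProblem.cnt, filter_filter]

theorem Fits.holds_beatenE (hA : Fits β A) (h k : ℕ) :
    beatenE.Holds β A [h, k, 0, 0] ↔ (problem β A).Beaten (marked β A) h k := by
  simp only [beatenE, Ex.holds_count, eval_cardE, min_eq_left hA.card_le, Ex.holds_and,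
    Ex.holds_get, Ex.eval_var_zero, Ex.eval_var_one, Ex.eval_var_two, Ex.holds_eq, Ex.eval_call₂,
    eval_labE, eval_colE, Ex.eval_sub, Ex.eval_const, Ex.holds_or, Ex.holds_lt, hA.eval_cntE,
    LaminarProblem.Beaten, mem_marked, and_assoc]

theorem holds_firstE {h k : ℕ} (hk : k ≤ β) : firstE.Holds β A [h, k, 0, 0] ↔
    ∀ j < k, (problem β A).lab h j ≠ (problem β A).lab h k := by
  simp [firstE, min_eq_left hk]

end

end RandRAM

namespace RandRAM

open Finset

namespace Stmt

variable {β : ℕ} {A : ℕ → ℕ → ℕ} {v : List ℕ}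

theorem run_store (a : ℕ) (i e : Ex) : (store a i e).run β v A =
    Function.update A a (Function.update (A a) (i.eval β A v) (e.eval β A v)) := rfl
theorem run_seq (p q : Stmt) : (seq p q).run β v A = q.run β v (p.run β v A) := rfl
theorem run_ite (e : Ex) (p q : Stmt) : (ite e p q).run β v A =
    if e.Holds β A v then p.run β v A else q.run β v A := rfl
theorem run_loop (n : Ex) (p : Stmt) : (loop n p).run β v A =
    rounds (fun i A => p.run β (i :: v) A) (min (n.eval β A v) β) A := rfl

end Stmt

/-! ### The greedy selection as a statement -/

/-- One more than the current level. -/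
def levelE : Ex := .get 10 (.const 0)
/-- The element that is inspected at the next level. -/
def childE : Ex := .get 9 levelE
/-- The representative of the current class. -/
def parentE : Ex := .get 9 (.sub levelE (.const 1))

def advanceS : Stmt := .store 9 levelE (.add childE (.const 1))

/-- The language has no empty statement; storing the level where it already is serves as one, here
and in `stepS`. -/
def addS : Stmt := .ite (.call₂ addableE childE (.const 0)) (.store 7 childE (.const 1))
  (.store 10 (.const 0) levelE)

/-- The survivors are collected in array `8` first, since `beatenE` counts the marks in array `7`
and must see them unchanged during the whole pass. -/
def pruneS : Stmt := .seq
  (.loop cardE (.store 8 (.var 0) (.ite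
    (.and (.eq (.call₂ labE (.sub levelE (.const 1)) (.var 0))
        (.call₂ labE (.sub levelE (.const 1)) parentE))
      (.call₂ beatenE (.sub levelE (.const 1)) (.var 0))) (.const 0) (.get 7 (.var 0)))))
  (.loop cardE (.store 7 (.var 0) (.get 8 (.var 0))))

/-- A step of the depth-first traversal of the classes. Array `9` holds the stack of elements and
array `10` its height. -/
def stepS : Stmt := .ite levelE
  (.ite (.lt childE cardE)
    (.ite (.and (.eq (.call₂ labE (.sub levelE (.const 1)) childE)
        (.call₂ labE (.sub levelE (.const 1)) parentE))
        (.or (.eq (.sub levelE (.const 1)) depthE) (.call₂ firstE levelE childE)))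
      (.ite (.eq (.sub levelE (.const 1)) depthE)
        (.seq addS advanceS)
        (.seq (.store 9 (.add levelE (.const 1)) (.const 0))
          (.store 10 (.const 0) (.add levelE (.const 1)))))
      advanceS)
    (.seq (.ite (.sub levelE (.const 1)) pruneS (.store 10 (.const 0) levelE))
      (.seq (.store 10 (.const 0) (.sub levelE (.const 1))) advanceS)))
  (.store 10 (.const 0) levelE)

variable {β : ℕ} {A : ℕ → ℕ → ℕ}

theorem store_level (A : ℕ → ℕ → ℕ) :
    Function.update A 10 (Function.update (A 10) 0 (A 10 0)) = A := by simp

theorem problem_update {a : ℕ} (ha : 7 ≤ a) (f : ℕ → ℕ) :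
    problem β (Function.update A a f) = problem β A :=
  problem_congr fun b hb => by rw [Function.update_of_ne (by omega)]

theorem marked_update {a : ℕ} (ha : 7 < a) (f : ℕ → ℕ) :
    marked β (Function.update A a f) = marked β A := by
  rw [marked, marked, problem_update ha.le, Function.update_of_ne (by omega)]

theorem Fits.congr {B : ℕ → ℕ → ℕ} (hA : Fits β A) (h : ∀ a < 7, B a = A a) : Fits β B := by
  have := problem_congr (β := β) h
  exact ⟨this ▸ hA.1, this ▸ hA.2⟩

/-- The arrays `0, …, 6` are the same. -/
def SameInput (A B : ℕ → ℕ → ℕ) : Prop := ∀ a < 7, B a = A a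

theorem SameInput.problem_eq {B : ℕ → ℕ → ℕ} (h : SameInput A B) : problem β B = problem β A :=
  problem_congr h

theorem Fits.run_addS (hA : Fits β A) (v : List ℕ) :
    let B := addS.run β v A
    SameInput A B ∧ B 9 = A 9 ∧ B 10 = A 10 ∧
      (A 9 (A 10 0) < (problem β A).n →
        marked β B = (problem β A).add (A 9 (A 10 0)) (marked β A)) := by
  classical
  have hrun : addS.run β v A = if addableE.Holds β A [A 9 (A 10 0), 0, 0, 0] then
      Function.update A 7 (Function.update (A 7) (A 9 (A 10 0)) 1) else A := by
    simp only [addS, Stmt.run_ite, Stmt.run_store, Ex.holds_call₂, childE, levelE, Ex.eval_get,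
      Ex.eval_const, store_level]
  intro B
  simp only [B, hrun]
  simp only [hA.holds_addableE, LaminarProblem.add]
  split_ifs with h
  · refine ⟨fun a ha => Function.update_of_ne (by omega) _ _,
      Function.update_of_ne (by omega) _ _, Function.update_of_ne (by omega) _ _, fun hn => ?_⟩
    ext x
    rw [mem_marked, problem_update le_rfl, Finset.mem_insert, mem_marked]
    rcases eq_or_ne x (A 9 (A 10 0)) with rfl | hx
    · simp [hn]
    · simp [hx]
  · exact ⟨fun _ _ => rfl, rfl, rfl, fun _ => rfl⟩

theorem Fits.run_pruneS (hA : Fits β A) (v : List ℕ) :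
    let B := pruneS.run β v A
    SameInput A B ∧ B 9 = A 9 ∧ B 10 = A 10 ∧
      marked β B = (problem β A).prune (A 10 0 - 1) (A 9 (A 10 0 - 1)) (marked β A) := by
  classical
  intro B
  have hB : B = pruneS.run β v A := rfl
  rw [pruneS, Stmt.run, Stmt.run_loop_store (by decide), Stmt.run_loop_store (by decide)] at hB
  refine ⟨fun a ha => ?_, ?_, ?_, ?_⟩
  · rw [hB, Function.update_of_ne (by omega), Function.update_of_ne (by omega)]
  · rw [hB, Function.update_of_ne (by omega), Function.update_of_ne (by omega)]
  · rw [hB, Function.update_of_ne (by omega), Function.update_of_ne (by omega)]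
  · ext x
    rw [hB, mem_marked, problem_update le_rfl, problem_update (by omega), LaminarProblem.prune,
      mem_filter, mem_marked]
    simp only [Function.update_self, eval_cardE, problem_update (le_of_lt (Nat.lt_succ_self 7)),
      min_eq_left hA.card_le]
    by_cases hx : x < (problem β A).n
    · simp [hx, hA.holds_beatenE, levelE, parentE]
      tauto
    · simp [hx]

section Step

variable {h i : ℕ} (v : List ℕ)

theorem run_stepS_final (h₀ : A 10 0 = 0) : stepS.run β v A = A := by
  rw [stepS, Stmt.run_ite, if_neg (by simp [levelE, h₀]), Stmt.run_store]
  simp only [levelE, Ex.eval_get, Ex.eval_const, store_level]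

theorem run_stepS_inspect (h₁ : A 10 0 = h + 1) (h₂ : A 9 (h + 1) = i)
    (hi : i < (problem β A).n) : stepS.run β v A =
    if (problem β A).lab h i = (problem β A).lab h (A 9 h) ∧
      (h = (problem β A).depth ∨ firstE.Holds β A [h + 1, i, 0, 0])
    then if h = (problem β A).depth then advanceS.run β v (addS.run β v A)
      else Function.update (Function.update A 9 (Function.update (A 9) (h + 2) 0)) 10
        (Function.update (A 10) 0 (h + 2))
    else Function.update A 9 (Function.update (A 9) (h + 1) (i + 1)) := by
  have e₁ : levelE.eval β A v = h + 1 := h₁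
  have e₂ : childE.eval β A v = i := by rw [childE, Ex.eval_get, e₁, h₂]
  have e₃ : parentE.eval β A v = A 9 h := by simp [parentE, e₁]
  rw [stepS, Stmt.run_ite, if_pos (by rw [Ex.Holds, e₁]; omega), Stmt.run_ite,
    if_pos (by rw [Ex.holds_lt, e₂]; exact hi), Stmt.run_ite]
  simp only [Ex.holds_and, Ex.holds_or, Ex.holds_eq, Ex.eval_call₂, Ex.eval_sub, Ex.eval_const,
    e₁, e₂, e₃, eval_labE, eval_depthE, Ex.holds_call₂, Stmt.run_ite, Nat.add_sub_cancel]
  refine if_congr Iff.rfl (if_congr Iff.rfl (Stmt.run_seq _ _) ?_) ?_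
  · simp only [Stmt.run_seq, Stmt.run_store, Ex.eval_add, Ex.eval_const, levelE, Ex.eval_get,
      Function.update_of_ne (show (10 : ℕ) ≠ 9 by decide), h₁]
  · simp only [advanceS, Stmt.run_store, Ex.eval_add, e₁, e₂, Ex.eval_const]

theorem Fits.run_stepS_advance (hA : Fits β A) (h₁ : A 10 0 = h + 1) (h₂ : A 9 (h + 1) = i)
    (hi : i < (problem β A).n)
    (hif : ¬ ((problem β A).lab h i = (problem β A).lab h (A 9 h) ∧ (h = (problem β A).depth ∨
      ∀ j < i, (problem β A).lab (h + 1) j ≠ (problem β A).lab (h + 1) i))) :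
    stepS.run β v A = Function.update A 9 (Function.update (A 9) (h + 1) (i + 1)) := by
  rw [run_stepS_inspect v h₁ h₂ hi,
    if_neg fun H => hif ⟨H.1, H.2.imp_right (holds_firstE (hi.le.trans hA.card_le)).1⟩]

theorem Fits.run_stepS_add (hA : Fits β A) (h₁ : A 10 0 = h + 1) (h₂ : A 9 (h + 1) = i)
    (hi : i < (problem β A).n) (hl : (problem β A).lab h i = (problem β A).lab h (A 9 h))
    (hd : h = (problem β A).depth) :
    let B := stepS.run β v A
    SameInput A B ∧ B 10 0 = h + 1 ∧ B 9 = Function.update (A 9) (h + 1) (i + 1) ∧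
      marked β B = (problem β A).add i (marked β A) := by
  intro B
  have hB : B = advanceS.run β v (addS.run β v A) := by
    simp only [B]
    rw [run_stepS_inspect v h₁ h₂ hi, if_pos ⟨hl, Or.inl hd⟩, if_pos hd]
  obtain ⟨b₁, b₂, b₃, b₄⟩ := hA.run_addS v
  rw [h₁, h₂] at b₄
  simp only [advanceS, Stmt.run_store, Ex.eval_add, childE, levelE, Ex.eval_get, Ex.eval_const,
    b₂, b₃, h₁, h₂] at hB
  rw [hB]
  refine ⟨fun a ha => ?_, ?_, ?_, ?_⟩
  · rw [Function.update_of_ne (by omega), b₁ a ha]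
  · rw [Function.update_of_ne (by omega), b₃, h₁]
  · rw [Function.update_self]
  · rw [marked_update (by omega), b₄ hi]

theorem Fits.run_stepS_open (hA : Fits β A) (h₁ : A 10 0 = h + 1) (h₂ : A 9 (h + 1) = i)
    (hi : i < (problem β A).n) (hl : (problem β A).lab h i = (problem β A).lab h (A 9 h))
    (hd : h ≠ (problem β A).depth)
    (hf : ∀ j < i, (problem β A).lab (h + 1) j ≠ (problem β A).lab (h + 1) i) :
    stepS.run β v A = Function.update (Function.update A 9 (Function.update (A 9) (h + 2) 0)) 10
        (Function.update (A 10) 0 (h + 2)) := by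
  rw [run_stepS_inspect v h₁ h₂ hi,
    if_pos ⟨hl, Or.inr ((holds_firstE (hi.le.trans hA.card_le)).2 hf)⟩, if_neg hd]

/-- The root class has no preceding level and is not pruned. Closing it sets the height to `0`,
where the traversal rests. -/
theorem Fits.run_stepS_close (hA : Fits β A) (h₁ : A 10 0 = h + 1)
    (hi : (problem β A).n ≤ A 9 (h + 1)) :
    let B := stepS.run β v A
    SameInput A B ∧ B 10 0 = h ∧ B 9 = Function.update (A 9) h (A 9 h + 1) ∧
      marked β B = if h ≠ 0 then (problem β A).prune h (A 9 h) (marked β A) else marked β A := by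
  intro B
  have e₁ : levelE.eval β A v = h + 1 := h₁
  have e₂ : childE.eval β A v = A 9 (h + 1) := by rw [childE, Ex.eval_get, e₁]
  set C := if h ≠ 0 then pruneS.run β v A else A with hC
  have hB : B = Function.update (Function.update C 10 (Function.update (C 10) 0 (C 10 0 - 1))) 9
      (Function.update (C 9) (C 10 0 - 1) (C 9 (C 10 0 - 1) + 1)) := by
    simp only [B]
    rw [stepS, Stmt.run_ite, if_pos (by rw [Ex.Holds, e₁]; omega), Stmt.run_ite,
      if_neg (by rw [Ex.holds_lt, e₂, eval_cardE]; omega), Stmt.run_seq, Stmt.run_ite,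
      Stmt.run_store, e₁, Ex.eval_const, ← h₁, store_level]
    simp only [Ex.holds_sub, e₁, Ex.eval_const, Nat.add_sub_cancel, ← hC]
    simp only [advanceS, Stmt.run_seq, Stmt.run_store, childE, levelE, Ex.eval_add, Ex.eval_get,
      Ex.eval_sub, Ex.eval_const, Function.update_self,
      Function.update_of_ne (show (9 : ℕ) ≠ 10 by decide)]
  obtain ⟨b₁, b₂, b₃, b₄⟩ : SameInput A C ∧ C 9 = A 9 ∧ C 10 = A 10 ∧ marked β C =
      if h ≠ 0 then (problem β A).prune h (A 9 h) (marked β A) else marked β A := by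
    rw [hC]
    split_ifs with hh
    · simpa [h₁] using hA.run_pruneS v
    · exact ⟨fun _ _ => rfl, rfl, rfl, rfl⟩
  rw [b₂, b₃, h₁, Nat.add_sub_cancel] at hB
  rw [hB]
  refine ⟨fun a ha => ?_, ?_, ?_, ?_⟩
  · rw [Function.update_of_ne (by omega), Function.update_of_ne (by omega), b₁ a ha]
  · rw [Function.update_of_ne (by omega)]; simp
  · rw [Function.update_self]
  · rw [marked_update (by omega), marked_update (by omega), b₄]

theorem run_stepS_indep : stepS.run β v A = stepS.run β [] A := by rfl

end Step

/-! ### Simulation of the recursion with an explicit stack -/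

/-- The state `B` is reached from `A` in `j` steps, at the same level `h` and with the same classes
on the stack, when the next element to be inspected is `i`. -/
structure Traverses (β : ℕ) (A : ℕ → ℕ → ℕ) (h i : ℕ) (S : Finset ℕ) (j : ℕ) (B : ℕ → ℕ → ℕ) :
    Prop where
  steps : (stepS.run β [])^[j] A = B
  input : SameInput A B
  level : B 10 0 = h + 1
  stack : ∀ g ≤ h, B 9 g = A 9 g
  child : B 9 (h + 1) = i
  marked_eq : marked β B = S

/-- Every inspected element costs one step, and an opened subclass costs `w` further steps per
element. The opened subclasses are disjoint, so these steps add up to at most `w` times the size of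
the class. -/
theorem traverses_scan {h : ℕ} (h₁ : A 10 0 = h + 1)
    (h₂ : A 9 (h + 1) = 0) {L : ℕ → ℕ} {step : ℕ → Finset ℕ → Finset ℕ} {w : ℕ}
    (hL : ∀ x < (problem β A).n, ∀ y < (problem β A).n, L x = L y →
      (problem β A).lab h x = (problem β A).lab h y)
    (hadv : ∀ i < (problem β A).n, ¬ ((problem β A).lab h i = (problem β A).lab h (A 9 h) ∧
      ∀ j < i, L j ≠ L i) → ∀ S j B, Traverses β A h i S j B → ∃ B',
      Traverses β A h (i + 1) S (j + 1) B')
    (hstep : ∀ i < (problem β A).n, (problem β A).lab h i = (problem β A).lab h (A 9 h) →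
      (∀ j < i, L j ≠ L i) → ∀ S j B, Traverses β A h i S j B →
      ∃ j' B', j' ≤ j + 1 + w * #{x ∈ range (problem β A).n | L x = L i} ∧
        Traverses β A h (i + 1) (step i S) j' B') :
    ∃ j B, j ≤ (problem β A).n + w * #((problem β A).cls h (A 9 h)) ∧
      Traverses β A h (problem β A).n
        ((problem β A).scan h (A 9 h) L step (problem β A).n (marked β A)) j B := by
  classical
  set P := problem β A with hP
  have key : ∀ i ≤ P.n, ∃ j B, j ≤ i + w * #{x ∈ P.cls h (A 9 h) | ∃ i' < i, L i' = L x} ∧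
      Traverses β A h i (P.scan h (A 9 h) L step i (marked β A)) j B := by
    intro i
    induction i with
    | zero =>
      intro _
      exact ⟨0, A, by simp, rfl, fun _ _ => rfl, h₁, fun _ _ => rfl, h₂, rfl⟩
    | succ i ih =>
      intro hi
      obtain ⟨j, B, hj, T⟩ := ih (by omega)
      have hscan : P.scan h (A 9 h) L step (i + 1) (marked β A) =
        if P.lab h i = P.lab h (A 9 h) ∧ ∀ j < i, L j ≠ L i
        then step i (P.scan h (A 9 h) L step i (marked β A))
        else P.scan h (A 9 h) L step i (marked β A) := by
        simp only [LaminarProblem.scan, rounds]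
      rw [hscan]
      have hmono : ({x ∈ P.cls h (A 9 h) | ∃ i' < i, L i' = L x} : Finset ℕ) ⊆
          {x ∈ P.cls h (A 9 h) | ∃ i' < i + 1, L i' = L x} := by
        intro x hx
        rw [mem_filter] at hx ⊢
        obtain ⟨hx, i', hi', hl⟩ := hx
        exact ⟨hx, i', by omega, hl⟩
      split_ifs with hif
      · obtain ⟨j', B', hj', T'⟩ := hstep i (by omega) hif.1 hif.2 _ j B T
        refine ⟨j', B', hj'.trans ?_, T'⟩
        -- A subclass is opened at its first element only, hence it is disjoint from the subclasses
        -- seen before.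
        have hcard : #{x ∈ P.cls h (A 9 h) | ∃ i' < i, L i' = L x} +
            #{x ∈ range P.n | L x = L i} ≤
            #{x ∈ P.cls h (A 9 h) | ∃ i' < i + 1, L i' = L x} := by
          rw [← card_union_of_disjoint]
          · refine card_le_card (union_subset hmono fun x hx => ?_)
            rw [mem_filter, mem_range] at hx
            rw [mem_filter, LaminarProblem.mem_cls]
            exact ⟨⟨hx.1, (hL x hx.1 i (by omega) hx.2).trans hif.1⟩, i, by omega, hx.2.symm⟩
          · refine disjoint_left.2 fun x hx hx' => ?_
            rw [mem_filter] at hx hx'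
            obtain ⟨i', hi', hl⟩ := hx.2
            exact hif.2 i' hi' (hl.trans hx'.2)
        have := Nat.mul_le_mul_left w hcard
        rw [Nat.mul_add] at this
        omega
      · obtain ⟨B', T'⟩ := hadv i (by omega) hif _ j B T
        refine ⟨j + 1, B', ?_, T'⟩
        have := Nat.mul_le_mul_left w (card_le_card hmono)
        omega
  obtain ⟨j, B, hj, T⟩ := key P.n le_rfl
  refine ⟨j, B, hj.trans ?_, T⟩
  gcongr
  exact filter_subset _ _

/-- The induction on the number of levels below follows `select`. Opening a subclass pushes the
counter `0`, closing it prunes and advances the counter of the parent; the stack below is untouched,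
so the traversal of the class can be resumed. -/
theorem Fits.traverses_select (hP : (problem β A).Hierarchical) (r : ℕ) : ∀ (h : ℕ)
    (B : ℕ → ℕ → ℕ), Fits β B → problem β B = problem β A → h + r = (problem β A).depth →
    B 10 0 = h + 1 → B 9 (h + 1) = 0 →
    ∃ j C, j ≤ (problem β A).n +
        (r + 1) * ((problem β A).n + 2) * #((problem β A).cls h (B 9 h)) ∧
      Traverses β B h (problem β A).n ((problem β A).select r h (B 9 h) (marked β B)) j C := by
  classical
  set P := problem β A with hPdef
  have next : ∀ {B : ℕ → ℕ → ℕ} {h i : ℕ} {S : Finset ℕ} {j : ℕ} {C : ℕ → ℕ → ℕ},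
      Traverses β B h i S j C → (stepS.run β [])^[j + 1] B = stepS.run β [] C := by
    intro B h i S j C T
    rw [Function.iterate_succ_apply', T.steps]
  have advance : ∀ {B : ℕ → ℕ → ℕ} {h i : ℕ} {S : Finset ℕ} {j : ℕ} {C : ℕ → ℕ → ℕ},
      Traverses β B h i S j C →
      stepS.run β [] C = Function.update C 9 (Function.update (C 9) (h + 1) (i + 1)) →
      Traverses β B h (i + 1) S (j + 1) (stepS.run β [] C) := by
    intro B h i S j C T hC
    refine ⟨next T, fun a ha => ?_, ?_, fun g hg => ?_, ?_, ?_⟩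
    · rw [hC, Function.update_of_ne (by omega), T.input a ha]
    · rw [hC, Function.update_of_ne (by omega), T.level]
    · rw [hC, Function.update_self, Function.update_of_ne (by omega), T.stack g hg]
    · rw [hC, Function.update_self, Function.update_self]
    · rw [hC, marked_update (by omega), T.marked_eq]
  induction r with
  | zero =>
    intro h B hB hBA hr h₁ h₂
    have := traverses_scan (A := B) (β := β) (L := id) (step := P.add) (w := 0) h₁ h₂
      (fun x _ y _ hl => by rw [id, id] at hl; rw [hl])
      (fun i hi hif S j C T => ⟨_, advance T ((hB.congr T.input).run_stepS_advance [] T.level T.child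
        (by rwa [T.input.problem_eq]) (by
          rw [T.input.problem_eq, T.stack h le_rfl]
          exact fun H => hif ⟨H.1, fun j hj => hj.ne⟩))⟩)
      (fun i hi hl hf S j C T => by
        obtain ⟨c₁, c₂, c₃, c₄⟩ := (hB.congr T.input).run_stepS_add [] T.level T.child
          (by rwa [T.input.problem_eq]) (by rwa [T.input.problem_eq, T.stack h le_rfl])
          (by rw [T.input.problem_eq, hBA]; exact hr)
        refine ⟨j + 1, stepS.run β [] C, by omega, next T, fun a ha => (c₁ a ha).trans (T.input a ha),
          c₂, fun g hg => ?_, ?_, ?_⟩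
        · rw [c₃, Function.update_of_ne (by omega), T.stack g hg]
        · rw [c₃, Function.update_self]
        · rw [c₄, T.input.problem_eq, hBA, T.marked_eq])
    rw [hBA] at this
    obtain ⟨j, C, hj, T⟩ := this
    exact ⟨j, C, by omega, T⟩
  | succ r ih =>
    intro h B hB hBA hr h₁ h₂
    have := traverses_scan (A := B) (β := β) (L := P.lab (h + 1))
      (step := fun i S => P.prune (h + 1) i (P.select r (h + 1) i S))
      (w := (r + 1 + 1) * (P.n + 2)) h₁ h₂
      (fun x hx y hy hl => by
        rw [hBA] at hx hy ⊢
        exact hP.lab_succ h (by omega) x hx y hy hl)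
      (fun i hi hif S j C T => ⟨_, advance T ((hB.congr T.input).run_stepS_advance [] T.level T.child
        (by rwa [T.input.problem_eq]) (by
          rw [T.input.problem_eq, T.stack h le_rfl, hBA]
          rw [hBA] at hif
          rintro ⟨h', h'' | h''⟩
          · omega
          · exact hif ⟨h', h''⟩))⟩)
      (fun i hi hl hf S j C T => by
        have hCA := T.input.problem_eq.trans hBA
        have hC := hB.congr T.input
        rw [hBA] at hi hl
        have ho := hC.run_stepS_open [] T.level T.child (by rwa [hCA])
          (by rwa [hCA, T.stack h le_rfl]) (by rw [hCA]; omega) (by rwa [hCA])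
        set D := stepS.run β [] C with hD
        have hDin : SameInput C D := fun a ha => by
          rw [ho, Function.update_of_ne (by omega), Function.update_of_ne (by omega)]
        have hD9 : D 9 = Function.update (C 9) (h + 2) 0 := by
          rw [ho, Function.update_of_ne (by omega), Function.update_self]
        have hDi : D 9 (h + 1) = i := by
          rw [hD9, Function.update_of_ne (by omega), T.child]
        have hDm : marked β D = S := by
          rw [ho, marked_update (by omega), marked_update (by omega), T.marked_eq]
        obtain ⟨j₁, E, hj₁, TE⟩ := ih (h + 1) D (hC.congr hDin)
          (hDin.problem_eq.trans hCA) (by omega) (by rw [ho]; simp) (by rw [hD9]; simp)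
        rw [hDi, hDm] at TE
        rw [hDi] at hj₁
        have hEA := TE.input.problem_eq.trans (hDin.problem_eq.trans hCA)
        obtain ⟨c₁, c₂, c₃, c₄⟩ := (hC.congr hDin |>.congr TE.input).run_stepS_close [] TE.level
          (by rw [hEA, TE.child])
        refine ⟨j + 1 + j₁ + 1, stepS.run β [] E, ?_, ?_, ?_, c₂, fun g hg => ?_, ?_, ?_⟩
        -- The subclass is nonempty, so the steps that do not scale with its size, at most `n + 1`
        -- besides the inspection, are charged to its elements. This is why `w` grows by `n + 2` per
        -- level.
        · have hpos : 1 ≤ #(P.cls (h + 1) i) :=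
            card_pos.2 ⟨i, LaminarProblem.mem_cls.2 ⟨hi, rfl⟩⟩
          have hcls : #{x ∈ range (problem β B).n | P.lab (h + 1) x = P.lab (h + 1) i}
              = #(P.cls (h + 1) i) := by rw [hBA]; rfl
          rw [hcls]
          have : (r + 1 + 1) * (P.n + 2) * #(P.cls (h + 1) i) =
            (r + 1) * (P.n + 2) * #(P.cls (h + 1) i) + (P.n + 2) * #(P.cls (h + 1) i) := by ring
          have := Nat.mul_le_mul_left (P.n + 2) hpos
          omega
        · rw [show j + 1 + j₁ + 1 = (j₁ + 1) + (j + 1) by omega, Function.iterate_add_apply,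
            next T, ← hD, next TE]
        · exact fun a ha => (c₁ a ha).trans ((TE.input a ha).trans ((hDin a ha).trans
            (T.input a ha)))
        · rw [c₃, Function.update_of_ne (by omega), TE.stack g (by omega), hD9,
            Function.update_of_ne (by omega), T.stack g hg]
        · rw [c₃, Function.update_self, TE.stack (h + 1) le_rfl, hDi]
        · rw [c₄, if_pos (by omega), TE.stack (h + 1) le_rfl, hDi, TE.marked_eq, hEA])
    rw [hBA] at this
    obtain ⟨j, C, hj, T⟩ := this
    exact ⟨j, C, hj, T⟩

theorem Fits.sameInput_stepS (hA : Fits β A) (v : List ℕ) : SameInput A (stepS.run β v A) := by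
  rcases h₁ : A 10 0 with _ | h
  · rw [run_stepS_final v h₁]
    exact fun _ _ => rfl
  by_cases hi : A 9 (h + 1) < (problem β A).n
  · rw [run_stepS_inspect v h₁ rfl hi]
    split_ifs with _ hd
    · intro a ha
      rw [advanceS, Stmt.run_store, Function.update_of_ne (by omega), (hA.run_addS v).1 a ha]
    · intro a ha
      rw [Function.update_of_ne (by omega), Function.update_of_ne (by omega)]
    · intro a ha
      rw [Function.update_of_ne (by omega)]
  · exact (hA.run_stepS_close v h₁ (not_lt.1 hi)).1

theorem Stmt.run_loop_eq_iterate {Inv : (ℕ → ℕ → ℕ) → Prop} {g : (ℕ → ℕ → ℕ) → ℕ → ℕ → ℕ} {e : Ex}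
    {p : Stmt} {v : List ℕ} {M : ℕ} (hp : ∀ i B, Inv B → p.run β (i :: v) B = g B)
    (hg : ∀ B, Inv B → Inv (g B)) (hA : Inv A) (he : min (e.eval β A v) β = M) :
    (Stmt.loop e p).run β v A = g^[M] A ∧ Inv (g^[M] A) := by
  rw [run_loop, he]
  clear he
  induction M with
  | zero => exact ⟨rfl, hA⟩
  | succ M ih =>
    rw [rounds, ih.1, Function.iterate_succ_apply', hp _ _ ih.2]
    exact ⟨rfl, hg _ ih.2⟩

/-- The greedy selection, with empty arrays `7` and `9` at the beginning. -/
def greedyS : Stmt := .seq (.store 10 (.const 0) (.const 1))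
  (.loop (.add depthE (.const 1)) (.loop (.add cardE (.const 2)) (.loop (.add cardE (.const 2))
    stepS)))

/-- The final state is a fixed point of the step, so surplus steps are harmless and only an upper
bound on their number is needed. The three nested loops supply `(n + 2) * (n + 2) * (depth + 1)`
steps, enough for the traversal and the closing of the root. -/
theorem run_greedyS (hn : (problem β A).n + 2 ≤ β) (hd : (problem β A).depth + 1 ≤ β)
    (hP : (problem β A).Hierarchical) (h₇ : A 7 = 0) (h₉ : A 9 = 0) :
    SameInput A (greedyS.run β [] A) ∧ marked β (greedyS.run β [] A) = (problem β A).greedy := by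
  classical
  set A' := Function.update A 10 (Function.update (A 10) 0 1) with hA'
  have hin : SameInput A A' := fun a ha => Function.update_of_ne (by omega) _ _
  have hfit : Fits β A := ⟨by omega, by omega⟩
  set P := problem β A with hPdef
  have hfix : ∀ B, SameInput A B → SameInput A (stepS.run β [] B) := fun B hB a ha =>
    ((hfit.congr hB).sameInput_stepS [] a ha).trans (hB a ha)
  have hn' : ∀ B, SameInput A B → ∀ v, min ((Ex.add cardE (.const 2)).eval β B v) β = P.n + 2 := by
    intro B hB v
    rw [Ex.eval_add, eval_cardE, hB.problem_eq, Ex.eval_const, min_eq_left hn]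
  have hd' : ∀ B, SameInput A B → ∀ v, min ((Ex.add depthE (.const 1)).eval β B v) β
      = P.depth + 1 := by
    intro B hB v
    rw [Ex.eval_add, eval_depthE, hB.problem_eq, Ex.eval_const, min_eq_left hd]
  have loop₁ : ∀ (v : List ℕ) B, SameInput A B →
      (Stmt.loop (.add cardE (.const 2)) stepS).run β v B = (stepS.run β [])^[P.n + 2] B ∧
        SameInput A ((stepS.run β [])^[P.n + 2] B) := fun v B hB =>
    Stmt.run_loop_eq_iterate (Inv := SameInput A) (fun i B _ => run_stepS_indep _) hfix hB
      (hn' B hB v)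
  have loop₂ : ∀ (v : List ℕ) B, SameInput A B →
      (Stmt.loop (.add cardE (.const 2)) (.loop (.add cardE (.const 2)) stepS)).run β v B =
        ((stepS.run β [])^[P.n + 2])^[P.n + 2] B ∧
        SameInput A (((stepS.run β [])^[P.n + 2])^[P.n + 2] B) := fun v B hB =>
    Stmt.run_loop_eq_iterate (Inv := SameInput A) (fun i B hB => (loop₁ _ B hB).1)
      (fun B hB => (loop₁ [] B hB).2) hB (hn' B hB v)
  have loop₃ := Stmt.run_loop_eq_iterate (v := []) (Inv := SameInput A)
      (fun i B hB => (loop₂ _ B hB).1) (fun B hB => (loop₂ [] B hB).2) hin (hd' A' hin [])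
  have hrun : greedyS.run β [] A = (stepS.run β [])^[(P.n + 2) * (P.n + 2) * (P.depth + 1)] A' := by
    rw [greedyS, Stmt.run_seq, Stmt.run_store, Ex.eval_const, Ex.eval_const, ← hA', loop₃.1,
      ← Function.iterate_mul, ← Function.iterate_mul, mul_assoc]
  refine ⟨?_, ?_⟩
  · rw [greedyS, Stmt.run_seq, Stmt.run_store, Ex.eval_const, Ex.eval_const, ← hA', loop₃.1]
    exact loop₃.2
  obtain ⟨j, B, hj, T⟩ := Fits.traverses_select hP P.depth 0 A' (hfit.congr hin) hin.problem_eq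
    (Nat.zero_add _) (by simp [hA']) (by simp [hA', h₉])
  have h90 : A' 9 0 = 0 := by simp [hA', h₉]
  have hm : marked β A' = ∅ := by
    ext x; simp [mem_marked, hA', h₇]
  have hBin : SameInput A B := fun a ha => (T.input a ha).trans (hin a ha)
  obtain ⟨c₁, c₂, c₃, c₄⟩ := (hfit.congr hBin).run_stepS_close [] T.level
    (by rw [hBin.problem_eq, T.child])
  have hfinal : ∀ m, (stepS.run β [])^[m] (stepS.run β [] B) = stepS.run β [] B := fun m =>
    Function.iterate_fixed (run_stepS_final [] c₂) m
  have hle : j + 1 ≤ (P.n + 2) * (P.n + 2) * (P.depth + 1) := by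
    have h₁ : #(P.cls 0 (A' 9 0)) ≤ P.n := (card_filter_le _ _).trans (card_range _).le
    have h₂ := Nat.mul_le_mul_left ((P.depth + 1) * (P.n + 2)) h₁
    nlinarith
  obtain ⟨m, hm'⟩ := Nat.exists_eq_add_of_le hle
  rw [hrun, hm', add_comm, Function.iterate_add_apply, Function.iterate_succ_apply', T.steps, hfinal,
    c₄, if_neg (by simp), T.marked_eq, h90, hm]
  rfl

end RandRAM

/-! ### The geometry of the squares and colors -/

theorem mem_squareVertices {d : ℕ} {q w : ℕ × ℕ} : w ∈ squareVertices d q ↔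
    (q.1 ≤ w.1 ∧ w.1 < q.1 + d) ∧ (q.2 ≤ w.2 ∧ w.2 < q.2 + d) := by
  simp [squareVertices]

namespace SquareColorSystem

open Finset RandRAM

variable {H : SquareColorSystem}

theorem eta_pos : 0 < H.eta := pow_pos two_pos _

theorem d_pos (h : ℕ) : 0 < H.d h := pow_pos eta_pos _

theorem corner_mem (h : ℕ) (q : ℕ × ℕ) : q ∈ H.verts h q := by
  have := H.d_pos h
  rw [verts, mem_squareVertices]; omega

namespace Valid

/-- Points of distinct canonical intervals are more than `d` apart, so a common point would be at
distance `0 > d` from itself. -/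
theorem square_unique (hH : H.Valid) {h : ℕ} (h₁ : 1 ≤ h) (h₂ : h ≤ H.depth) {q q' w : ℕ × ℕ}
    (hq : q ∈ H.squares h) (hq' : q' ∈ H.squares h) (hw : w ∈ H.verts h q)
    (hw' : w ∈ H.verts h q') : q = q' := by
  obtain ⟨_, A, B, hA, hB, hmem⟩ := hH.canonical h h₁ h₂
  rw [hmem] at hq hq'
  rw [verts, squareVertices, mem_product] at hw hw'
  refine Prod.ext ?_ ?_
  · by_contra hne
    have := hA.2 _ hq.1 _ hq'.1 hne _ hw.1 _ hw'.1
    rw [sub_self, abs_zero] at this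
    omega
  · by_contra hne
    have := hB.2 _ hq.2 _ hq'.2 hne _ hw.2 _ hw'.2
    rw [sub_self, abs_zero] at this
    omega

theorem exists_ancestor (hH : H.Valid) {g h : ℕ} (hg : 1 ≤ g) (hgh : g ≤ h) (hh : h ≤ H.depth)
    {q : ℕ × ℕ} (hq : q ∈ H.squares h) : ∃ q' ∈ H.squares g, H.verts h q ⊆ H.verts g q' := by
  induction h, hgh using Nat.le_induction generalizing q with
  | base => exact ⟨q, hq, Subset.rfl⟩
  | succ h hgh ih =>
    obtain ⟨q', hq', hsub⟩ := hH.nested h (by omega) (by omega) q hq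
    obtain ⟨q'', hq'', hsub'⟩ := ih (by omega) hq'
    exact ⟨q'', hq'', hsub.trans hsub'⟩

theorem exists_square (hH : H.Valid) {w : ℕ × ℕ} (hw : H.Belongs w) {h : ℕ} (h₁ : 1 ≤ h)
    (h₂ : h ≤ H.depth) : ∃ q ∈ H.squares h, w ∈ H.verts h q := by
  obtain ⟨q, hq, hwq⟩ := hw
  obtain ⟨q', hq', hsub⟩ := hH.exists_ancestor h₁ h₂ le_rfl hq
  exact ⟨q', hq', hsub hwq⟩

theorem len_pos (hH : H.Valid) {h : ℕ} (h₁ : 1 ≤ h) (h₂ : h ≤ H.depth) : 0 < H.len h := by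
  obtain ⟨e, he⟩ := hH.len_pow h h₁ h₂
  rw [he]
  exact pow_pos eta_pos _

/-- All lengths are powers of `η`, so their order implies divisibility. -/
theorem len_dvd_len (hH : H.Valid) {g h : ℕ} (hg : 1 ≤ g) (hgh : g ≤ h) (hh : h ≤ H.depth) :
    H.len h ∣ H.len g := by
  induction h, hgh using Nat.le_induction with
  | base => exact dvd_rfl
  | succ h hgh ih =>
    refine dvd_trans ?_ (ih (by omega))
    have hle := hH.len_anti h (by omega) (by omega)
    obtain ⟨a, ha⟩ := hH.len_pow h (by omega) (by omega)
    obtain ⟨b, hb⟩ := hH.len_pow (h + 1) (by omega) (by omega)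
    rw [ha, hb] at hle ⊢
    -- For `η = 1` the exponents cannot be compared, but then all lengths are `1`.
    rcases (Nat.succ_le_of_lt (eta_pos (H := H))).eq_or_lt with h1 | h1
    · simp [← h1]
    · exact pow_dvd_pow _ ((Nat.pow_le_pow_iff_right h1).1 hle)

theorem len_dvd_side' (hH : H.Valid) {h : ℕ} (h₁ : 1 ≤ h) (h₂ : h ≤ H.depth) :
    H.len h ∣ H.side' := (hH.len_dvd_len le_rfl h₁ h₂).trans hH.len_dvd

theorem side'_pos (hH : H.Valid) : 0 < H.side' := by
  have h₁ := hH.eta_pow_lt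
  have h₂ : 0 < H.eta ^ (H.depth + 2) := pow_pos eta_pos _
  exact Nat.mul_pos (Nat.div_pos (by omega) h₂) h₂

theorem isColor_div (hH : H.Valid) {h : ℕ} (h₁ : 1 ≤ h) (h₂ : h ≤ H.depth) {x : ℕ}
    (hx : x < H.side') : H.IsColor h (x / H.len h) :=
  Nat.div_lt_div_of_lt_of_dvd (hH.len_dvd_side' h₁ h₂) hx

/-- As the lengths divide each other, a finer interval lies in a coarser one as soon as its left
endpoint does. This makes ancestors computable by one division. -/
theorem isAncestor_iff (hH : H.Valid) {g h : ℕ} (hg : 1 ≤ g) (hgh : g ≤ h) (hh : h ≤ H.depth)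
    {c c' : ℕ} : H.IsAncestor g c h c' ↔ c = c' * H.len h / H.len g := by
  obtain ⟨m, hm⟩ := hH.len_dvd_len hg hgh hh
  have hb := hH.len_pos (hg.trans hgh) hh
  have ha := hH.len_pos hg (hgh.trans hh)
  have hm0 : 0 < m := Nat.pos_of_ne_zero fun h0 => by rw [h0] at hm; omega
  rw [IsAncestor, interval, interval, Ico_subset_Ico_iff (by nlinarith)]
  rw [eq_comm, Nat.div_eq_iff ha, hm]
  constructor
  · rintro ⟨h₁, h₂⟩
    have : (c + 1) * (H.len h * m) = c * (H.len h * m) + H.len h * m := by ring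
    have : (c' + 1) * H.len h = c' * H.len h + H.len h := by ring
    omega
  · rintro ⟨h₁, h₂⟩
    refine ⟨h₁, ?_⟩
    have h₃ : (c + 1) * (H.len h * m) = c * (H.len h * m) + H.len h * m := by ring
    have h₄ : 0 < H.len h * m := by positivity
    have h₅ : c' * H.len h < (c + 1) * m * H.len h := by
      rw [show (c + 1) * m * H.len h = (c + 1) * (H.len h * m) by ring]; omega
    have h₆ := Nat.lt_of_mul_lt_mul_right h₅
    calc (c' + 1) * H.len h ≤ ((c + 1) * m) * H.len h := Nat.mul_le_mul_right _ h₆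
      _ = _ := by ring

/-- The ancestor of the color of a position is the coarser color of the same position. A single
position thus carries the colors of all levels, and both problems can use positions for colors. -/
theorem div_mul_len_div (hH : H.Valid) {g h : ℕ} (hg : 1 ≤ g) (hgh : g ≤ h) (hh : h ≤ H.depth)
    (x : ℕ) : x / H.len h * H.len h / H.len g = x / H.len g := by
  obtain ⟨m, hm⟩ := hH.len_dvd_len hg hgh hh
  have hb := hH.len_pos (hg.trans hgh) hh
  rw [hm, ← Nat.div_div_eq_div_mul, Nat.mul_div_cancel _ hb, Nat.div_div_eq_div_mul]

/-- The color of a square is obtained from that of a square inside it. -/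
theorem color_eq_of_subset (hH : H.Valid) {f : ℕ → ℕ × ℕ → ℕ} (hf : H.IsColoring f) {g h : ℕ}
    (hg : 1 ≤ g) (hgh : g ≤ h) (hh : h ≤ H.depth) {q q' : ℕ × ℕ} (hq : q ∈ H.squares h)
    (hq' : q' ∈ H.squares g) (hsub : H.verts h q ⊆ H.verts g q') :
    f g q' = f h q * H.len h / H.len g := by
  induction h, hgh using Nat.le_induction generalizing q with
  | base =>
    obtain rfl := hH.square_unique hg hh hq hq' (corner_mem g q) (hsub (corner_mem g q))
    rw [Nat.mul_div_cancel _ (hH.len_pos hg hh)]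
  | succ h hgh ih =>
    obtain ⟨p, hp, hqp⟩ := hH.nested h (by omega) (by omega) q hq
    obtain ⟨p', hp', hpp'⟩ := hH.exists_ancestor hg hgh (by omega) hp
    obtain rfl := hH.square_unique hg (by omega) hp' hq' (hpp' (hqp (corner_mem _ q)))
      (hsub (corner_mem _ q))
    rw [ih (by omega) hp hpp',
      (hH.isAncestor_iff (by omega) (Nat.le_succ h) hh).1 (hf.2 h (by omega) (by omega) q hq p hp hqp)]
    obtain ⟨m, hm⟩ := hH.len_dvd_len hg hgh (by omega)
    obtain ⟨m', hm'⟩ := hH.len_dvd_len (by omega) (Nat.le_succ h) hh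
    have hb := hH.len_pos (h := h + 1) (by omega) hh
    have hb' := hH.len_pos (h := h) (by omega) (by omega)
    rw [hm, ← Nat.div_div_eq_div_mul, ← Nat.div_div_eq_div_mul, Nat.mul_div_cancel _ hb']

end Valid

/-! ### The selection problem of a system of squares -/

/-- `P` is the selection problem for `n` elements at the vertices `v k` of the squares with the
positions `x k` in the row of sources. -/
structure Models (H : SquareColorSystem) (n : ℕ) (v : ℕ → ℕ × ℕ) (x : ℕ → ℕ) (P : LaminarProblem) :
    Prop where
  card : P.n = n
  depth : P.depth = H.depth
  lab_zero : ∀ k, P.lab 0 k = 0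
  col_zero : ∀ k, P.col 0 k = 0
  lab : ∀ h, 1 ≤ h → h ≤ H.depth → ∀ k < n, ∃ hlt : P.lab h k < (H.squares h).length,
    v k ∈ H.verts h ((H.squares h)[P.lab h k])
  col : ∀ h, 1 ≤ h → h ≤ H.depth → ∀ k < n, P.col h k = x k / H.len h

namespace Models

variable {n : ℕ} {v : ℕ → ℕ × ℕ} {x : ℕ → ℕ} {P : LaminarProblem}

theorem lab_eq_iff (hP : H.Models n v x P) (hH : H.Valid) {h : ℕ} (h₁ : 1 ≤ h) (h₂ : h ≤ H.depth)
    {k k' : ℕ} (hk : k < n) (hk' : k' < n) : P.lab h k = P.lab h k' ↔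
      ∃ q ∈ H.squares h, v k ∈ H.verts h q ∧ v k' ∈ H.verts h q := by
  obtain ⟨hl, hm⟩ := hP.lab h h₁ h₂ k hk
  obtain ⟨hl', hm'⟩ := hP.lab h h₁ h₂ k' hk'
  constructor
  · intro he
    exact ⟨_, List.getElem_mem hl, hm, by simpa only [he] using hm'⟩
  · rintro ⟨q, hq, hkq, hkq'⟩
    have e₁ := hH.square_unique h₁ h₂ (List.getElem_mem hl) hq hm hkq
    have e₂ := hH.square_unique h₁ h₂ (List.getElem_mem hl') hq hm' hkq'
    exact (hH.canonical h h₁ h₂).1.getElem_inj_iff.1 (e₁.trans e₂.symm)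

theorem hierarchical (hP : H.Models n v x P) (hH : H.Valid) : P.Hierarchical := by
  refine ⟨hP.lab_zero, hP.col_zero, fun h hh k hk k' hk' he => ?_, fun h hh k hk k' hk' he => ?_⟩
  · rw [hP.depth] at hh
    rw [hP.card] at hk hk'
    rcases Nat.eq_zero_or_pos h with rfl | h₁
    · rw [hP.lab_zero, hP.lab_zero]
    · obtain ⟨q, hq, hkq, hkq'⟩ := (hP.lab_eq_iff hH (by omega) hh hk hk').1 he
      obtain ⟨p, hp, hqp⟩ := hH.nested h h₁ hh q hq
      exact (hP.lab_eq_iff hH h₁ hh.le hk hk').2 ⟨p, hp, hqp hkq, hqp hkq'⟩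
  · rw [hP.depth] at hh
    rw [hP.card] at hk hk'
    rcases Nat.eq_zero_or_pos h with rfl | h₁
    · rw [hP.col_zero, hP.col_zero]
    · rw [hP.col h h₁ hh.le k hk, hP.col h h₁ hh.le k' hk']
      rw [hP.col (h + 1) (by omega) hh k hk, hP.col (h + 1) (by omega) hh k' hk'] at he
      rw [← hH.div_mul_len_div h₁ (Nat.le_succ h) hh, he, hH.div_mul_len_div h₁ (Nat.le_succ h) hh]

/-- Elements that agree with a coloring are consistent. -/
theorem compat_of_agree (hP : H.Models n v x P) (hH : H.Valid) {f : ℕ → ℕ × ℕ → ℕ}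
    (hf : H.IsColoring f) (hv : ∀ k < n, H.Belongs (v k)) {k k' : ℕ} (hk : k < n) (hk' : k' < n)
    (h₁ : ∀ q ∈ H.squares H.depth, v k ∈ H.verts H.depth q → f H.depth q = x k / H.len H.depth)
    (h₂ : ∀ q ∈ H.squares H.depth, v k' ∈ H.verts H.depth q →
      f H.depth q = x k' / H.len H.depth) : P.Compat k k' := by
  intro h hh hl
  rw [hP.depth] at hh
  obtain ⟨q, hq, hkq, hkq'⟩ := (hP.lab_eq_iff hH (by omega) hh hk hk').1 hl
  -- The color of `q` is the ancestor of the color of the last-level square of `v k`, which is the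
  -- color of the position `x k`.
  have key : ∀ k < n, v k ∈ H.verts (h + 1) q → (∀ q ∈ H.squares H.depth, v k ∈ H.verts H.depth q →
      f H.depth q = x k / H.len H.depth) → P.col (h + 1) k = f (h + 1) q := by
    intro k hk hkq hag
    obtain ⟨p, hp, hkp⟩ := hv k hk
    obtain ⟨p', hp', hpp'⟩ := hH.exists_ancestor (g := h + 1) (by omega) hh le_rfl hp
    obtain rfl := hH.square_unique (by omega) hh hq hp' hkq (hpp' hkp)
    rw [hH.color_eq_of_subset hf (by omega) hh le_rfl hp hp' hpp', hag p hp hkp,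
      hH.div_mul_len_div (by omega) hh le_rfl, hP.col (h + 1) (by omega) hh k hk]
  rw [key k hk hkq h₁, key k' hk' hkq' h₂]

end Models

/-! ### The coloring that belongs to a selection -/

section Coloring

open Classical in
/-- The position of the last selected element in the level-`h` square of `w`, and `y` if there is
none. -/
noncomputable def lastPosition (H : SquareColorSystem) (n : ℕ) (v : ℕ → ℕ × ℕ) (x : ℕ → ℕ)
    (S : Finset ℕ) (h : ℕ) (w : ℕ × ℕ) (y : ℕ) : ℕ :=
  rounds (fun k y => if k ∈ S ∧ ∃ q ∈ H.squares h, v k ∈ H.verts h q ∧ w ∈ H.verts h q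
    then x k else y) n y

/-- The position of a selected element in the smallest possible square of level at most `h` that
contains `w`, and `0` if there is none. -/
noncomputable def position (H : SquareColorSystem) (n : ℕ) (v : ℕ → ℕ × ℕ) (x : ℕ → ℕ)
    (S : Finset ℕ) (h : ℕ) (w : ℕ × ℕ) : ℕ :=
  rounds (fun g => H.lastPosition n v x S (g + 1) w) h 0

/-- The color of the position `SquareColorSystem.position`. -/
noncomputable def colorOf (H : SquareColorSystem) (n : ℕ) (v : ℕ → ℕ × ℕ) (x : ℕ → ℕ)
    (S : Finset ℕ) (h : ℕ) (w : ℕ × ℕ) : ℕ := H.position n v x S h w / H.len h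

variable {n : ℕ} {v : ℕ → ℕ × ℕ} {x : ℕ → ℕ} {S : Finset ℕ}

theorem rounds_ite_eq {p : ℕ → Prop} [DecidablePred p] (x : ℕ → ℕ) (m y : ℕ) :
    (∃ k < m, p k ∧ rounds (fun k y => if p k then x k else y) m y = x k) ∨
      (∀ k < m, ¬ p k) ∧ rounds (fun k y => if p k then x k else y) m y = y := by
  induction m with
  | zero => exact Or.inr ⟨by simp, rfl⟩
  | succ m ih =>
    rw [rounds]
    split_ifs with hm
    · exact Or.inl ⟨m, by omega, hm, rfl⟩
    · rcases ih with ⟨k, hk, hp, he⟩ | ⟨hp, he⟩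
      · exact Or.inl ⟨k, by omega, hp, he⟩
      · refine Or.inr ⟨fun k hk => ?_, he⟩
        rcases Nat.lt_succ_iff_lt_or_eq.1 hk with hk | rfl
        · exact hp k hk
        · exact hm

theorem lastPosition_eq (h : ℕ) (w : ℕ × ℕ) (y : ℕ) :
    (∃ k < n, (k ∈ S ∧ ∃ q ∈ H.squares h, v k ∈ H.verts h q ∧ w ∈ H.verts h q) ∧
      H.lastPosition n v x S h w y = x k) ∨
    (∀ k < n, ¬ (k ∈ S ∧ ∃ q ∈ H.squares h, v k ∈ H.verts h q ∧ w ∈ H.verts h q)) ∧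
      H.lastPosition n v x S h w y = y := by
  classical
  exact rounds_ite_eq x n y

theorem position_succ (h : ℕ) (w : ℕ × ℕ) : H.position n v x S (h + 1) w =
    H.lastPosition n v x S (h + 1) w (H.position n v x S h w) := rfl

theorem Valid.position_lt (hH : H.Valid) (hx : ∀ k < n, x k < H.side') (h : ℕ) (w : ℕ × ℕ) :
    H.position n v x S h w < H.side' := by
  induction h with
  | zero => exact hH.side'_pos
  | succ h ih =>
    rw [position_succ]
    rcases H.lastPosition_eq (n := n) (v := v) (x := x) (S := S) (h + 1) w
      (H.position n v x S h w) with ⟨k, hk, _, he⟩ | ⟨_, he⟩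
    · exact he.trans_lt (hx k hk)
    · exact he.trans_lt ih

/-- Up to level `h`, a square meeting `q` contains it, so no search condition distinguishes the
points of `q`. Hence the corner may stand for the square. -/
theorem Valid.position_congr (hH : H.Valid) {g h : ℕ} (hg : g ≤ h) (hh : h ≤ H.depth)
    {q w : ℕ × ℕ} (hq : q ∈ H.squares h) (hw : w ∈ H.verts h q) :
    H.position n v x S g w = H.position n v x S g q := by
  classical
  refine rounds_congr (fun j hj y => rounds_congr (fun k _ y => if_congr ?_ rfl rfl) y) 0
  refine and_congr_right fun _ => exists_congr fun p => and_congr_right fun hp =>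
    and_congr_right fun _ => ?_
  obtain ⟨p', hp', hqp'⟩ := hH.exists_ancestor (g := j + 1) (by omega) (by omega) hh hq
  constructor
  · intro hwp
    rw [hH.square_unique (by omega) (by omega) hp hp' hwp (hqp' hw)]
    exact hqp' (corner_mem h q)
  · intro hqp
    rw [hH.square_unique (by omega) (by omega) hp hp' hqp (hqp' (corner_mem h q))]
    exact hqp' hw

/-- The search settles on some selected element of the square; by compatibility all selected
elements of the square have its color. -/
theorem Models.colorOf_eq {P : LaminarProblem} (hP : H.Models n v x P) (hH : H.Valid)
    (hS : P.Feasible S) {h : ℕ} (h₁ : 1 ≤ h) (h₂ : h ≤ H.depth) {q : ℕ × ℕ}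
    (hq : q ∈ H.squares h) {k : ℕ} (hk : k ∈ S) (hkq : v k ∈ H.verts h q) :
    H.colorOf n v x S h q = x k / H.len h := by
  obtain ⟨h, rfl⟩ := Nat.exists_eq_add_of_le' h₁
  have hlt : ∀ {k}, k ∈ S → k < n := fun hk => hP.card ▸ mem_range.1 (hS.subset hk)
  rw [colorOf, position_succ]
  rcases H.lastPosition_eq (n := n) (v := v) (x := x) (S := S) (h + 1) q
    (H.position n v x S h q) with ⟨k', _, ⟨hk', p, hp, hkp, hqp⟩, he⟩ | ⟨hno, _⟩
  · obtain rfl := hH.square_unique h₁ h₂ hq hp (corner_mem _ q) hqp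
    rw [he]
    have := hS.compat k' hk' k hk h (by rw [hP.depth]; omega)
      ((hP.lab_eq_iff hH h₁ h₂ (hlt hk') (hlt hk)).2 ⟨q, hq, hkp, hkq⟩)
    rwa [hP.col _ h₁ h₂ _ (hlt hk'), hP.col _ h₁ h₂ _ (hlt hk)] at this
  · exact absurd ⟨hk, q, hq, hkq, corner_mem _ q⟩ (hno k (hlt hk))

/-- If the child-square has a selected element, the parent-square contains it too and both colors
come from its position. If not, the child inherits the position of its parent. -/
theorem Models.isColoring_colorOf {P : LaminarProblem} (hP : H.Models n v x P) (hH : H.Valid)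
    (hx : ∀ k < n, x k < H.side') (hS : P.Feasible S) : H.IsColoring (H.colorOf n v x S) := by
  refine ⟨fun h h₁ h₂ q _ => hH.isColor_div h₁ h₂ (hH.position_lt hx h q),
    fun h h₁ hh q hq q' hq' hsub => ?_⟩
  rw [hH.isAncestor_iff h₁ (Nat.le_succ h) hh]
  have hlt : ∀ {k}, k ∈ S → k < n := fun hk => hP.card ▸ mem_range.1 (hS.subset hk)
  rcases H.lastPosition_eq (n := n) (v := v) (x := x) (S := S) (h + 1) q
    (H.position n v x S h q) with ⟨k, _, ⟨hk, p, hp, hkp, hqp⟩, _⟩ | ⟨_, he⟩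
  · obtain rfl := hH.square_unique (by omega) hh hq hp (corner_mem _ q) hqp
    rw [hP.colorOf_eq hH hS h₁ hh.le hq' hk (hsub hkp),
      hP.colorOf_eq hH hS (by omega) hh hq hk hkp, hH.div_mul_len_div h₁ (Nat.le_succ h) hh]
  · rw [colorOf, colorOf, position_succ, he, hH.div_mul_len_div h₁ (Nat.le_succ h) hh,
      hH.position_congr le_rfl hh.le hq' (hsub (corner_mem _ q))]

end Coloring

end SquareColorSystem

/-! ### Reading the input -/

namespace List

theorem drop_flatMap_range' {α : Type*} (f : ℕ → List α) (R : List α) (n : ℕ) : ∀ (i s : ℕ), i ≤ n →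
    ((range' s n).flatMap f ++ R).drop (∑ g ∈ Finset.range i, (f (s + g)).length) =
      (range' (s + i) (n - i)).flatMap f ++ R := by
  intro i
  induction i with
  | zero => intro s _; simp
  | succ i ih =>
    intro s hi
    rw [Finset.sum_range_succ, ← drop_drop, ih s (by omega),
      show n - i = (n - (i + 1)) + 1 by omega, range'_succ, flatMap_cons, append_assoc]
    rw [drop_append_of_le_length le_rfl, drop_length, nil_append, add_assoc]

theorem getElem?_flatMap_range' {α : Type*} (f : ℕ → List α) (R : List α) {n i s j : ℕ} (hi : i < n)
    (hj : j < (f (s + i)).length) :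
    ((range' s n).flatMap f ++ R)[(∑ g ∈ Finset.range i, (f (s + g)).length) + j]? =
      (f (s + i))[j]? := by
  rw [← getElem?_drop, drop_flatMap_range' f R n i s hi.le,
    show n - i = (n - (i + 1)) + 1 by omega, range'_succ, flatMap_cons, append_assoc,
    getElem?_append_left hj]

theorem getElem?_flatMap_range'_right {α : Type*} (f : ℕ → List α) (R : List α) (n s j : ℕ) :
    ((range' s n).flatMap f ++ R)[(∑ g ∈ Finset.range n, (f (s + g)).length) + j]? = R[j]? := by
  rw [← getElem?_drop, drop_flatMap_range' f R n n s le_rfl]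
  simp

theorem length_flatMap_range' {α : Type*} (f : ℕ → List α) (n s : ℕ) :
    ((range' s n).flatMap f).length = ∑ g ∈ Finset.range n, (f (s + g)).length := by
  induction n with
  | zero => simp
  | succ n ih => rw [range'_1_concat, flatMap_append, length_append, ih, Finset.sum_range_succ]; simp

theorem getElem?_flatMap_const {α β : Type*} (g : α → List β) (c : ℕ) : ∀ (l : List α),
    (∀ a ∈ l, (g a).length = c) → ∀ {i j : ℕ} (hi : i < l.length), j < c →
    (l.flatMap g)[i * c + j]? = (g l[i])[j]? := by
  intro l
  induction l with
  | nil => intro _ i j hi; simp at hi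
  | cons a l ih =>
    intro hl i j hi hj
    have ha : (g a).length = c := hl a (by simp)
    rw [flatMap_cons]
    rcases i with _ | i
    · rw [getElem?_append_left (by omega)]; simp
    · rw [getElem?_append_right (by rw [ha]; nlinarith), ha,
        show (i + 1) * c + j - c = i * c + j by rw [Nat.succ_mul]; omega,
        ih (fun b hb => hl b (by simp [hb])) (by simpa using hi) hj]
      simp

theorem length_flatMap_const {α β : Type*} (g : α → List β) (c : ℕ) (l : List α)
    (hl : ∀ a ∈ l, (g a).length = c) : (l.flatMap g).length = l.length * c := by
  induction l with
  | nil => simp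
  | cons a l ih =>
    rw [flatMap_cons, length_append, ih fun b hb => hl b (by simp [hb]), hl a (by simp),
      length_cons]
    ring

end List

namespace SquareColorSystem

open Finset RandRAM

variable (H : SquareColorSystem)

/-- The position in the input of the part on the squares of level `h + 1`. -/
noncomputable def blockStart (h : ℕ) : ℕ :=
  3 + (H.depth + H.depth) + ∑ g ∈ range h, (1 + 2 * (H.squares (1 + g)).length)

/-- The part of the input on the squares of level `h`. -/
def block (h : ℕ) : List ℕ := (H.squares h).length :: (H.squares h).flatMap fun q => [q.1, q.2]

theorem length_block (h : ℕ) : (H.block h).length = 1 + 2 * (H.squares h).length := by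
  rw [block, List.length_cons, List.length_flatMap_const _ 2 _ (by simp)]; ring

theorem encode_append (R : List ℕ) : H.encode ++ R = [H.side, H.side', H.depth] ++
    (H.levels.map H.d ++ (H.levels.map H.len ++ (H.levels.flatMap H.block ++ R))) := by
  simp only [encode, List.append_assoc]; rfl

variable (R : List ℕ)

theorem length_levels : H.levels.length = H.depth := List.length_range'

theorem getElem?_levels {h : ℕ} (hh : h < H.depth) : H.levels[h]? = some (1 + h) := by
  simp [levels, hh]

theorem encode_d {h : ℕ} (hh : h < H.depth) : (H.encode ++ R)[3 + h]? = some (H.d (1 + h)) := by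
  rw [encode_append, List.getElem?_append_right (by simp),
    List.getElem?_append_left (by simp [length_levels, hh]), List.getElem?_map]
  simp [H.getElem?_levels hh]

theorem encode_len {h : ℕ} (hh : h < H.depth) :
    (H.encode ++ R)[3 + H.depth + h]? = some (H.len (1 + h)) := by
  rw [encode_append, List.getElem?_append_right (by simp; omega),
    List.getElem?_append_right (by simp [length_levels]; omega),
    List.getElem?_append_left (by simp [length_levels]; omega), List.getElem?_map]
  have : 3 + H.depth + h - [H.side, H.side', H.depth].length - (H.levels.map H.d).length = h := by
    simp [length_levels]; omega
  rw [this, H.getElem?_levels hh, Option.map_some]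

theorem encode_right (j : ℕ) : (H.encode ++ R)[3 + (H.depth + H.depth) + j]? =
    (H.levels.flatMap H.block ++ R)[j]? := by
  rw [encode_append, List.getElem?_append_right (by simp; omega),
    List.getElem?_append_right (by simp [length_levels]; omega),
    List.getElem?_append_right (by simp [length_levels]; omega)]
  congr 1
  simp [length_levels]; omega

theorem encode_block {h j : ℕ} (hh : h < H.depth) (hj : j < 1 + 2 * (H.squares (1 + h)).length) :
    (H.encode ++ R)[H.blockStart h + j]? = (H.block (1 + h))[j]? := by
  rw [blockStart, add_assoc, encode_right]
  simp only [← length_block] at hj ⊢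
  exact List.getElem?_flatMap_range' H.block R hh hj

theorem encode_rest (j : ℕ) : (H.encode ++ R)[H.blockStart H.depth + j]? = R[j]? := by
  rw [blockStart, add_assoc, encode_right]
  simp only [← length_block]
  exact List.getElem?_flatMap_range'_right H.block R _ _ _

theorem length_encode : H.encode.length = H.blockStart H.depth := by
  have := H.encode_append []
  rw [List.append_nil] at this
  rw [this, blockStart]
  simp only [← length_block, List.length_append, List.length_map, length_levels, List.append_nil,
    ← List.length_flatMap_range' H.block H.depth 1]
  simp [levels]; omega

theorem encode_side : (H.encode ++ R)[0]? = some H.side := by rw [encode_append]; simp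

theorem encode_depth : (H.encode ++ R)[2]? = some H.depth := by rw [encode_append]; simp

theorem block_zero (h : ℕ) : (H.block h)[0]? = some (H.squares h).length := rfl

theorem block_row {h i : ℕ} (hi : i < (H.squares h).length) :
    (H.block h)[1 + (i + i)]? = some ((H.squares h)[i]).1 := by
  rw [block, add_comm, List.getElem?_cons_succ]
  have := List.getElem?_flatMap_const (fun q : ℕ × ℕ => [q.1, q.2]) 2 (H.squares h) (by simp)
    (j := 0) hi (by omega)
  rw [show i + i = i * 2 + 0 by omega, this]; rfl

theorem block_column {h i : ℕ} (hi : i < (H.squares h).length) :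
    (H.block h)[2 + (i + i)]? = some ((H.squares h)[i]).2 := by
  rw [block, show 2 + (i + i) = (i * 2 + 1) + 1 by omega, List.getElem?_cons_succ]
  have := List.getElem?_flatMap_const (fun q : ℕ × ℕ => [q.1, q.2]) 2 (H.squares h) (by simp)
    (j := 1) hi (by omega)
  rw [this]; rfl

end SquareColorSystem

namespace RandRAM

open Finset

/-- What the arrays contain for the squares and colors of `H` and for `n` elements at the vertices
`v k` with the positions `x k`. -/
structure Loaded (H : SquareColorSystem) (n : ℕ) (v : ℕ → ℕ × ℕ) (x cap : ℕ → ℕ)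
    (A : ℕ → ℕ → ℕ) : Prop where
  depth : A 0 2 = H.depth
  d : ∀ h, 1 ≤ h → h ≤ H.depth → A 0 (h + 2) = H.d h
  len : ∀ h, 1 ≤ h → h ≤ H.depth → A 0 (h + 2 + H.depth) = H.len h
  count : ∀ h, 1 ≤ h → h ≤ H.depth → A 0 (A 2 h) = (H.squares h).length
  row : ∀ h, 1 ≤ h → h ≤ H.depth → ∀ i (hi : i < (H.squares h).length),
    A 0 (A 2 h + 1 + (i + i)) = ((H.squares h)[i]).1
  column : ∀ h, 1 ≤ h → h ≤ H.depth → ∀ i (hi : i < (H.squares h).length),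
    A 0 (A 2 h + 2 + (i + i)) = ((H.squares h)[i]).2
  card : A 0 (A 2 (H.depth + 1)) = n
  vertex : ∀ k < n, (A 3 k, A 4 k) = v k
  position : ∀ k < n, A 5 k = x k
  capacity : ∀ h, 1 ≤ h → h ≤ H.depth → A 6 h = cap h

/-- Put the positions of the blocks of squares into array `2`. -/
def blockS : Stmt := .seq (.store 2 (.const 1) (.add (.const 3) (.add depthE depthE)))
  (.loop depthE (.store 2 (.add (.var 0) (.const 2))
    (.add (.get 2 (.add (.var 0) (.const 1))) (.add (.const 1)
      (.add (.get 0 (.get 2 (.add (.var 0) (.const 1))))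
        (.get 0 (.get 2 (.add (.var 0) (.const 1)))))))))

/-- Entry `j` of the description of element `k`, the variable `0`. -/
def entryE (j : ℕ) : Ex := .get 0 (.add (.get 2 (.add depthE (.const 1)))
  (.add (.const (1 + j)) (.add (.var 0) (.add (.var 0) (.var 0)))))

/-- Put the elements and the capacities into the arrays `3, …, 6`. The vertex of an element is given
by the entries `a` and `a + 1`. -/
def elementS (a : ℕ) (posE capE : Ex) : Stmt := .seq (.loop cardE (.store 3 (.var 0) (entryE a)))
  (.seq (.loop cardE (.store 4 (.var 0) (entryE (a + 1))))
  (.seq (.loop cardE (.store 5 (.var 0) posE))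
    (.loop (.add depthE (.const 1)) (.store 6 (.var 0) capE))))

section

variable {H : SquareColorSystem} {β : ℕ} {R : List ℕ} {ω : ℕ → Bool}

theorem initState_arr_zero (L : List ℕ) (i : ℕ) : (initState L ω).arr 0 i = (L[i]?).getD 0 := by
  simp [initState, List.getD_eq_getElem?_getD]

theorem initState_arr_of_ne (L : List ℕ) {a : ℕ} (ha : a ≠ 0) : (initState L ω).arr a = 0 := by
  ext i; simp [initState, ha]

/-- The block starts are prefix sums: each block begins with its number of squares, from which the
start of the next one follows. -/
theorem run_blockS (hβ : H.depth ≤ β) : ∃ s : ℕ → ℕ,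
    blockS.run β [] (initState (H.encode ++ R) ω).arr =
      Function.update (initState (H.encode ++ R) ω).arr 2 s ∧
    ∀ h ≤ H.depth, s (h + 1) = H.blockStart h := by
  set A := (initState (H.encode ++ R) ω).arr with hA
  have h0 : ∀ i, A 0 i = ((H.encode ++ R)[i]?).getD 0 := initState_arr_zero _
  have hdep : ∀ (s : ℕ → ℕ) v, depthE.eval β (Function.update A 2 s) v = H.depth := by
    intro s v
    simp [depthE, Ex.eval, h0, H.encode_depth]
  have hdep' : ∀ v, depthE.eval β A v = H.depth := by
    intro v
    simp [depthE, Ex.eval, h0, H.encode_depth]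
  rw [blockS, Stmt.run_seq, Stmt.run_store, Stmt.run_loop, hdep, min_eq_left hβ]
  have key : ∀ m ≤ H.depth, ∃ s : ℕ → ℕ, rounds (fun i A => (Stmt.store 2 (.add (.var 0) (.const 2))
    (.add (.get 2 (.add (.var 0) (.const 1))) (.add (.const 1)
      (.add (.get 0 (.get 2 (.add (.var 0) (.const 1))))
        (.get 0 (.get 2 (.add (.var 0) (.const 1)))))))).run β [i] A) m
      (Function.update A 2 (Function.update (A 2) ((Ex.const 1).eval β A [])
        ((Ex.add (.const 3) (.add depthE depthE)).eval β A []))) = Function.update A 2 s ∧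
      ∀ h ≤ m, s (h + 1) = H.blockStart h := by
    intro m
    induction m with
    | zero =>
      intro _
      refine ⟨_, rfl, fun h hh => ?_⟩
      obtain rfl : h = 0 := by omega
      rw [Ex.eval_const, zero_add, Function.update_self, Ex.eval_add, Ex.eval_add, hdep']
      simp [SquareColorSystem.blockStart]
    | succ m ih =>
      intro hm
      obtain ⟨s, hs, hs'⟩ := ih (by omega)
      rw [rounds, hs, Stmt.run_store, Function.update_idem]
      refine ⟨_, rfl, fun h hh => ?_⟩
      rw [Function.update_self]
      simp only [Ex.eval_add, Ex.eval_var_zero, Ex.eval_const, Ex.eval_get, Function.update_self]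
      rcases Nat.lt_or_eq_of_le hh with hh | rfl
      · rw [Function.update_of_ne (by omega), hs' h (by omega)]
      · rw [Function.update_self, hs' m le_rfl, Function.update_of_ne (by omega), h0]
        have := H.encode_block R (h := m) (j := 0) (by omega) (by omega)
        rw [add_zero, H.block_zero] at this
        rw [this, SquareColorSystem.blockStart, SquareColorSystem.blockStart, sum_range_succ,
          Option.getD_some]
        omega
  exact key H.depth le_rfl

/-- The expressions do not read the arrays from `3` on, which are the only ones written here, so
every entry may be evaluated in the state left by `blockS`. -/
theorem run_elementS {α : Type*} (U : List α) (t : α → List ℕ)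
    (ht : ∀ u, (t u).length = 3) (hR : R = U.length :: U.flatMap t) (hn : U.length ≤ β)
    (hβ : H.depth + 1 ≤ β) {a : ℕ} (ha : a + 1 < 3) {posE capE : Ex}
    (hpos : ∀ b, 3 ≤ b → posE.reads b = false) (hcap : ∀ b, 3 ≤ b → capE.reads b = false)
    {v : ℕ → ℕ × ℕ} {x cap : ℕ → ℕ}
    (hv : ∀ k (hk : k < U.length), v k = ((t U[k]).getD a 0, (t U[k]).getD (a + 1) 0))
    (hx : ∀ A, A 0 = (initState (H.encode ++ R) ω).arr 0 →
      (∀ h ≤ H.depth, A 2 (h + 1) = H.blockStart h) → ∀ k < U.length, posE.eval β A [k] = x k)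
    (hc : ∀ A, A 0 = (initState (H.encode ++ R) ω).arr 0 →
      (∀ h ≤ H.depth, A 2 (h + 1) = H.blockStart h) →
      ∀ h, 1 ≤ h → h ≤ H.depth → capE.eval β A [h] = cap h) :
    Loaded H U.length v x cap ((Stmt.seq blockS (elementS a posE capE)).run β []
      (initState (H.encode ++ R) ω).arr) ∧
    ∀ b, (b = 1 ∨ 7 ≤ b) → (Stmt.seq blockS (elementS a posE capE)).run β []
      (initState (H.encode ++ R) ω).arr b = 0 := by
  obtain ⟨s, hs, hs'⟩ := run_blockS (H := H) (R := R) (ω := ω) (β := β) (by omega)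
  rw [Stmt.run_seq, hs]
  set A := (initState (H.encode ++ R) ω).arr with hA
  have h0 : ∀ i, A 0 i = ((H.encode ++ R)[i]?).getD 0 := initState_arr_zero _
  set A₂ := Function.update A 2 s with hA₂
  have hA₂0 : A₂ 0 = A 0 := Function.update_of_ne (by omega) _ _
  have hA₂2 : A₂ 2 = s := Function.update_self _ _ _
  have hdepth : ∀ v, depthE.eval β A₂ v = H.depth := by
    intro v
    rw [depthE, Ex.eval_get, hA₂0, h0, Ex.eval_const, H.encode_depth, Option.getD_some]
  have hentry : ∀ j, A 0 (H.blockStart H.depth + j) = (R[j]?).getD 0 := fun j => by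
    rw [h0, H.encode_rest]
  have hcard : ∀ v, cardE.eval β A₂ v = U.length := by
    intro v
    rw [cardE, Ex.eval_get, Ex.eval_get, Ex.eval_add, hdepth, Ex.eval_const, hA₂0, hA₂2,
      hs' _ le_rfl]
    have := hentry 0
    rw [add_zero] at this
    rw [this, hR]; rfl
  have hentryE : ∀ j < 3, ∀ k (hk : k < U.length), (entryE j).eval β A₂ [k] =
      (t U[k]).getD j 0 := by
    intro j hj k hk
    rw [entryE, Ex.eval_get, Ex.eval_add, Ex.eval_get, Ex.eval_add, hdepth, hA₂0, hA₂2,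
      Ex.eval_const, hs' _ le_rfl, hentry, hR]
    simp only [Ex.eval_add, Ex.eval_const, Ex.eval_var_zero]
    rw [show 1 + j + (k + (k + k)) = (k * 3 + j) + 1 by ring, List.getElem?_cons_succ,
      List.getElem?_flatMap_const t 3 U (fun u _ => ht u) hk hj, List.getD_eq_getElem?_getD]
  have hposE := hx A₂ hA₂0 (by rw [hA₂2]; exact hs')
  have hcapE := hc A₂ hA₂0 (by rw [hA₂2]; exact hs')
  have hr : ∀ j b, 3 ≤ b → (entryE j).reads b = false := by
    intro j b hb
    simp only [entryE, depthE, Ex.reads, Bool.or_false, Bool.or_eq_false_iff, beq_eq_false_iff_ne]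
    omega
  have hrc : ∀ b, 3 ≤ b → cardE.reads b = false := by
    intro b hb
    simp only [cardE, depthE, Ex.reads, Bool.or_false, Bool.or_eq_false_iff, beq_eq_false_iff_ne]
    omega
  have hrd : ∀ b, 3 ≤ b → (Ex.add depthE (.const 1)).reads b = false := by
    intro b hb
    simp only [depthE, Ex.reads, Bool.or_false, beq_eq_false_iff_ne]
    omega
  rw [elementS, Stmt.run_seq, Stmt.run_loop_store (hr _ 3 le_rfl), Stmt.run_seq,
    Stmt.run_loop_store (hr _ 4 (by omega)), Stmt.run_seq,
    Stmt.run_loop_store (hpos 5 (by omega)), Stmt.run_loop_store (hcap 6 (by omega))]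
  simp only [Ex.eval_update (hrc 3 le_rfl), Ex.eval_update (hrc 4 (by omega)),
    Ex.eval_update (hr _ 3 le_rfl),
    Ex.eval_update (hpos 3 le_rfl), Ex.eval_update (hpos 4 (by omega)),
    Ex.eval_update (hcap 3 le_rfl), Ex.eval_update (hcap 4 (by omega)),
    Ex.eval_update (hcap 5 (by omega)), Ex.eval_update (hrd 3 le_rfl),
    Ex.eval_update (hrd 4 (by omega)), Ex.eval_update (hrd 5 (by omega)), hcard, Ex.eval_add,
    hdepth, Ex.eval_const, min_eq_left hn, min_eq_left hβ]
  set B := Function.update _ 6 _ with hB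
  have hB0 : B 0 = A 0 := by
    rw [hB, Function.update_of_ne (by omega), Function.update_of_ne (by omega),
      Function.update_of_ne (by omega), Function.update_of_ne (by omega), hA₂0]
  have hB2 : B 2 = s := by
    rw [hB, Function.update_of_ne (by omega), Function.update_of_ne (by omega),
      Function.update_of_ne (by omega), Function.update_of_ne (by omega), hA₂2]
  refine ⟨⟨?_, fun h h₁ h₂ => ?_, fun h h₁ h₂ => ?_, fun h h₁ h₂ => ?_, fun h h₁ h₂ i hi => ?_,
    fun h h₁ h₂ i hi => ?_, ?_, fun k hk => ?_, fun k hk => ?_, fun h h₁ h₂ => ?_⟩, fun b hb => ?_⟩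
  · rw [hB0, h0, H.encode_depth, Option.getD_some]
  · obtain ⟨h, rfl⟩ := Nat.exists_eq_add_of_le h₁
    rw [hB0, h0, show 1 + h + 2 = 3 + h by omega, H.encode_d _ (by omega), Option.getD_some]
  · obtain ⟨h, rfl⟩ := Nat.exists_eq_add_of_le h₁
    rw [hB0, h0, show 1 + h + 2 + H.depth = 3 + H.depth + h by omega, H.encode_len _ (by omega),
      Option.getD_some]
  · obtain ⟨h, rfl⟩ := Nat.exists_eq_add_of_le' h₁
    rw [hB0, hB2, hs' h (by omega), h0]
    have := H.encode_block R (h := h) (j := 0) (by omega) (by omega)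
    rw [add_zero, H.block_zero, add_comm 1 h] at this
    rw [this, Option.getD_some]
  · obtain ⟨h, rfl⟩ := Nat.exists_eq_add_of_le' h₁
    rw [hB0, hB2, hs' h (by omega), h0, add_assoc]
    have := H.encode_block R (h := h) (j := 1 + (i + i)) (by omega) (by rw [add_comm 1 h]; omega)
    rw [this]
    simp only [add_comm 1 h]
    rw [H.block_row hi, Option.getD_some]
  · obtain ⟨h, rfl⟩ := Nat.exists_eq_add_of_le' h₁
    rw [hB0, hB2, hs' h (by omega), h0, add_assoc]
    have := H.encode_block R (h := h) (j := 2 + (i + i)) (by omega) (by rw [add_comm 1 h]; omega)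
    rw [this]
    simp only [add_comm 1 h]
    rw [H.block_column hi, Option.getD_some]
  · rw [hB0, hB2, hs' _ le_rfl]
    have := hentry 0
    rw [add_zero] at this
    rw [this, hR]; rfl
  · rw [hB, Function.update_of_ne (by omega), Function.update_of_ne (by omega),
      Function.update_of_ne (by omega), Function.update_self,
      Function.update_of_ne (by omega), Function.update_of_ne (by omega), Function.update_self,
      if_pos hk, if_pos hk, hentryE a (by omega) k hk, hentryE (a + 1) ha k hk, hv k hk]
  · rw [hB, Function.update_of_ne (by omega), Function.update_self, if_pos hk, hposE k hk]
  · rw [hB, Function.update_self, if_pos (by omega), hcapE h h₁ h₂]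
  · rw [hB, Function.update_of_ne (by omega), Function.update_of_ne (by omega),
      Function.update_of_ne (by omega), Function.update_of_ne (by omega), hA₂,
      Function.update_of_ne (by omega), hA, initState_arr_of_ne _ (by omega)]

end

/-! ### The values of the expressions for the classes and the colors -/

section

variable {β : ℕ} {A : ℕ → ℕ → ℕ}

theorem eval_mulE {x y : ℕ} (hx : x ≤ β) : mulE.eval β A [x, y, 0, 0] = x * y := by
  simp [mulE, min_eq_left hx]

/-- The quotient is the number of `i < x` with `(i + 1) * y ≤ x`; for these `i` the factor `i + 1 ≤
x` stays within the bound of the unary multiplication. -/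
theorem eval_divE {x y : ℕ} (hx : x ≤ β) (hy : 0 < y) : divE.eval β A [x, y, 0, 0] = x / y := by
  rw [divE, Ex.eval_count, Ex.eval_var_zero, min_eq_left hx]
  have : ({i ∈ range x | (Ex.le (.call₂ mulE (.add (.var 0) (.const 1)) (.var 2)) (.var 1)).Holds β
      A (i :: [x, y, 0, 0])} : Finset ℕ) = range (x / y) := by
    ext i
    rw [mem_filter, mem_range, mem_range, Ex.holds_le, Ex.eval_call₂,
      show i < x / y ↔ (i + 1) * y ≤ x from Nat.le_div_iff_mul_le hy]
    simp only [Ex.eval_add, Ex.eval_var_zero, Ex.eval_var_one, Ex.eval_var_two, Ex.eval_const]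
    constructor
    · rintro ⟨hi, h⟩
      rwa [eval_mulE (by omega)] at h
    · intro h
      have : i < x := by nlinarith
      exact ⟨this, by rwa [eval_mulE (by omega)]⟩
  rw [this, card_range]

namespace Loaded

variable {H : SquareColorSystem} {n : ℕ} {v : ℕ → ℕ × ℕ} {x cap : ℕ → ℕ}

theorem problem_n (hA : Loaded H n v x cap A) : (problem β A).n = n :=
  (congrArg (fun d => A 0 (A 2 (d + 1))) hA.depth).trans hA.card

theorem problem_depth (hA : Loaded H n v x cap A) : (problem β A).depth = H.depth :=
  hA.depth

theorem eval_depthE (hA : Loaded H n v x cap A) (w : List ℕ) : depthE.eval β A w = H.depth :=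
  hA.depth

theorem holds_inSquareE (hA : Loaded H n v x cap A) {h i : ℕ} (h₁ : 1 ≤ h) (h₂ : h ≤ H.depth)
    (hi : i < (H.squares h).length) (w : ℕ × ℕ) :
    inSquareE.Holds β A [h, i, w.1, w.2] ↔ w ∈ H.verts h ((H.squares h)[i]) := by
  rw [SquareColorSystem.verts, mem_squareVertices]
  simp only [inSquareE, Ex.holds_and, Ex.holds_le, Ex.holds_lt, Ex.eval_get, Ex.eval_add,
    Ex.eval_const, Ex.eval_var_zero, Ex.eval_var_one, Ex.eval_var_two, Ex.eval_var_three,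
    hA.row h h₁ h₂ i hi, hA.column h h₁ h₂ i hi, hA.d h h₁ h₂]

theorem eval_lenE (hA : Loaded H n v x cap A) {h : ℕ} (h₁ : 1 ≤ h) (h₂ : h ≤ H.depth) {e : Ex}
    {w : List ℕ} (he : e.eval β A w = h) :
    (Ex.get 0 (.add (.add e (.const 2)) depthE)).eval β A w = H.len h := by
  rw [Ex.eval_get, Ex.eval_add, Ex.eval_add, he, hA.eval_depthE, Ex.eval_const, hA.len h h₁ h₂]

theorem models (hA : Loaded H n v x cap A) (hH : H.Valid) (hv : ∀ k < n, H.Belongs (v k))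
    (hx : ∀ k < n, x k ≤ β) (hcount : ∀ h, 1 ≤ h → h ≤ H.depth → (H.squares h).length ≤ β) :
    H.Models n v x (problem β A) := by
  refine ⟨hA.problem_n, hA.problem_depth, fun k => rfl, fun k => rfl, fun h h₁ h₂ k hk => ?_,
    fun h h₁ h₂ k hk => ?_⟩
  · obtain ⟨q, hq, hkq⟩ := hH.exists_square (hv k hk) h₁ h₂
    obtain ⟨i, hi, rfl⟩ := List.getElem_of_mem hq
    have : (problem β A).lab h k = i := by
      rw [problem, labE]
      simp only [Ex.eval_ite, Ex.holds_var_zero, Ex.eval_var_zero, Ex.eval_sum, Ex.eval_get,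
        hA.count h h₁ h₂, min_eq_left (hcount h h₁ h₂), if_pos (show h ≠ 0 by omega),
        Ex.holds_call, Ex.eval_var_one, Ex.eval_var_two, Ex.eval_const]
      have hw := hA.vertex k hk
      have e₁ : A 3 k = (v k).1 := congrArg Prod.fst hw
      have e₂ : A 4 k = (v k).2 := congrArg Prod.snd hw
      -- The squares of one level are disjoint, so the sum in `labE` has at most one nonzero term,
      -- the index of the square of the element.
      rw [e₁, e₂, sum_eq_single i]
      · rw [if_pos ((hA.holds_inSquareE h₁ h₂ hi _).2 hkq)]
      · intro j hj hji
        rw [mem_range] at hj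
        refine if_neg fun hc => hji ?_
        have := hH.square_unique h₁ h₂ (List.getElem_mem hj) hq
          ((hA.holds_inSquareE h₁ h₂ hj _).1 hc) hkq
        exact (hH.canonical h h₁ h₂).1.getElem_inj_iff.1 this
      · intro hni
        exact absurd (mem_range.2 hi) hni
    simp only [this]
    exact ⟨hi, hkq⟩
  · rw [problem, colE]
    simp only [Ex.eval_ite, Ex.holds_var_zero, if_pos (show h ≠ 0 by omega), Ex.eval_call₂]
    rw [hA.eval_lenE h₁ h₂ (Ex.eval_var_zero _), Ex.eval_get, Ex.eval_var_one, hA.position k hk,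
      eval_divE (hx k hk) (hH.len_pos h₁ h₂)]

end Loaded

end

end RandRAM

/-! ### Writing the output -/

namespace RandRAM

open Finset

/-- The number of squares at the levels `1, …, h`; argument `h`. -/
def offsetE : Ex := .sum (.var 0) (.get 0 (.get 2 (.add (.var 0) (.const 1))))

/-- The row of the corner of square `i` of level `g + 1`; arguments `g, i`. -/
def rowE : Ex := .get 0 (.add (.add (.get 2 (.add (.var 0) (.const 1))) (.const 1))
  (.add (.var 1) (.var 1)))

/-- The column of the corner of square `i` of level `g + 1`; arguments `g, i`. -/
def columnE : Ex := .get 0 (.add (.add (.get 2 (.add (.var 0) (.const 1))) (.const 2))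
  (.add (.var 1) (.var 1)))

/-- Find the position for square `i` of level `g + 1`; the variables are `i, g`. -/
def positionS : Stmt := .seq (.store 11 (.const 0) (.const 0))
  (.loop (.add (.var 1) (.const 1)) (.loop cardE
    (.ite (.and (.get 7 (.var 0)) (.call inSquareE (.add (.var 1) (.const 1))
        (.call₂ labE (.add (.var 1) (.const 1)) (.var 0))
        (.call₂ rowE (.var 3) (.var 2)) (.call₂ columnE (.var 3) (.var 2))))
      (.store 11 (.const 0) (.get 5 (.var 0)))
      (.store 11 (.const 0) (.get 11 (.const 0))))))

def outputS : Stmt := .seq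
  (.loop depthE (.loop (.get 0 (.get 2 (.add (.var 0) (.const 1))))
    (.seq positionS (.store 1 (.add (.call₂ offsetE (.var 1) (.const 0)) (.var 0))
      (.call₂ divE (.get 11 (.const 0))
        (.get 0 (.add (.add (.add (.var 1) (.const 1)) (.const 2)) depthE)))))))
  (.loop cardE (.store 1 (.add (.call₂ offsetE depthE (.const 0)) (.var 0))
    (.ite (.get 7 (.var 0)) (.const 1) (.const 0))))

def outputLengthE : Ex := .add (.call₂ offsetE depthE (.const 0)) cardE

theorem rounds_induction {α : Type*} {f : ℕ → α → α} {Inv : ℕ → α → Prop} {a : α} {N : ℕ}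
    (h₀ : Inv 0 a) (hs : ∀ i < N, ∀ a, Inv i a → Inv (i + 1) (f i a)) : Inv N (rounds f N a) := by
  induction N with
  | zero => exact h₀
  | succ N ih => exact hs N (by omega) _ (ih fun i hi => hs i (by omega))

section

variable {H : SquareColorSystem} {n β : ℕ} {v : ℕ → ℕ × ℕ} {x cap : ℕ → ℕ} {A : ℕ → ℕ → ℕ}

/-- The bound `β` is large enough for all loops. -/
structure Bounded (H : SquareColorSystem) (n : ℕ) (v : ℕ → ℕ × ℕ) (x : ℕ → ℕ) (β : ℕ) : Prop where
  valid : H.Valid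
  belongs : ∀ k < n, H.Belongs (v k)
  position : ∀ k < n, x k < H.side'
  side_le : H.side' ≤ β
  count_le : ∀ h, 1 ≤ h → h ≤ H.depth → (H.squares h).length ≤ β
  depth_le : H.depth + 1 ≤ β
  card_le : n + 2 ≤ β

theorem Loaded.models' (hA : Loaded H n v x cap A) (hB : Bounded H n v x β) :
    H.Models n v x (problem β A) :=
  hA.models hB.valid hB.belongs (fun k hk => (hB.position k hk).le.trans hB.side_le) hB.count_le

/-- The scratch register of the output is overwritten by `y`. -/
def withScratch (A : ℕ → ℕ → ℕ) (y : ℕ) : ℕ → ℕ → ℕ :=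
  Function.update A 11 (Function.update (A 11) 0 y)

theorem withScratch_withScratch (y z : ℕ) : withScratch (withScratch A y) z = withScratch A z := by
  simp [withScratch]

theorem eval_withScratch {e : Ex} (he : e.reads 11 = false) (y : ℕ) (w : List ℕ) :
    e.eval β (withScratch A y) w = e.eval β A w := Ex.eval_update he _ _

/-- A loop that changes only the scratch cell is a loop on numbers, which is the form in which
`position` is defined. -/
theorem rounds_withScratch {f : ℕ → (ℕ → ℕ → ℕ) → ℕ → ℕ → ℕ} {g : ℕ → ℕ → ℕ} {N : ℕ}
    (h : ∀ i < N, ∀ y, f i (withScratch A y) = withScratch A (g i y)) (y : ℕ) :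
    rounds f N (withScratch A y) = withScratch A (rounds g N y) := by
  induction N with
  | zero => rfl
  | succ N ih => rw [rounds, rounds, ih fun i hi => h i (by omega), h N (by omega)]

theorem Loaded.eval_rowE (hA : Loaded H n v x cap A) {g i : ℕ} (hg : g < H.depth)
    (hi : i < (H.squares (g + 1)).length) :
    rowE.eval β A [g, i, 0, 0] = ((H.squares (g + 1))[i]).1 := by
  simp only [rowE, Ex.eval_get, Ex.eval_add, Ex.eval_const, Ex.eval_var_zero, Ex.eval_var_one,
    hA.row (g + 1) (by omega) hg i hi]

theorem Loaded.eval_columnE (hA : Loaded H n v x cap A) {g i : ℕ} (hg : g < H.depth)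
    (hi : i < (H.squares (g + 1)).length) :
    columnE.eval β A [g, i, 0, 0] = ((H.squares (g + 1))[i]).2 := by
  simp only [columnE, Ex.eval_get, Ex.eval_add, Ex.eval_const, Ex.eval_var_zero, Ex.eval_var_one,
    hA.column (g + 1) (by omega) hg i hi]

theorem Loaded.run_positionS (hA : Loaded H n v x cap A) (hB : Bounded H n v x β) {g i : ℕ}
    (hg : g < H.depth) (hi : i < (H.squares (g + 1)).length) : positionS.run β [i, g] A =
      withScratch A (H.position n v x (marked β A) (g + 1) ((H.squares (g + 1))[i])) := by
  classical
  have hM := hA.models' hB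
  have hcardE : ∀ y w, cardE.eval β (withScratch A y) w = n := fun y w => by
    rw [eval_withScratch (by decide), eval_cardE, hA.problem_n]
  rw [positionS, Stmt.run_seq, Stmt.run_store, Ex.eval_const, ← withScratch, Stmt.run_loop,
    Ex.eval_add, Ex.eval_var_one, Ex.eval_const, min_eq_left (by have := hB.depth_le; omega)]
  refine rounds_withScratch (fun j hj y => ?_) 0
  rw [Stmt.run_loop, hcardE, min_eq_left (by have := hB.card_le; omega)]
  refine rounds_withScratch (fun k hk y => ?_) y
  -- Instead of searching for a square that contains both, the program tests only the square of
  -- element `k`; by uniqueness this is the same.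
  have hcond : (Ex.and (.get 7 (.var 0)) (.call inSquareE (.add (.var 1) (.const 1))
        (.call₂ labE (.add (.var 1) (.const 1)) (.var 0))
        (.call₂ rowE (.var 3) (.var 2)) (.call₂ columnE (.var 3) (.var 2)))).Holds β
        (withScratch A y) (k :: j :: [i, g]) ↔
      k ∈ marked β A ∧ ∃ q ∈ H.squares (j + 1), v k ∈ H.verts (j + 1) q ∧
        (H.squares (g + 1))[i] ∈ H.verts (j + 1) q := by
    rw [Ex.Holds, eval_withScratch (by decide), ← Ex.Holds]
    simp only [Ex.holds_and, Ex.holds_get, Ex.eval_var_zero, Ex.holds_call, Ex.eval_add,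
      Ex.eval_var_one, Ex.eval_var_two, Ex.eval_var_three, Ex.eval_const, Ex.eval_call₂, eval_labE,
      hA.eval_rowE hg hi, hA.eval_columnE hg hi]
    obtain ⟨hl, hkl⟩ := hM.lab (j + 1) (by omega) (by omega) k hk
    rw [hA.holds_inSquareE (by omega) (by omega) hl, mem_marked, hA.problem_n]
    simp only [hk, true_and]
    refine and_congr_right fun _ => ⟨fun h => ⟨_, List.getElem_mem hl, hkl, h⟩, ?_⟩
    rintro ⟨q, hq, hkq, hwq⟩
    rwa [hB.valid.square_unique (by omega) (by omega) (List.getElem_mem hl) hq hkl hkq]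
  rw [Stmt.run_ite]
  simp only [hcond]
  split_ifs with hc
  · have h5 : withScratch A y 5 k = x k := by
      rw [withScratch, Function.update_of_ne (by omega), hA.position k hk]
    rw [Stmt.run_store, Ex.eval_const, ← withScratch, withScratch_withScratch, Ex.eval_get,
      Ex.eval_var_zero, h5]
  · have h11 : withScratch A y 11 0 = y := by simp [withScratch]
    rw [Stmt.run_store, Ex.eval_const, ← withScratch, withScratch_withScratch, Ex.eval_get,
      Ex.eval_const, h11]

theorem Loaded.congr {B : ℕ → ℕ → ℕ} (hA : Loaded H n v x cap A) (h : ∀ a < 7, a ≠ 1 → B a = A a) :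
    Loaded H n v x cap B := by
  have h0 := h 0 (by omega) (by omega)
  have h2 := h 2 (by omega) (by omega)
  have h3 := h 3 (by omega) (by omega)
  have h4 := h 4 (by omega) (by omega)
  have h5 := h 5 (by omega) (by omega)
  have h6 := h 6 (by omega) (by omega)
  constructor <;> simp only [h0, h2, h3, h4, h5, h6]
  exacts [hA.depth, hA.d, hA.len, hA.count, hA.row, hA.column, hA.card, hA.vertex, hA.position,
    hA.capacity]

theorem Loaded.eval_offsetE (hA : Loaded H n v x cap A) (hB : Bounded H n v x β) {h : ℕ}
    (hh : h ≤ H.depth) : offsetE.eval β A [h, 0, 0, 0] =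
      ∑ g ∈ range h, (H.squares (1 + g)).length := by
  rw [offsetE, Ex.eval_sum, Ex.eval_var_zero, min_eq_left (by have := hB.depth_le; omega)]
  refine sum_congr rfl fun g hg => ?_
  rw [mem_range] at hg
  simp only [Ex.eval_get, Ex.eval_add, Ex.eval_var_zero, Ex.eval_const]
  rw [hA.count (g + 1) (by omega) (by omega), add_comm]

/-- The output consists of the colors and of the selection. -/
theorem Loaded.output_eq (hA : Loaded H n v x cap A) (hB : Bounded H n v x β) {out : List ℕ}
    (hlen : out.length = (∑ g ∈ range H.depth, (H.squares (1 + g)).length) + n)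
    (hcolor : ∀ g < H.depth, ∀ i (hi : i < (H.squares (1 + g)).length),
      out[(∑ g ∈ range g, (H.squares (1 + g)).length) + i]? =
        some (H.colorOf n v x (marked β A) (1 + g) ((H.squares (1 + g))[i])))
    (hsel : ∀ k < n, out[(∑ g ∈ range H.depth, (H.squares (1 + g)).length) + k]? =
      some (if k ∈ marked β A then 1 else 0)) :
    (List.range (outputLengthE.eval β (outputS.run β [] A) [])).map (outputS.run β [] A 1) = out := by
  set off : ℕ → ℕ := fun h => ∑ g ∈ range h, (H.squares (1 + g)).length with hoff
  -- The output is written from left to right, so a correct prefix of length `p` is the invariant of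
  -- all loops; apart from the output and the scratch array nothing changes.
  let Inv : ℕ → (ℕ → ℕ → ℕ) → Prop := fun p B =>
    (∀ a, a ≠ 1 → a ≠ 11 → B a = A a) ∧ ∀ j < p, out[j]? = some (B 1 j)
  have hload : ∀ p B, Inv p B → Loaded H n v x cap B := fun p B hI =>
    hA.congr fun a ha ha' => hI.1 a ha' (by omega)
  have hprob : ∀ p B, Inv p B → problem β B = problem β A := by
    intro p B hI
    have hM : ∀ e : Ex, (e.reads 1 = false ∧ e.reads 11 = false) → ∀ w, e.eval β B w = e.eval β A w :=
      fun e he w => e.eval_congr w fun a ha => hI.1 a (fun h => by simp [h, he.1] at ha)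
        (fun h => by simp [h, he.2] at ha)
    have h6 : B 6 = A 6 := hI.1 6 (by omega) (by omega)
    simp only [problem, hM labE (by decide), hM colE (by decide), hM cardE (by decide),
      hM depthE (by decide), h6]
  have hmarked : ∀ p B, Inv p B → marked β B = marked β A := by
    intro p B hI
    rw [marked, marked, hprob p B hI, hI.1 7 (by omega) (by omega)]
  have hnext : ∀ p B z, Inv p B → out[p]? = some z →
      Inv (p + 1) (Function.update B 1 (Function.update (B 1) p z)) := by
    intro p B z hI hz
    refine ⟨fun a ha ha' => by rw [Function.update_of_ne ha, hI.1 a ha ha'], fun j hj => ?_⟩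
    rw [Function.update_self]
    rcases Nat.lt_succ_iff_lt_or_eq.1 hj with hj | rfl
    · rw [Function.update_of_ne hj.ne, hI.2 j hj]
    · rw [Function.update_self, hz]
  have hscratch : ∀ p B y, Inv p B → Inv p (withScratch B y) := fun p B y hI =>
    ⟨fun a ha ha' => by rw [withScratch, Function.update_of_ne ha', hI.1 a ha ha'],
      fun j hj => by rw [withScratch, Function.update_of_ne (by omega), hI.2 j hj]⟩
  have houtput : Inv (off H.depth + n) (outputS.run β [] A) := by
    rw [outputS, Stmt.run_seq]
    have h₁ : Inv (off H.depth) ((Stmt.loop depthE (.loop (.get 0 (.get 2 (.add (.var 0) (.const 1))))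
    (.seq positionS (.store 1 (.add (.call₂ offsetE (.var 1) (.const 0)) (.var 0))
      (.call₂ divE (.get 11 (.const 0))
        (.get 0 (.add (.add (.add (.var 1) (.const 1)) (.const 2)) depthE))))))).run β [] A) := by
      rw [Stmt.run_loop, hA.eval_depthE, min_eq_left (by have := hB.depth_le; omega)]
      refine rounds_induction (Inv := fun g B => Inv (off g) B) ⟨fun _ _ _ => rfl, by simp [hoff]⟩
        fun g hg B hI => ?_
      have hBl := hload _ B hI
      rw [Stmt.run_loop]
      have hc : (Ex.get 0 (.get 2 (.add (.var 0) (.const 1)))).eval β B [g] =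
          (H.squares (1 + g)).length := by
        rw [add_comm]
        exact hBl.count (g + 1) (by omega) hg
      rw [hc, min_eq_left (hB.count_le _ (by omega) (by omega))]
      have hstep : off (g + 1) = off g + (H.squares (1 + g)).length := sum_range_succ _ _
      simp only [hstep]
      refine rounds_induction (Inv := fun i B => Inv (off g + i) B) (by simpa using hI)
        fun i hi B hI => ?_
      have hBl := hload _ B hI
      rw [Stmt.run_seq, hBl.run_positionS hB hg (by rwa [add_comm g 1]), Stmt.run_store]
      have hi' : i < (H.squares (g + 1)).length := by rwa [add_comm g 1]
      set y := H.position n v x (marked β B) (g + 1) (H.squares (g + 1))[i] with hy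
      have hI' := hscratch _ _ y hI
      have hBl' := hload _ _ hI'
      rw [Ex.eval_add, Ex.eval_call₂, Ex.eval_var_one, Ex.eval_const, Ex.eval_var_zero,
        hBl'.eval_offsetE hB hg.le, Ex.eval_call₂,
        hBl'.eval_lenE (h := g + 1) (by omega) hg (by simp), Ex.eval_get, Ex.eval_const]
      have h11 : withScratch B y 11 0 = y := by simp [withScratch]
      have hylt : y < H.side' := hB.valid.position_lt hB.position _ _
      rw [h11, eval_divE (hylt.le.trans hB.side_le) (hB.valid.len_pos (by omega) hg)]
      refine hnext _ _ _ hI' ?_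
      rw [hcolor g hg i hi, SquareColorSystem.colorOf, hy, hmarked _ _ hI]
      simp only [add_comm 1 g]
    generalize Stmt.run β _ [] A = B at h₁
    have hBl := hload _ B h₁
    rw [Stmt.run_loop, eval_cardE, hBl.problem_n, min_eq_left (by have := hB.card_le; omega)]
    refine rounds_induction (Inv := fun k B => Inv (off H.depth + k) B) (by simpa using h₁)
      fun k hk B hI => ?_
    have hBl := hload _ B hI
    rw [Stmt.run_store, Ex.eval_add, Ex.eval_call₂, hBl.eval_depthE, Ex.eval_const,
      hBl.eval_offsetE hB le_rfl, Ex.eval_var_zero, Ex.eval_ite]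
    refine hnext _ _ _ hI ?_
    rw [hsel k hk]
    simp only [mem_marked, hA.problem_n, hk, true_and, Ex.holds_get, Ex.eval_var_zero,
      Ex.eval_const, hI.1 7 (by omega) (by omega)]
  set B := outputS.run β [] A with hBdef
  have hBl := hload _ B houtput
  have hL : outputLengthE.eval β B [] = out.length := by
    rw [outputLengthE, Ex.eval_add, Ex.eval_call₂, hBl.eval_depthE, Ex.eval_const,
      hBl.eval_offsetE hB le_rfl, eval_cardE, hBl.problem_n, hlen]
  rw [hL]
  refine List.ext_getElem? fun j => ?_
  rcases lt_or_ge j out.length with hj | hj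
  · rw [houtput.2 j (by rw [hlen] at hj; exact hj)]
    simp [hj]
  · rw [List.getElem?_eq_none hj, List.getElem?_eq_none (by simpa using hj)]

end

end RandRAM

/-! ### The whole program -/

namespace SquareColorSystem.Valid

open Finset

variable {H : SquareColorSystem}

theorem side'_lt (hH : H.Valid) : H.side' < H.side := by
  have h₁ := hH.eta_pow_lt
  have : H.side' ≤ H.side - 1 := Nat.div_mul_le_self _ _
  omega

theorem two_le_side (hH : H.Valid) : 2 ≤ H.side := by
  have h₁ := hH.eta_pow_lt
  have h₂ : 0 < H.eta ^ (H.depth + 2) := pow_pos eta_pos _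
  omega

theorem four_le_gridCard (hH : H.Valid) : 4 ≤ H.gridCard := by
  have := hH.two_le_side
  rw [gridCard]; nlinarith

theorem one_le_exponent (hH : H.Valid) :
    1 ≤ ⌈Real.sqrt (Real.logb 2 (H.gridCard : ℝ))⌉₊ := by
  have h := hH.four_le_gridCard
  refine Nat.one_le_ceil_iff.2 (Real.sqrt_pos.2 (Real.logb_pos one_lt_two ?_))
  exact_mod_cast (by omega : 1 < H.gridCard)

theorem two_le_eta (hH : H.Valid) : 2 ≤ H.eta :=
  Nat.le_self_pow (by have := hH.one_le_exponent; omega) 2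

theorem depth_lt_side (hH : H.Valid) : H.depth + 2 < H.side :=
  (Nat.lt_two_pow_self.trans_le (Nat.pow_le_pow_left hH.two_le_eta _)).trans hH.eta_pow_lt

theorem length_squares_le (hH : H.Valid) {h : ℕ} (h₁ : 1 ≤ h) (h₂ : h ≤ H.depth) :
    (H.squares h).length ≤ H.gridCard := by
  classical
  obtain ⟨hn, A, B, hA, hB, hmem⟩ := hH.canonical h h₁ h₂
  have hsub : (H.squares h).toFinset ⊆ range H.side ×ˢ range H.side := by
    intro q hq
    rw [List.mem_toFinset, hmem] at hq
    have := hA.1 _ hq.1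
    have := hB.1 _ hq.2
    have := hH.side'_lt
    have := H.d_pos h
    rw [mem_product, mem_range, mem_range]
    omega
  have := card_le_card hsub
  rwa [List.toFinset_card_of_nodup hn, card_product, card_range, ← sq] at this

theorem length_encode_le (hH : H.Valid) :
    H.encode.length ≤ 3 + 3 * H.gridCard + 2 * H.gridCard ^ 2 := by
  have hd : H.depth ≤ H.gridCard := by
    have := hH.depth_lt_side
    have := hH.two_le_side
    rw [gridCard]; nlinarith
  have hs : ∑ g ∈ range H.depth, (1 + 2 * (H.squares (1 + g)).length) ≤
      H.depth * (1 + 2 * H.gridCard) := by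
    refine (sum_le_card_nsmul _ _ (1 + 2 * H.gridCard) fun g hg => ?_).trans (by simp)
    rw [mem_range] at hg
    have := hH.length_squares_le (h := 1 + g) (by omega) (by omega)
    omega
  rw [length_encode, blockStart]
  nlinarith

end SquareColorSystem.Valid

namespace RandRAM

open Finset

/-- Select greedily and output a coloring that agrees with the selection. -/
def selectProg (a : ℕ) (posE capE : Ex) : Prog :=
  (Stmt.seq (.seq blockS (elementS a posE capE)) (.seq greedyS outputS)).main outputLengthE

/-- A bound on the running time for inputs with grids and element lists of total size `N`. -/
noncomputable def selectCost (a : ℕ) (posE capE : Ex) : Polynomial ℕ :=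
  ((Stmt.seq (.seq blockS (elementS a posE capE)) (.seq greedyS outputS)).cost +
    outputLengthE.cost + 9).comp (7 + 7 * Polynomial.X + 2 * Polynomial.X ^ 2)

/-- Common core of both problems, which differ only in the order of the entries of an element and in
the expressions for its position and for the capacities. -/
theorem exists_outputs {H : SquareColorSystem} (hH : H.Valid) {α : Type*} (U : List α)
    (t : α → List ℕ) (ht : ∀ u, (t u).length = 3) {a : ℕ} (ha : a + 1 < 3) {posE capE : Ex}
    (hpos : ∀ b, 3 ≤ b → posE.reads b = false) (hcap : ∀ b, 3 ≤ b → capE.reads b = false)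
    {v : ℕ → ℕ × ℕ} {x cap : ℕ → ℕ}
    (hv : ∀ k (hk : k < U.length), v k = ((t U[k]).getD a 0, (t U[k]).getD (a + 1) 0))
    (hb : ∀ k < U.length, H.Belongs (v k)) (hlt : ∀ k < U.length, x k < H.side')
    (input : List ℕ) (hinput : input = H.encode ++ U.length :: U.flatMap t)
    (hx : ∀ β A, H.side' ≤ β → (∀ i, A 0 i = (input[i]?).getD 0) →
      (∀ h ≤ H.depth, A 2 (h + 1) = H.blockStart h) → ∀ k < U.length, posE.eval β A [k] = x k)
    (hc : ∀ β A, (∀ i, A 0 i = (input[i]?).getD 0) →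
      ∀ h, 1 ≤ h → h ≤ H.depth → capE.eval β A [h] = cap h)
    (ω : ℕ → Bool) :
    ∃ P : LaminarProblem, H.Models U.length v x P ∧ (∀ h, 1 ≤ h → h ≤ H.depth → P.cap h = cap h) ∧
      ∃ T ≤ (selectCost a posE capE).eval (H.gridCard + U.length),
        Outputs (selectProg a posE capE) input ω
          (H.encodeSolution (H.colorOf U.length v x P.greedy)
            ({k | (k : ℕ) ∈ P.greedy} : Finset (Fin U.length))) T := by
  classical
  set β := input.length + input.getD 0 0 + 3 with hβ
  have hside : input.getD 0 0 = H.side := by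
    rw [List.getD_eq_getElem?_getD, hinput, H.encode_side, Option.getD_some]
  have hlen : input.length = H.encode.length + (1 + 3 * U.length) := by
    rw [hinput, List.length_append, List.length_cons,
      List.length_flatMap_const t 3 U fun u _ => ht u]
    ring
  have hinit : ∀ i, (initState input ω).arr 0 i = (input[i]?).getD 0 := initState_arr_zero _
  have hside' := hH.side'_lt
  have hB : Bounded H U.length v x β := by
    refine ⟨hH, hb, hlt, by omega, fun h h₁ h₂ => ?_, ?_, by omega⟩
    · obtain ⟨g, rfl⟩ := Nat.exists_eq_add_of_le h₁
      have : 1 + 2 * (H.squares (1 + g)).length ≤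
          ∑ g ∈ range H.depth, (1 + 2 * (H.squares (1 + g)).length) :=
        single_le_sum (f := fun g => 1 + 2 * (H.squares (1 + g)).length) (fun _ _ => Nat.zero_le _)
          (mem_range.2 (by omega))
      have hE := H.length_encode
      rw [SquareColorSystem.blockStart] at hE
      omega
    · have := hH.depth_lt_side
      omega
  obtain ⟨hL, hz⟩ := run_elementS (H := H) (ω := ω) (β := β) U t ht rfl
    (by have := hB.card_le; omega) hB.depth_le ha hpos hcap hv
    (fun A hA hA2 => hx β A hB.side_le (fun i => by rw [hA, ← hinput, hinit]) hA2)
    (fun A hA _ => hc β A fun i => by rw [hA, ← hinput, hinit])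
  rw [← hinput] at hL hz
  generalize hA₁ : (Stmt.seq blockS (elementS a posE capE)).run β [] (initState input ω).arr = A₁ at hL hz
  have hM := hL.models' hB
  set P := problem β A₁ with hP
  obtain ⟨hin, hmark⟩ := run_greedyS (by rw [← hP, hM.card]; exact hB.card_le)
    (by rw [← hP, hM.depth]; exact hB.depth_le) (hM.hierarchical hH) (hz 7 (by omega))
    (hz 9 (by omega))
  rw [← hP] at hmark
  have hfeas := (hM.hierarchical hH).feasible_greedy
  refine ⟨P, hM, hL.capacity, ?_⟩
  generalize hA₂ : greedyS.run β [] A₁ = A₂ at hin hmark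
  have hL₂ : Loaded H U.length v x cap A₂ := hL.congr fun a ha _ => hin a ha
  obtain ⟨T, hT, hout⟩ := Stmt.outputs_main
    (Stmt.seq (.seq blockS (elementS a posE capE)) (.seq greedyS outputS)) outputLengthE input ω β hβ
    (outputS.run β [] A₂) (by rw [Stmt.run_seq, Stmt.run_seq, hA₁, hA₂])
  refine ⟨T, hT.trans ?_, ?_⟩
  · rw [selectCost, Polynomial.eval_comp]
    generalize Stmt.cost _ + Ex.cost _ + 9 = p
    -- The input length is at most quadratic in the grid: there are at most `gridCard` levels with
    -- at most `gridCard` squares each.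
    refine p.eval_nat_mono ?_
    have h₁ := hH.length_encode_le
    have h₂ : H.side ≤ H.gridCard := by
      have := hH.two_le_side
      rw [SquareColorSystem.gridCard]; nlinarith
    simp only [Polynomial.eval_add, Polynomial.eval_mul, Polynomial.eval_pow, Polynomial.eval_X,
      Polynomial.eval_ofNat]
    rw [hβ, hlen, hside]
    nlinarith [Nat.zero_le (H.gridCard * U.length), Nat.zero_le (U.length ^ 2)]
  · rw [hL₂.output_eq (out := H.encodeSolution (H.colorOf U.length v x P.greedy)
      ({k | (k : ℕ) ∈ P.greedy} : Finset (Fin U.length))) hB ?_ ?_ ?_] at hout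
    · exact hout
    · rw [SquareColorSystem.encodeSolution, List.length_append, SquareColorSystem.levels,
        List.length_flatMap_range']
      simp
    · intro g hg i hi
      rw [hmark, SquareColorSystem.encodeSolution, SquareColorSystem.levels]
      have := List.getElem?_flatMap_range' (fun h => (H.squares h).map
        (H.colorOf U.length v x P.greedy h)) ((List.finRange U.length).map fun k =>
          if k ∈ ({k | (k : ℕ) ∈ P.greedy} : Finset (Fin U.length)) then 1 else 0)
        (n := H.depth) (i := g) (s := 1) (j := i) hg (by simpa using hi)
      simp only [List.length_map] at this
      rw [this]
      simp [hi]
    · intro k hk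
      rw [hmark, SquareColorSystem.encodeSolution, SquareColorSystem.levels]
      have := List.getElem?_flatMap_range'_right (fun h => (H.squares h).map
        (H.colorOf U.length v x P.greedy h)) ((List.finRange U.length).map fun k =>
          if k ∈ ({k | (k : ℕ) ∈ P.greedy} : Finset (Fin U.length)) then 1 else 0)
        H.depth 1 k
      simp only [List.length_map] at this
      rw [this]
      simp [hk]

end RandRAM

/-! ### Solutions and selections -/

namespace SquareColorSystem

open Finset RandRAM

variable {H : SquareColorSystem}

theorem Valid.mem_interval_iff (hH : H.Valid) {h : ℕ} (h₁ : 1 ≤ h) (h₂ : h ≤ H.depth) {x c : ℕ} :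
    x ∈ H.interval h c ↔ x / H.len h = c := by
  rw [interval, mem_Ico, Nat.div_eq_iff (hH.len_pos h₁ h₂), add_one_mul]
  have := hH.len_pos h₁ h₂
  omega

namespace Models

variable {n : ℕ} {v : ℕ → ℕ × ℕ} {x : ℕ → ℕ} {P : LaminarProblem}

/-- Every solution is a feasible selection, so the bound for the greedy selection covers all
competitors. -/
theorem feasible_map (hP : H.Models n v x P) (hH : H.Valid) (hv : ∀ k < n, H.Belongs (v k))
    (hx : ∀ k < n, x k < H.side') {f : ℕ → ℕ × ℕ → ℕ} (hf : H.IsColoring f) {S : Finset (Fin n)}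
    (hagree : ∀ k ∈ S, ∀ q ∈ H.squares H.depth, v k ∈ H.verts H.depth q →
      f H.depth q = x k / H.len H.depth)
    (hcap : ∀ h, 1 ≤ h → h ≤ H.depth → ∀ c, H.IsColor h c →
      #{k ∈ S | x (k : Fin n) / H.len h = c} ≤ P.cap h) : P.Feasible (S.map Fin.valEmbedding) := by
  classical
  refine ⟨fun k hk => ?_, fun k hk k' hk' => ?_, fun h hh c => ?_⟩
  · obtain ⟨k, _, rfl⟩ := mem_map.1 hk
    rw [hP.card]
    exact mem_range.2 k.2
  · obtain ⟨k, hkS, rfl⟩ := mem_map.1 hk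
    obtain ⟨k', hkS', rfl⟩ := mem_map.1 hk'
    exact hP.compat_of_agree hH hf hv k.2 k'.2 (hagree k hkS) (hagree k' hkS')
  · rw [hP.depth] at hh
    rw [filter_map, card_map]
    have he : ∀ k : Fin n, P.col (h + 1) k = x k / H.len (h + 1) := fun k =>
      hP.col (h + 1) (by omega) hh k k.2
    simp only [Function.comp_def, Fin.valEmbedding_apply, he]
    by_cases hc : H.IsColor (h + 1) c
    · exact hcap (h + 1) (by omega) hh c hc
    -- A number that is not a color is not attained by any position in the row of sources.
    · refine (card_eq_zero.2 (filter_eq_empty_iff.2 fun k _ he => hc ?_)).trans_le (Nat.zero_le _)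
      rw [← he]
      exact hH.isColor_div (by omega) hh (hx k k.2)

theorem card_filter_mem {S : Finset ℕ} (hP : H.Models n v x P) (hS : P.Feasible S) :
    #{k : Fin n | (k : ℕ) ∈ S} = #S := by
  classical
  rw [← card_map Fin.valEmbedding]
  congr 1
  ext k
  simp only [mem_map, mem_filter, mem_univ, true_and, Fin.valEmbedding_apply]
  refine ⟨fun ⟨i, hi, hik⟩ => hik ▸ hi, fun hk => ⟨⟨k, ?_⟩, hk, rfl⟩⟩
  exact hP.card ▸ mem_range.1 (hS.subset hk)

theorem card_color_le {S : Finset ℕ} (hP : H.Models n v x P) (hS : P.Feasible S) {h : ℕ}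
    (h₁ : 1 ≤ h) (h₂ : h ≤ H.depth) (c : ℕ) :
    #{k ∈ ({k : Fin n | (k : ℕ) ∈ S} : Finset (Fin n)) | x (k : Fin n) / H.len h = c} ≤ P.cap h := by
  classical
  obtain ⟨h, rfl⟩ := Nat.exists_eq_add_of_le' h₁
  refine le_trans ?_ (hS.indep h (by rw [hP.depth]; omega) c)
  rw [← card_map Fin.valEmbedding]
  refine card_le_card fun k hk => ?_
  obtain ⟨k, hkS, rfl⟩ := mem_map.1 hk
  rw [mem_filter, mem_filter] at hkS
  rw [mem_filter]
  exact ⟨hkS.1.2, (hP.col _ h₁ h₂ k k.2).trans hkS.2⟩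

theorem indep_of_card_le (hP : H.Models n v x P) (hn : ∀ h, 1 ≤ h → h ≤ H.depth → n ≤ P.cap h) :
    ∀ S ⊆ range P.n, P.Indep S := by
  classical
  intro S hS h hh c
  rw [hP.depth] at hh
  refine (card_le_card ((filter_subset _ _).trans hS)).trans ?_
  rw [card_range, hP.card]
  exact hn _ (by omega) hh

end Models

end SquareColorSystem

namespace RandRAM

variable {H : SquareColorSystem} {β : ℕ} {A : ℕ → ℕ → ℕ} {α : Type*} {U : List α} {t : α → List ℕ}
  {input : List ℕ}

theorem eval_entryE (ht : ∀ u, (t u).length = 3)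
    (hinput : input = H.encode ++ U.length :: U.flatMap t)
    (h0 : ∀ i, A 0 i = (input[i]?).getD 0) (h2 : ∀ h ≤ H.depth, A 2 (h + 1) = H.blockStart h)
    {j : ℕ} (hj : j < 3) {k : ℕ} (hk : k < U.length) :
    (entryE j).eval β A [k] = (t U[k]).getD j 0 := by
  rw [entryE, Ex.eval_get, Ex.eval_add, Ex.eval_get, Ex.eval_add, depthE, Ex.eval_get,
    Ex.eval_const, Ex.eval_const, h0 2, hinput, H.encode_depth, Option.getD_some,
    h2 _ le_rfl, h0, hinput, H.encode_rest]
  simp only [Ex.eval_add, Ex.eval_const, Ex.eval_var_zero]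
  rw [show 1 + j + (k + (k + k)) = (k * 3 + j) + 1 by ring, List.getElem?_cons_succ,
    List.getElem?_flatMap_const t 3 U (fun u _ => ht u) hk hj, List.getD_eq_getElem?_getD]

theorem eval_depthE_of_input {R : List ℕ} (hinput : input = H.encode ++ R)
    (h0 : ∀ i, A 0 i = (input[i]?).getD 0) (w : List ℕ) : depthE.eval β A w = H.depth := by
  rw [depthE, Ex.eval_get, Ex.eval_const, h0, hinput, H.encode_depth, Option.getD_some]

theorem reads_entryE (j : ℕ) {b : ℕ} (hb : 3 ≤ b) : (entryE j).reads b = false := by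
  simp only [entryE, depthE, Ex.reads, Bool.or_false, Bool.or_eq_false_iff, beq_eq_false_iff_ne]
  omega

/-- The parameter `d_h`; argument `h`. -/
def sideE : Ex := .get 0 (.add (.var 0) (.const 2))

theorem eval_sideE {R : List ℕ} (hinput : input = H.encode ++ R)
    (h0 : ∀ i, A 0 i = (input[i]?).getD 0) {h : ℕ} (h₁ : 1 ≤ h) (h₂ : h ≤ H.depth) :
    sideE.eval β A [h] = H.d h := by
  obtain ⟨g, rfl⟩ := Nat.exists_eq_add_of_le h₁
  rw [sideE, Ex.eval_get, Ex.eval_add, Ex.eval_const, Ex.eval_var_zero, h0, hinput,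
    show 1 + g + 2 = 3 + g by ring, H.encode_d _ (by omega), Option.getD_some]

/-- The left endpoint of the interval of the color of an element. -/
def endpointE : Ex :=
  .call₂ mulE (entryE 2) (.get 0 (.add (.add depthE (.const 2)) depthE))

/-- The capacity of a color if every color of the last level is used at most once; argument `h`. -/
def distinctE : Ex := .ite (.eq (.var 0) depthE) (.const 1) sideE

end RandRAM

/-! ### The greedy solution for Hierarchical Square Coloring -/

namespace HSCInstance

open Finset RandRAM

variable {I : HSCInstance}

/-- An element is placed at the left endpoint of the interval of its color, so that dividing by the
interval lengths yields its ancestor-colors. The result holds for both values of `ε` because the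
program does not depend on it. -/
theorem Valid.exists_outputs (hI : I.Valid) (ω : ℕ → Bool) :
    ∃ T f S, T ≤ (selectCost 0 endpointE sideE).eval I.size ∧ I.Feasible f S ∧
      (∀ ε, 1 ≤ ε ∨ I.U.length ≤ I.eta ^ 3 → ∀ f' S', I.Feasible f' S' →
        #S' ≤ (1 + ε * (I.depth + 1)) * #S) ∧
      Outputs (selectProg 0 endpointE sideE) I.encode ω (I.encodeSolution f S) T := by
  classical
  have hH := hI.system
  have hρ := hH.one_le_depth
  have hlen := hH.len_pos hρ le_rfl
  set v : ℕ → ℕ × ℕ := fun k => (I.U.getD k default).1 with hv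
  set x : ℕ → ℕ := fun k => (I.U.getD k default).2 * I.len I.depth with hx
  have hv' : ∀ k (hk : k < I.U.length), v k = I.U[k].1 := fun k hk => by
    simp [hv, hk]
  have hx' : ∀ k (hk : k < I.U.length), x k = I.U[k].2 * I.len I.depth := fun k hk => by
    simp [hx, hk]
  have hcolor : ∀ k (hk : k < I.U.length), x k / I.len I.depth = I.U[k].2 := fun k hk => by
    rw [hx' k hk, Nat.mul_div_cancel _ hlen]
  have hb : ∀ k < I.U.length, I.Belongs (v k) := fun k hk => by
    rw [hv' k hk]; exact hI.belongs _ (List.getElem_mem hk)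
  have hc : ∀ k (hk : k < I.U.length), I.U[k].2 < I.side' / I.len I.depth := fun k hk =>
    hI.color _ (List.getElem_mem hk)
  have hlt : ∀ k < I.U.length, x k < I.side' := fun k hk => by
    rw [hx' k hk]
    exact (Nat.mul_lt_mul_of_pos_right (hc k hk) hlen).trans_le (Nat.div_mul_le_self _ _)
  have ht : ∀ u : (ℕ × ℕ) × ℕ, [u.1.1, u.1.2, u.2].length = 3 := fun _ => rfl
  obtain ⟨P, hM, hcap, T, hT, hout⟩ := RandRAM.exists_outputs hH I.U
    (fun u => [u.1.1, u.1.2, u.2]) ht (a := 0) (by omega) (posE := endpointE) (capE := sideE)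
    (v := v) (x := x) (cap := I.d)
    (fun b hb => by
      simp only [endpointE, Ex.call₂, Ex.reads, reads_entryE 2 hb, mulE, depthE]
      simp; omega)
    (fun b hb => by simp only [sideE, Ex.reads]; simp; omega)
    (fun k hk => by rw [hv' k hk]; rfl) hb hlt I.encode rfl
    (fun β A hβ h0 h2 k hk => by
      rw [endpointE, Ex.eval_call₂, eval_entryE ht rfl h0 h2 (by omega) hk, Ex.eval_get,
        Ex.eval_add, Ex.eval_add, eval_depthE_of_input rfl h0, Ex.eval_const, h0, encode]
      obtain ⟨g, hg⟩ := Nat.exists_eq_add_of_le hρ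
      rw [show I.depth + 2 + I.depth = 3 + I.depth + g by omega, I.encode_len _ (by omega), ← hg,
        Option.getD_some, hx' k hk]
      exact eval_mulE ((hc k hk).le.trans ((Nat.div_le_self _ _).trans hβ)))
    (fun β A h0 h h₁ h₂ => eval_sideE rfl h0 h₁ h₂) ω
  have hG := (hM.hierarchical hH).feasible_greedy
  have hncard : ∀ S : Finset (Fin I.U.length), ∀ h, 1 ≤ h → h ≤ I.depth → ∀ c,
      Set.ncard {k | k ∈ S ∧ I.IsAncestor h c I.depth I.U[k].2} = #{k ∈ S | x (k : Fin I.U.length) / I.len h = c} := by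
    intro S h h₁ h₂ c
    rw [← Set.ncard_coe_finset, coe_filter]
    congr 1
    ext k
    simp only [Set.mem_ofPred_eq, hH.isAncestor_iff h₁ h₂ le_rfl, hx' k k.2, Fin.getElem_fin,
      eq_comm]
  refine ⟨T, _, _, hT, ⟨hM.isColoring_colorOf hH hlt hG, fun k hk q hq hkq => ?_,
    fun h h₁ h₂ c _ => ?_⟩, fun ε hε f' S' hS' => ?_, hout⟩
  · rw [mem_filter] at hk
    rw [hM.colorOf_eq hH hG hρ le_rfl hq hk.2 (by rwa [hv' k k.2]), hcolor k k.2, Fin.getElem_fin]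
  · rw [hncard _ h h₁ h₂, ← hcap h h₁ h₂]
    exact hM.card_color_le hG h₁ h₂ c
  · rw [hM.card_filter_mem hG, ← hM.depth, ← card_map Fin.valEmbedding]
    refine (hM.hierarchical hH).card_le_greedy (hε.imp_right fun hU => ?_)
      (hM.feasible_map hH hb hlt hS'.coloring (fun k hk q hq hkq => ?_) fun h h₁ h₂ c hc => ?_)
    -- All capacities satisfy `d_h ≥ d_ρ = η ^ 3`, so a small `U` can never exceed them.
    · refine hM.indep_of_card_le fun h h₁ h₂ => hU.trans ?_
      rw [hcap h h₁ h₂]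
      exact Nat.pow_le_pow_right SquareColorSystem.eta_pos (by omega)
    · rw [hcolor k k.2]
      exact hS'.agree k hk q hq (by rwa [hv' k k.2] at hkq)
    · rw [hcap h h₁ h₂, ← hncard S' h h₁ h₂]
      exact hS'.capacity h h₁ h₂ c hc

end HSCInstance

/-! ### Perfect sets of demand pairs -/

namespace DemandInstance

open Finset RandRAM

variable {I : DemandInstance}

/-- The conflicts between equal sources or equal destinations are not laminar constraints. Allowing
only one element per level-`ρ` color excludes both; thinning a competitor accordingly costs the
factor `d_ρ = η ^ 3`. -/
theorem Valid.exists_outputs (hI : I.Valid) (ω : ℕ → Bool) :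
    ∃ T f S, T ≤ (selectCost 1 (entryE 0) distinctE).eval I.size ∧ I.Perfect f S ∧
      (∀ f' S', I.Perfect f' S' → #S' ≤ I.eta ^ 3 * ((I.depth + 2) * #S)) ∧
      Outputs (selectProg 1 (entryE 0) distinctE) I.encode ω (I.encodeSolution f S) T := by
  classical
  have hH := hI.system
  have hρ := hH.one_le_depth
  set v : ℕ → ℕ × ℕ := fun k => (I.pairs.getD k default).2 with hv
  set x : ℕ → ℕ := fun k => (I.pairs.getD k default).1 with hx
  have hv' : ∀ k (hk : k < I.pairs.length), v k = I.pairs[k].2 := fun k hk => by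
    simp [hv, hk]
  have hx' : ∀ k (hk : k < I.pairs.length), x k = I.pairs[k].1 := fun k hk => by
    simp [hx, hk]
  have hb : ∀ k < I.pairs.length, I.Belongs (v k) := fun k hk => by
    rw [hv' k hk]; exact hI.destination _ (List.getElem_mem hk)
  have hlt : ∀ k < I.pairs.length, x k < I.side' := fun k hk => by
    rw [hx' k hk]; exact hI.source _ (List.getElem_mem hk)
  have ht : ∀ p : ℕ × (ℕ × ℕ), [p.1, p.2.1, p.2.2].length = 3 := fun _ => rfl
  obtain ⟨P, hM, hcap, T, hT, hout⟩ := RandRAM.exists_outputs hH I.pairs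
    (fun p => [p.1, p.2.1, p.2.2]) ht (a := 1) (by omega) (posE := entryE 0) (capE := distinctE)
    (v := v) (x := x) (cap := fun h => if h = I.depth then 1 else I.d h)
    (fun b hb => reads_entryE 0 hb)
    (fun b hb => by
      simp only [distinctE, sideE, depthE, Ex.reads, Ex.eq, Ex.and, Ex.le, Ex.not]
      simp; omega)
    (fun k hk => by rw [hv' k hk]; rfl) hb hlt I.encode rfl
    (fun β A _ h0 h2 k hk => by rw [eval_entryE ht rfl h0 h2 (by omega) hk, hx' k hk]; rfl)
    (fun β A h0 h h₁ h₂ => by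
      simp only [distinctE, Ex.eval_ite, Ex.holds_eq, Ex.eval_var_zero,
        eval_depthE_of_input (H := I.toSquareColorSystem) rfl h0, Ex.eval_const,
        eval_sideE (H := I.toSquareColorSystem) rfl h0 h₁ h₂]) ω
  have hG := (hM.hierarchical hH).feasible_greedy
  have hncard : ∀ S : Finset (Fin I.pairs.length), ∀ h, 1 ≤ h → h ≤ I.depth → ∀ c,
      Set.ncard {k | k ∈ S ∧ I.pairs[k].1 ∈ I.interval h c} = #{k ∈ S | x (k : Fin I.pairs.length) / I.len h = c} := by
    intro S h h₁ h₂ c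
    rw [← Set.ncard_coe_finset, coe_filter]
    congr 1
    ext k
    simp only [Set.mem_ofPred_eq, hH.mem_interval_iff h₁ h₂, hx' k k.2, Fin.getElem_fin]
  have hdistinct : ∀ k k' : Fin I.pairs.length, (k : ℕ) ∈ P.greedy → (k' : ℕ) ∈ P.greedy →
      x k / I.len I.depth = x k' / I.len I.depth → k = k' := by
    intro k k' hk hk' he
    have := hM.card_color_le hG hρ le_rfl (x k' / I.len I.depth)
    rw [hcap _ hρ le_rfl, if_pos rfl] at this
    exact card_le_one.1 this k (by simp [hk, he]) k' (by simp [hk'])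
  refine ⟨T, _, _, hT, ⟨hM.isColoring_colorOf hH hlt hG, fun k hk k' hk' hne => ⟨?_, ?_⟩,
    fun k hk q hq hkq => ?_, fun h h₁ h₂ c _ => ?_⟩, fun f' S' hS' => ?_, hout⟩
  · intro he
    rw [mem_filter] at hk hk'
    exact hne (hdistinct k k' hk.2 hk'.2 (by rw [hx' k k.2, hx' k' k'.2]; exact congrArg (· / _) he))
  -- Equal destinations lie in the same last-level square, hence the two sources lie in the interval
  -- of its one color.
  · intro he
    rw [mem_filter] at hk hk'
    obtain ⟨q, hq, hkq⟩ := hb k k.2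
    refine hne (hdistinct k k' hk.2 hk'.2 ?_)
    rw [← hM.colorOf_eq hH hG hρ le_rfl hq hk.2 hkq, ← hM.colorOf_eq hH hG hρ le_rfl hq hk'.2]
    rw [hv' k' k'.2]
    rw [hv' k k.2] at hkq
    simp only [Fin.getElem_fin] at he
    rwa [← he]
  · rw [mem_filter] at hk
    rw [hH.mem_interval_iff hρ le_rfl, hM.colorOf_eq hH hG hρ le_rfl hq hk.2 (by rwa [hv' k k.2]),
      hx' k k.2, Fin.getElem_fin]
  · rw [hncard _ h h₁ h₂]
    refine (hM.card_color_le hG h₁ h₂ c).trans ?_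
    rw [hcap h h₁ h₂]
    split_ifs
    exacts [I.d_pos h, le_rfl]
  · have hcolor : ∀ h, 1 ≤ h → h ≤ I.depth → ∀ c, I.IsColor h c →
        #{k ∈ S' | x (k : Fin I.pairs.length) / I.len h = c} ≤ I.d h := fun h h₁ h₂ c hc => by
      rw [← hncard S' h h₁ h₂]
      exact hS'.capacity h h₁ h₂ c hc
    set g : Fin I.pairs.length → ℕ := fun k => x k / I.len I.depth with hg
    -- Each color of the last level is used at most `d_ρ = η ^ 3` times.
    have h₁ : #S' ≤ I.eta ^ 3 * #(S'.image g) := by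
      refine card_le_mul_card_image S' _ fun c hc => ?_
      obtain ⟨k, _, rfl⟩ := mem_image.1 hc
      refine (hcolor I.depth hρ le_rfl _ (hH.isColor_div hρ le_rfl (hlt k k.2))).trans_eq ?_
      rw [SquareColorSystem.d, Nat.add_sub_cancel_left]
    -- One representative for each last-level color that occurs. This subset respects the reduced
    -- capacities and can be compared with the greedy selection.
    obtain ⟨S'', hsub, hcard, hinj⟩ : ∃ S'' ⊆ S', #S'' = #(S'.image g) ∧ Set.InjOn g S'' := by
      obtain ⟨u, hu, hinj, himage⟩ := Finset.exists_subset_injOn_image_eq_of_surjOn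
        (S' : Set (Fin I.pairs.length)) (S'.image g) (f := g) (by simp [Set.surjOn_image])
      refine ⟨u, by exact_mod_cast hu, ?_, hinj⟩
      rw [← himage, card_image_of_injOn hinj]
    refine h₁.trans (Nat.mul_le_mul_left _ ?_)
    rw [hM.card_filter_mem hG, ← hcard, ← card_map Fin.valEmbedding]
    have := (hM.hierarchical hH).card_le_greedy (ε := 1) (Or.inl le_rfl)
      (hM.feasible_map hH hb hlt hS'.coloring (S := S'') (fun k hk q hq hkq => ?_)
        fun h h₁ h₂ c hc => ?_)
    · rw [hM.depth] at this
      rwa [show I.depth + 2 = 1 + 1 * (I.depth + 1) by ring]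
    · have := hS'.agree k (hsub hk) q hq (by rwa [hv' k k.2] at hkq)
      rw [hH.mem_interval_iff hρ le_rfl] at this
      rw [← this, hx' k k.2, Fin.getElem_fin]
    · rw [hcap h h₁ h₂]
      split_ifs with hh
      · subst hh
        refine card_le_one.2 fun k hk k' hk' => ?_
        rw [mem_filter] at hk hk'
        exact hinj hk.1 hk'.1 (hk.2.trans hk'.2.symm)
      · exact (card_le_card (filter_subset_filter _ hsub)).trans (hcolor h h₁ h₂ c hc)

end DemandInstance

/-! ### The approximation factors -/

namespace SquareColorSystem.Valid

variable {H : SquareColorSystem}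

/-- The integer `⌈√(log n)⌉`, of which `η` is the power of two. -/
theorem exists_exponent (hH : H.Valid) : ∃ s : ℕ, H.eta = 2 ^ s ∧ 2 * (H.depth + 2) < s ∧
    (s : ℝ) < Real.sqrt (Real.logb 2 H.gridCard) + 1 := by
  set L := Real.logb 2 (H.gridCard : ℝ) with hL
  have hG : (0 : ℝ) < H.gridCard := by
    have := hH.four_le_gridCard
    exact_mod_cast (by omega : 0 < H.gridCard)
  refine ⟨⌈Real.sqrt L⌉₊, rfl, ?_, Nat.ceil_lt_add_one (Real.sqrt_nonneg _)⟩
  set s := ⌈Real.sqrt L⌉₊ with hs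
  have h₁ : L ≤ (s : ℝ) ^ 2 := by
    have := Nat.le_ceil (Real.sqrt L)
    exact (Real.sqrt_le_left (by positivity)).1 this
  -- Rounding up the square root gives `log n ≤ s ^ 2`.
  have h₂ : H.gridCard ≤ 2 ^ (s * s) := by
    rw [hL, Real.logb_le_iff_le_rpow one_lt_two hG] at h₁
    have : ((2 : ℝ) ^ ((s : ℝ) ^ 2)) = ((2 ^ (s * s) : ℕ) : ℝ) := by
      rw [show ((s : ℝ) ^ 2) = ((s * s : ℕ) : ℝ) by push_cast; ring, Real.rpow_natCast]
      push_cast; rfl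
    rw [this] at h₁
    exact_mod_cast h₁
  -- Squaring `η ^ (ρ + 2) < ℓ` gives a lower bound for `n = ℓ ^ 2`; comparing exponents leaves `2 *
  -- (ρ + 2) < s`.
  have h₃ : 2 ^ (s * (2 * (H.depth + 2))) < H.gridCard := by
    have := hH.eta_pow_lt
    rw [show H.eta = 2 ^ s from rfl, ← pow_mul] at this
    rw [show s * (2 * (H.depth + 2)) = s * (H.depth + 2) * 2 by ring, pow_mul, gridCard]
    exact Nat.pow_lt_pow_left this (by omega)
  exact Nat.lt_of_mul_lt_mul_left ((Nat.pow_lt_pow_iff_right (by omega)).1 (h₃.trans_le h₂))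

theorem two_le_logb (hH : H.Valid) : 2 ≤ Real.logb 2 (H.gridCard : ℝ) := by
  have h := hH.four_le_gridCard
  rw [Real.le_logb_iff_rpow_le one_lt_two (by exact_mod_cast (by omega : 0 < H.gridCard))]
  norm_num
  exact_mod_cast h

/-- From `2 * (ρ + 2) < s < √L + 1` with `L = log n ≥ 2`, where `√L ≤ L` and `1 ≤ L`. -/
theorem depth_le_logb (hH : H.Valid) : (H.depth + 2 : ℝ) ≤ Real.logb 2 (H.gridCard : ℝ) := by
  obtain ⟨s, _, h₁, h₂⟩ := hH.exists_exponent
  have hL := hH.two_le_logb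
  have h₃ : (2 * (H.depth + 2) : ℝ) < s := by exact_mod_cast h₁
  have h₄ : Real.sqrt (Real.logb 2 H.gridCard) ≤ Real.logb 2 H.gridCard :=
    Real.sqrt_le_iff.2 ⟨by linarith, by nlinarith⟩
  linarith

/-- Since `η ^ 3 = 2 ^ (3 * s)`, the logarithm of `n` is at least `3 * s`, far above `ρ + 2`. -/
theorem depth_le_logb_of_lt (hH : H.Valid) {n : ℕ} (hn : H.eta ^ 3 < n) :
    (H.depth + 2 : ℝ) ≤ Real.logb 2 n := by
  obtain ⟨s, hs, h₁, _⟩ := hH.exists_exponent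
  rw [hs, ← pow_mul] at hn
  have h₃ : (2 * (H.depth + 2) : ℝ) < s := by exact_mod_cast h₁
  have h₄ : (s * 3 : ℝ) ≤ Real.logb 2 n := by
    rw [Real.le_logb_iff_rpow_le one_lt_two 
      (by exact_mod_cast (by positivity : 0 < 2 ^ (s * 3)).trans hn)]
    have : ((2 : ℝ) ^ (s * 3 : ℝ)) = ((2 ^ (s * 3) : ℕ) : ℝ) := by
      rw [show (s * 3 : ℝ) = ((s * 3 : ℕ) : ℝ) by push_cast; ring, Real.rpow_natCast]
      push_cast; rfl
    rw [this]
    exact_mod_cast hn.le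
  linarith

/-- The product is at most `2 ^ (4 * s)` because `ρ + 2 ≤ s ≤ 2 ^ s`. Moreover `4 * s ≤ 4 * √L + 4 ≤
8 * √L`, as `√L ≥ 1`; this is the constant `8`. -/
theorem eta_pow_mul_depth_le (hH : H.Valid) : ((H.eta ^ 3 * (H.depth + 2) : ℕ) : ℝ) ≤
    (2 : ℝ) ^ (8 * Real.sqrt (Real.logb 2 H.gridCard)) := by
  obtain ⟨s, hs, h₁, h₂⟩ := hH.exists_exponent
  have h₃ : H.eta ^ 3 * (H.depth + 2) ≤ 2 ^ (4 * s) := by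
    have h : H.depth + 2 ≤ 2 ^ s := (by omega : H.depth + 2 ≤ s).trans Nat.lt_two_pow_self.le
    calc H.eta ^ 3 * (H.depth + 2) ≤ (2 ^ s) ^ 3 * 2 ^ s := by rw [hs]; gcongr
      _ = 2 ^ (4 * s) := by ring
  have h₄ : 1 ≤ Real.sqrt (Real.logb 2 H.gridCard) :=
    Real.one_le_sqrt.2 (by linarith [hH.two_le_logb])
  calc ((H.eta ^ 3 * (H.depth + 2) : ℕ) : ℝ) ≤ ((2 ^ (4 * s) : ℕ) : ℝ) := by exact_mod_cast h₃
    _ = (2 : ℝ) ^ ((4 * s : ℕ) : ℝ) := by rw [Real.rpow_natCast]; push_cast; rfl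
    _ ≤ _ := by
      refine Real.rpow_le_rpow_of_exponent_le one_le_two ?_
      push_cast
      linarith

end SquareColorSystem.Valid

/-- A small `U` might have a logarithm below `ρ + 2`; then `|U| ≤ η ^ 3`, no capacity binds, and `ε
= 0` makes the greedy selection optimal. In all other cases `ε = 1` works, and since the logarithm
is at least `1` it is below its fourth power. -/
theorem HSCInstance.Valid.factor_le {I : HSCInstance} (hI : I.Valid) {n : ℕ} (hn : 2 ≤ n)
    (h : n = I.gridCard ∨ n = I.U.length) :
    ∃ ε : ℕ, (1 ≤ ε ∨ I.U.length ≤ I.eta ^ 3) ∧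
      ((1 + ε * (I.depth + 1) : ℕ) : ℝ) ≤ 1 * Real.logb 2 n ^ 4 := by
  have h₁ : 1 ≤ Real.logb 2 n := by
    rw [Real.le_logb_iff_rpow_le one_lt_two (by exact_mod_cast (by omega : 0 < n)), Real.rpow_one]
    exact_mod_cast hn
  have h₂ : Real.logb 2 n ≤ Real.logb 2 n ^ 4 := le_self_pow₀ h₁ (by omega)
  rw [one_mul]
  by_cases hU : n = I.U.length ∧ I.U.length ≤ I.eta ^ 3
  · refine ⟨0, Or.inr hU.2, ?_⟩
    simp only [zero_mul, add_zero, Nat.cast_one]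
    linarith
  · refine ⟨1, Or.inl le_rfl, ?_⟩
    have h₃ : (I.depth + 2 : ℝ) ≤ Real.logb 2 n := by
      rcases h with rfl | rfl
      · exact hI.system.depth_le_logb
      · exact hI.system.depth_le_logb_of_lt (by simpa using hU)
    push_cast
    linarith

/-! ### Events that occur for every stream of random bits -/

namespace RandRAM

instance : IsProbabilityMeasure coinMeasure := by
  unfold coinMeasure
  infer_instance

theorem one_sub_le_coinMeasure {p : (ℕ → Bool) → Prop} (hp : ∀ ω, p ω) (n : ℝ) (hn : 0 ≤ n) (K : ℕ) :
    1 - 1 / n ^ K ≤ coinMeasure.real {ω | p ω} := by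
  rw [show {ω | p ω} = Set.univ from Set.eq_univ_of_forall hp, probReal_univ]
  have : 0 ≤ 1 / n ^ K := by positivity
  linarith

end RandRAM

/-- The programs use no random bits: the selection is greedy, square by square from the inside to
the outside, so that the bounds hold for every stream of random bits. -/
theorem theorem6p1 :
    (∃ C : ℝ, 0 < C ∧ ∀ K : ℕ, ∃ (A : RandRAM.Prog) (p : Polynomial ℕ),
      ∀ I : HSCInstance, I.Valid →
        (∀ ω : ℕ → Bool, ∃ t f S, t ≤ p.eval I.size ∧ I.Feasible f S ∧
          RandRAM.Outputs A I.encode ω (I.encodeSolution f S) t) ∧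
        ∀ n : ℕ, 2 ≤ n → (n = I.gridCard ∨ n = I.U.length) →
          1 - 1 / (n : ℝ) ^ K ≤ RandRAM.coinMeasure.real
            {ω | ∃ t f S, I.IsApprox (C * Real.logb 2 n ^ 4) f S ∧
              RandRAM.Outputs A I.encode ω (I.encodeSolution f S) t}) ∧
    (∃ C : ℝ, 0 < C ∧ ∀ K : ℕ, ∃ (A : RandRAM.Prog) (p : Polynomial ℕ),
      ∀ I : DemandInstance, I.Valid →
        (∀ ω : ℕ → Bool, ∃ t f S, t ≤ p.eval I.size ∧ I.Perfect f S ∧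
          RandRAM.Outputs A I.encode ω (I.encodeSolution f S) t) ∧
        1 - 1 / (I.gridCard : ℝ) ^ K ≤ RandRAM.coinMeasure.real
          {ω | ∃ t f S, I.IsApprox ((2 : ℝ) ^ (C * Real.sqrt (Real.logb 2 I.gridCard))) f S ∧
            RandRAM.Outputs A I.encode ω (I.encodeSolution f S) t}) := by
  refine ⟨⟨1, one_pos, fun K => ⟨RandRAM.selectProg 0 RandRAM.endpointE RandRAM.sideE,
    RandRAM.selectCost 0 RandRAM.endpointE RandRAM.sideE,
    fun I hI => ⟨fun ω => ?_, fun n hn hnI => ?_⟩⟩⟩,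
    ⟨8, by norm_num, fun K => ⟨RandRAM.selectProg 1 (RandRAM.entryE 0) RandRAM.distinctE,
    RandRAM.selectCost 1 (RandRAM.entryE 0) RandRAM.distinctE,
    fun I hI => ⟨fun ω => ?_, ?_⟩⟩⟩⟩
  · obtain ⟨T, f, S, hT, hS, _, hout⟩ := hI.exists_outputs ω
    exact ⟨T, f, S, hT, hS, hout⟩
  · refine RandRAM.one_sub_le_coinMeasure (fun ω => ?_) _ (Nat.cast_nonneg n) K
    obtain ⟨T, f, S, _, hS, hbound, hout⟩ := hI.exists_outputs ω
    obtain ⟨ε, hε, hle⟩ := hI.factor_le hn hnI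
    refine ⟨T, f, S, ⟨hS, fun f' S' hS' => ?_⟩, hout⟩
    have h : (S'.card : ℝ) ≤ ((1 + ε * (I.depth + 1) : ℕ) : ℝ) * S.card := by
      exact_mod_cast hbound ε hε f' S' hS'
    exact h.trans (mul_le_mul_of_nonneg_right hle (Nat.cast_nonneg _))
  · obtain ⟨T, f, S, hT, hS, _, hout⟩ := hI.exists_outputs ω
    exact ⟨T, f, S, hT, hS, hout⟩
  · refine RandRAM.one_sub_le_coinMeasure (fun ω => ?_) _ (Nat.cast_nonneg _) K
    obtain ⟨T, f, S, _, hS, hbound, hout⟩ := hI.exists_outputs ω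
    refine ⟨T, f, S, ⟨hS, fun f' S' hS' => ?_⟩, hout⟩
    have h : (S'.card : ℝ) ≤ ((I.eta ^ 3 * (I.depth + 2) : ℕ) : ℝ) * S.card := by
      rw [← Nat.cast_mul, mul_assoc]
      exact_mod_cast hbound f' S' hS'
    exact h.trans (mul_le_mul_of_nonneg_right hI.system.eta_pow_mul_depth_le (Nat.cast_nonneg _))
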